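/- **Setting.** Let $\rho_1,\sigma_1\in H^2(-1,0)$ and $\rho_2,\sigma_2\in H^2(0,1)$ be uniformly positive (identified with their continuous representatives on the closed intervals), let $q_1\in L^1(-1,0)$ and $q_2\in L^1(0,1)$ be nonnegative, and let $M>0$. Put $$\gamma_1=\int_{-1}^0\sqrt{\rho_1/\sigma_1}\,dx,\qquad \gamma_2=\int_0^1\sqrt{\rho_2/\sigma_2}\,dx .$$ Consider the eigenvalue problem (solutions $u,v$ of class $C^1$ with $\sigma_1u'$, $\sigma_2v'$ absolutely continuous and the equations holding almost everywhere, $(u,v)\neq(0,0)$) $$-(\sigma_1u')'+q_1u=\lambda\rho_1u\ \text{ on }(-1,0),\qquad -(\sigma_2v')'+q_2v=\lambda\rho_2v\ \text{ on }(0,1),$$ $$u(-1)=v(1)=0,\qquad u(0)=v(0),\qquad \sigma_1(0)u'(0)-\sigma_2(0)v'(0)=\lambda M\,u(0).$$ Its real eigenvalues form an infinite strictly increasing sequence of positive numbers $0<\lambda_1<\lambda_2<\cdots$. Put $\sqrt{\lambda_{-n}}:=-\sqrt{\lambda_n}$ for $n\ge1$, and $\mathbb Z^*=\mathbb Z\setminus\{0\}$.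 For $n\in\mathbb Z^*$, let $n+1$, $n-1$, $n+2$ denote the neighbours of $n$ in the ordered set $\mathbb Z^*$ (so the successor of $-1$ is $1$), and let $\delta_n=\sqrt{\lambda_{n+1}}-\sqrt{\lambda_n}$. Call $A\subset\mathbb Z^*$ a *pairing set* if $n\in A$ implies $n+1\notin A$, and $\inf_{n\notin A}\delta_n>0$. (Thus the close consecutive frequencies are grouped into the disjoint pairs $\{n,n+1\}$, $n\in A$.) Let $B=\{n\in\mathbb Z^*: n-1\notin A,\ n\notin A\}$ be the set of unpaired indices, and for $a=(a_n)_{n\in\mathbb Z^*}\subset\mathbb C$ put $$N_A(a)=\sum_{n\in A}\left[\delta_n^2\left(|a_n|^2+|a_{n+1}|^2\right)+|a_{n+1}+a_n|^2\right]+\sum_{n\in B}|a_n|^2\in[0,\infty].$$ **Lemma.** (i) There is $\delta>0$ with $\sqrt{\lambda_{n+2}}-\sqrt{\lambda_n}>2\delta$ for all $n\in\mathbb Z^*$ and such that, for every $0<\delta'\le\delta$, the set $A=\{n:\delta_{n-1}\ge\delta',\ \delta_n<\delta'\}$ is a pairing set. (ii) Let $A$ be any pairing set and let $T>2(\gamma_1+\gamma_2)$.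 Then there are constants $C_1,C_2>0$ such that for every family $a=(a_n)_{n\in\mathbb Z^*}$ of complex numbers: if $N_A(a)<\infty$, then $\sum_{n\in\mathbb Z^*}a_ne^{i\sqrt{\lambda_n}t}$ has a sum in $L^2(0,T)$; and every sum $f=\sum_{n\in\mathbb Z^*}a_ne^{i\sqrt{\lambda_n}t}$ in $L^2(0,T)$ satisfies $$C_1\,N_A(a)\le\int_0^T\Big|\sum_{n\in\mathbb Z^*}a_ne^{i\sqrt{\lambda_n}t}\Big|^2dt\le C_2\,N_A(a).$$ Here $f\in L^2(0,T)$ is called a sum of the series if the partial sums over some sequence of finite subsets of $\mathbb Z^*$, eventually containing each given finite subset, converge to $f$ in $L^2(0,T)$; this includes all finite sums. -/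

import Mathlib

noncomputable section

namespace StringMass

open MeasureTheory Set Filter Topology

/-- `f` is (the continuously differentiable representative of) an element of the Sobolev space
`H²(a, b)`: it is `C¹` on `[a, b]`, its derivative is absolutely continuous, and the second
derivative is square integrable. -/
def MemH2 (a b : ℝ) (f : ℝ → ℝ) : Prop :=
  ∃ f' f'' : ℝ → ℝ,
    MemLp f'' 2 (volume.restrict (Ioc a b)) ∧
    (∀ x ∈ Icc a b, HasDerivWithinAt f (f' x) (Icc a b) x) ∧
    ∀ x ∈ Icc a b, f' x = f' a + ∫ t in a..x, f'' t

/-- Density `ρ`, tension `σ` and potential `q` of a string occupying `[a, b]`: `ρ` and `σ` are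
uniformly positive and of class `H²`, `q` is nonnegative and of class `L¹`. -/
structure IsStringCoeff (a b : ℝ) (ρ σ q : ℝ → ℝ) : Prop where
  rho_mem : MemH2 a b ρ
  sigma_mem : MemH2 a b σ
  q_integrable : IntegrableOn q (Ioc a b)
  rho_pos : ∃ c > 0, ∀ x ∈ Icc a b, c ≤ ρ x
  sigma_pos : ∃ c > 0, ∀ x ∈ Icc a b, c ≤ σ x
  q_nonneg : ∀ᵐ x ∂(volume.restrict (Ioc a b)), 0 ≤ q x

/-- Optical length `∫ₐᵇ √(ρ/σ)` of a string. -/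
def travelTime (a b : ℝ) (ρ σ : ℝ → ℝ) : ℝ :=
  ∫ x in a..b, Real.sqrt (ρ x / σ x)

/-- `y` solves `-(σ y')' + q y = l ρ y` on `[a, b]`, where `p = σ y'` is absolutely continuous and
the equation holds almost everywhere (written in integrated form for `p`). -/
def IsSLSolution (a b : ℝ) (ρ σ q : ℝ → ℝ) (l : ℝ) (y p : ℝ → ℝ) : Prop :=
  (∀ x ∈ Icc a b, HasDerivWithinAt y (p x / σ x) (Icc a b) x) ∧
  ∀ x ∈ Icc a b, p x = p a + ∫ t in a..x, (q t - l * ρ t) * y t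

/-- `l` is an eigenvalue of the two strings on `[-1, 0]` and `[0, 1]`, fixed at `-1` and at `1` and
joined at `0` by a point mass `M`. Here `p₁ = σ₁ u'` and `p₂ = σ₂ v'`. -/
def IsEigenvalue (ρ₁ σ₁ q₁ ρ₂ σ₂ q₂ : ℝ → ℝ) (M l : ℝ) : Prop :=
  ∃ u p₁ v p₂ : ℝ → ℝ,
    IsSLSolution (-1) 0 ρ₁ σ₁ q₁ l u p₁ ∧
    IsSLSolution 0 1 ρ₂ σ₂ q₂ l v p₂ ∧
    u (-1) = 0 ∧ v 1 = 0 ∧ u 0 = v 0 ∧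
    p₁ 0 - p₂ 0 = l * M * u 0 ∧
    ((∃ x ∈ Icc (-1 : ℝ) 0, u x ≠ 0) ∨ ∃ x ∈ Icc (0 : ℝ) 1, v x ≠ 0)

/-- The doubly infinite family of frequencies `±√λ`, listed in increasing order by `ℤ`, where `lam k`
is the `(k + 1)`-st eigenvalue `λ_{k+1}`. The nonzero integers, in their order, are relabelled by
all integers: `n ≥ 0` stands for the positive index `n + 1`, and `n < 0` for the index `n` itself;
so the successor of the index `-1` among the nonzero integers is the index `1`. -/
def freq (lam : ℕ → ℝ) : ℤ → ℝ
  | Int.ofNat k => Real.sqrt (lam k)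
  | Int.negSucc k => -Real.sqrt (lam k)

/-- The gap `δ_n` between consecutive frequencies. -/
def gap (ω : ℤ → ℝ) (n : ℤ) : ℝ := ω (n + 1) - ω n

/-- First indices of the pairs of frequencies closer than `d`, whose left neighbour is at a
distance at least `d`. -/
def closePairs (ω : ℤ → ℝ) (d : ℝ) : Set ℤ :=
  {n | d ≤ gap ω (n - 1) ∧ gap ω n < d}

/-- `A` collects the first indices of all close pairs of frequencies: the pairs `{n, n + 1}`,
`n ∈ A`, are disjoint, and the gaps `δ_n` with `n ∉ A` are bounded away from zero. -/
def IsPairing (ω : ℤ → ℝ) (A : Set ℤ) : Prop :=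
  (∀ n ∈ A, n + 1 ∉ A) ∧ ∃ c > 0, ∀ n, n ∉ A → c ≤ gap ω n

/-- The indices that belong to no pair. -/
def isolated (A : Set ℤ) : Set ℤ := {n | n - 1 ∉ A ∧ n ∉ A}

/-- The (squared) divided-difference norm of the coefficients, possibly infinite. -/
def ddNorm (ω : ℤ → ℝ) (A : Set ℤ) (a : ℤ → ℂ) : ENNReal :=
  (∑' n : A, ENNReal.ofReal
      ((‖a n‖ ^ 2 + ‖a (n + 1)‖ ^ 2) * gap ω n ^ 2 + ‖a (n + 1) + a n‖ ^ 2)) +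
    ∑' n : isolated A, ENNReal.ofReal (‖a n‖ ^ 2)

/-- `f = ∑ a_n e^{i ω_n t}` in `L²(0, T)`: the partial sums over some sequence of finite index sets
that exhausts `ℤ` converge to `f` in `L²(0, T)`. (Ordinary, symmetric, and pairwise grouped
convergence are all instances.) -/
def IsExpSum (T : ℝ) (ω : ℤ → ℝ) (a : ℤ → ℂ) (f : ℝ → ℂ) : Prop :=
  MemLp f 2 (volume.restrict (Ioc 0 T)) ∧
  ∃ F : ℕ → Finset ℤ, Tendsto F atTop atTop ∧
    Tendsto (fun k => eLpNorm
        (fun t : ℝ => f t - ∑ n ∈ F k, a n * Complex.exp (Complex.I * (ω n : ℂ) * (t : ℂ)))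
        2 (volume.restrict (Ioc 0 T)))
      atTop (𝓝 0)

end StringMass

end

namespace StringMass

open MeasureTheory Set Filter Topology

/-! The frequencies are zeros of a band-limited function, and such a function can be used to test
exponential sums. Let G be the Fourier transform of a finite complex measure on [0, T], with G(ω_n)
= 0 for all n. For finite sums f = Σ a_n e^{iω_n t} and g = Σ b_n e^{iω_n t}, integrate the
convolution (f ∗ g)(s) against that measure. A cross term gives a divided difference of G between
two of its zeros, which is 0; the diagonal leaves -i Σ a_n b_n G'(ω_n). Since |(f ∗ g)(s)| ≤ l‖f‖² +
l⁻¹‖g‖² for s in [0, T], an upper estimate for g, combined with a choice of b by duality, becomes a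
lower estimate for f in terms of the numbers a_n G'(ω_n). This is carried by
`IsBand.exists_norm_sum_mul_deriv_le` and `IsPairing.exists_sum_ddTerm_le`. The upper estimate is a
Bessel inequality for separated frequencies, extended to close pairs by writing the difference of
two exponentials as an average over the frequencies between them.

It remains to construct G. Liouville's transformation turns each string into an equation with
integrable potential in the optical coordinate τ. The solution vanishing at the outer end is, as a
function of the frequency, the cosine transform of a kernel supported in |t| ≤ τ(x): finite speed of
propagation. Hence the values φ_i and momenta P_i at the junction have band [-γ_i, γ_i], and the
characteristic function F = Mω²φ₁φ₂ - P₁φ₂ - P₂φ₁ has band [-(γ₁+γ₂), γ₁+γ₂]. A phase factor moves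
this band to [0, 2(γ₁+γ₂)], which lies in [0, T].

The estimates on F' come from F(ω) = K sin(γ₁ω) sin(γ₂ω) + O(1/|ω|), by which F, F' and F'' are
never small together far out (`IsCharacteristic.exists_nondegenerate`). So three zeros cannot
cluster, and |F'| at a zero is bounded below by a multiple of the distance to the neighbouring
zeros, capped at 1. By the trapezoidal rule the derivatives of G at the two members of a pair cancel
up to the square of the gap. These facts are what recovers the divided-difference norm from the
numbers a_n G'(ω_n). Wronskian identities show that the nonzero zeros of F are simple, and
interlacing with the zeros of φ₁φ₂ keeps the gaps bounded. -/

/-- The exponential `t ↦ e^{ixt}`. -/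
noncomputable def expI (x t : ℝ) : ℂ := Complex.exp (Complex.I * (x : ℂ) * (t : ℂ))

theorem norm_expI (x t : ℝ) : ‖expI x t‖ = 1 := by
  have : Complex.I * (x : ℂ) * (t : ℂ) = ((x * t : ℝ) : ℂ) * Complex.I := by push_cast; ring
  rw [expI, this, Complex.norm_exp_ofReal_mul_I]

theorem continuous_expI (x : ℝ) : Continuous (expI x) := by
  unfold expI; fun_prop

theorem continuous_expI_left (t : ℝ) : Continuous fun x => expI x t := by
  unfold expI; fun_prop

theorem expI_add_left (x y t : ℝ) : expI (x + y) t = expI x t * expI y t := by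
  rw [expI, expI, expI, ← Complex.exp_add]; push_cast; ring_nf

theorem expI_add_right (x s t : ℝ) : expI x (s + t) = expI x s * expI x t := by
  rw [expI, expI, expI, ← Complex.exp_add]; push_cast; ring_nf

theorem conj_expI (x t : ℝ) : (starRingEnd ℂ) (expI x t) = expI (-x) t := by
  rw [expI, expI, ← Complex.exp_conj]; simp

/-! ### Bessel inequality for separated frequencies -/

theorem integrable_exp_neg_abs : Integrable fun t : ℝ => Real.exp (-|t|) := by
  rw [← integrableOn_univ, ← Iic_union_Ioi (a := (0 : ℝ))]
  refine IntegrableOn.union ?_ ?_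
  · refine (integrableOn_exp_Iic 0).congr_fun (fun t ht => ?_) measurableSet_Iic
    simp [abs_of_nonpos (mem_Iic.1 ht)]
  · refine (integrableOn_exp_neg_Ioi 0).congr_fun (fun t ht => ?_) measurableSet_Ioi
    simp [abs_of_pos (mem_Ioi.1 ht)]

theorem integrable_exp_neg_abs_mul {f : ℝ → ℂ} (hf : Continuous f) {C : ℝ}
    (hC : ∀ t, ‖f t‖ ≤ C) :
    Integrable fun t : ℝ => (Real.exp (-|t|) : ℂ) * f t :=
  (integrable_exp_neg_abs.ofReal (𝕜 := ℂ)).mul_bdd (c := C) hf.aestronglyMeasurable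
    (Eventually.of_forall hC)

/-- The weight e^{-|t|} is bounded below on [0, T] and has an explicit, nonnegative, decaying
transform, so a weighted L² norm of an exponential sum is an explicit quadratic form in its
coefficients. -/
theorem integral_exp_neg_abs_mul_expI (x : ℝ) :
    ∫ t : ℝ, (Real.exp (-|t|) : ℂ) * expI x t = ((2 / (1 + x ^ 2) : ℝ) : ℂ) := by
  have hi := integrable_exp_neg_abs_mul (continuous_expI x) (fun t => (norm_expI x t).le)
  rw [← integral_add_compl (measurableSet_Iic (a := (0 : ℝ))) hi, compl_Iic]
  have h1 : ∫ t in Iic (0 : ℝ), (Real.exp (-|t|) : ℂ) * expI x t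
      = ∫ t in Iic (0 : ℝ), Complex.exp ((1 + Complex.I * x) * t) := by
    refine setIntegral_congr_fun measurableSet_Iic fun t ht => ?_
    simp only [abs_of_nonpos (mem_Iic.1 ht), expI, neg_neg, Complex.ofReal_exp, ← Complex.exp_add]
    ring_nf
  have h2 : ∫ t in Ioi (0 : ℝ), (Real.exp (-|t|) : ℂ) * expI x t
      = ∫ t in Ioi (0 : ℝ), Complex.exp ((-1 + Complex.I * x) * t) := by
    refine setIntegral_congr_fun measurableSet_Ioi fun t ht => ?_
    simp only [abs_of_pos (mem_Ioi.1 ht), expI, Complex.ofReal_exp, ← Complex.exp_add]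
    push_cast
    ring_nf
  rw [h1, h2, integral_exp_mul_complex_Iic (by simp), integral_exp_mul_complex_Ioi (by simp)]
  have n1 : (1 + Complex.I * x : ℂ) ≠ 0 := fun h => by simpa using congrArg Complex.re h
  have n2 : (-1 + Complex.I * x : ℂ) ≠ 0 := fun h => by simpa using congrArg Complex.re h
  have n3 : (1 + (x : ℂ) ^ 2) ≠ 0 := by
    have : (0 : ℝ) < 1 + x ^ 2 := by positivity
    exact_mod_cast this.ne'
  have key : (1 + Complex.I * x : ℂ) * (-1 + Complex.I * x) = -(1 + (x : ℂ) ^ 2) := by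
    ring_nf; rw [Complex.I_sq]; ring
  simp only [Complex.ofReal_zero, mul_zero, Complex.exp_zero]
  push_cast
  rw [div_add_div _ _ n1 n2, key]
  field_simp
  ring

/-- Points of a set of reals whose mutual distances are at least `c` do not accumulate. -/
theorem exists_sum_poisson_le (c : ℝ) (hc : 0 < c) :
    ∃ C > 0, ∀ (E : Finset ℤ) (x : ℤ → ℝ),
      (∀ i ∈ E, ∀ j ∈ E, i ≠ j → c ≤ |x i - x j|) →
      ∀ y : ℝ, ∑ j ∈ E, 2 / (1 + (y - x j) ^ 2) ≤ C := by
  have hs : Summable fun m : ℤ => 1 / (1 + (m : ℝ) ^ 2) := by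
    refine Summable.of_nonneg_of_le (fun m => by positivity) (fun m => ?_)
      (((Real.summable_one_div_int_pow (p := 2)).2 (by norm_num)).add
        (summable_of_hasFiniteSupport (f := fun m : ℤ => if m = 0 then (1 : ℝ) else 0)
          ((Set.finite_singleton (0 : ℤ)).subset (by intro m hm; simp at hm; simp [hm]))))
    by_cases hm : m = 0
    · simp [hm]
    · have : (0 : ℝ) < (m : ℝ) ^ 2 := by positivity
      simp only [hm, if_false, add_zero]
      exact one_div_le_one_div_of_le this (by linarith)
  -- With u = (x_j - y)/c and m = ⌊u⌋ one has 1 + m² ≤ 3 + 2u² ≤ K(1 + (y - x_j)²). Separation makes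
  -- j ↦ m injective, so the sum is dominated by Σ 1/(1 + m²) over all integers.
  set K : ℝ := 3 + 2 / c ^ 2
  have hK : 0 < K := by positivity
  have hS : 0 < ∑' m : ℤ, 1 / (1 + (m : ℝ) ^ 2) :=
    hs.tsum_pos (fun m => by positivity) 0 (by norm_num)
  refine ⟨2 * K * ∑' m : ℤ, 1 / (1 + (m : ℝ) ^ 2), by positivity, fun E x hx y => ?_⟩
  set fl : ℤ → ℤ := fun j => ⌊(x j - y) / c⌋
  have hinj : Set.InjOn fl E := by
    intro i hi j hj hij
    by_contra hne
    have h1 := hx i hi j hj hne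
    have h2 := Int.abs_sub_lt_one_of_floor_eq_floor hij
    rw [← sub_div, abs_div, abs_of_pos hc, div_lt_one hc] at h2
    rw [show x i - y - (x j - y) = x i - x j by ring] at h2
    linarith
  have hle : ∀ j ∈ E, 2 / (1 + (y - x j) ^ 2) ≤ 2 * K * (1 / (1 + (fl j : ℝ) ^ 2)) := by
    intro j _
    have f1 : (fl j : ℝ) ≤ (x j - y) / c := Int.floor_le _
    have f2 : (x j - y) / c < fl j + 1 := Int.lt_floor_add_one _
    set u : ℝ := (x j - y) / c with hu
    have hxu : (y - x j) ^ 2 = c ^ 2 * u ^ 2 := by rw [hu]; field_simp; ring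
    have hm : 1 + (fl j : ℝ) ^ 2 ≤ 3 + 2 * u ^ 2 := by
      nlinarith [sq_nonneg (2 * u - fl j), sq_nonneg (u - (fl j : ℝ)), sq_nonneg u]
    have hk : 3 + 2 * u ^ 2 ≤ K * (1 + (y - x j) ^ 2) := by
      rw [hxu]
      have : K * (1 + c ^ 2 * u ^ 2) = 3 + 2 / c ^ 2 + 3 * (c ^ 2 * u ^ 2) + 2 * u ^ 2 := by
        simp only [K]; field_simp; ring
      rw [this]
      have : 0 ≤ 2 / c ^ 2 := by positivity
      nlinarith [sq_nonneg (c * u)]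
    rw [mul_one_div, div_le_div_iff₀ (by positivity) (by positivity)]
    nlinarith
  calc ∑ j ∈ E, 2 / (1 + (y - x j) ^ 2) ≤ ∑ j ∈ E, 2 * K * (1 / (1 + (fl j : ℝ) ^ 2)) :=
        Finset.sum_le_sum hle
    _ = 2 * K * ∑ m ∈ E.image fl, 1 / (1 + (m : ℝ) ^ 2) := by
        rw [← Finset.mul_sum, Finset.sum_image hinj]
    _ ≤ _ := by
        gcongr
        exact hs.sum_le_tsum _ fun m _ => by positivity

/-- Schur's test: b_i b_j ≤ (b_i² + b_j²)/2, and by symmetry both halves reduce to row sums. -/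
theorem sum_sum_mul_le_of_schur {E : Finset ℤ} {k : ℤ → ℤ → ℝ} {C : ℝ}
    (hk : ∀ i j, 0 ≤ k i j) (hsymm : ∀ i j, k i j = k j i)
    (hC : ∀ i ∈ E, ∑ j ∈ E, k i j ≤ C) (b : ℤ → ℝ) :
    ∑ i ∈ E, ∑ j ∈ E, b i * b j * k i j ≤ C * ∑ i ∈ E, b i ^ 2 := by
  have h1 : ∑ i ∈ E, ∑ j ∈ E, b i * b j * k i j
      ≤ ∑ i ∈ E, ∑ j ∈ E, (b i ^ 2 * k i j + b j ^ 2 * k i j) / 2 := by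
    refine Finset.sum_le_sum fun i _ => Finset.sum_le_sum fun j _ => ?_
    nlinarith [mul_nonneg (hk i j) (sq_nonneg (b i - b j))]
  have h2 : ∑ i ∈ E, ∑ j ∈ E, b j ^ 2 * k i j = ∑ i ∈ E, ∑ j ∈ E, b i ^ 2 * k i j := by
    rw [Finset.sum_comm]
    simp_rw [hsymm]
  have h3 : ∑ i ∈ E, ∑ j ∈ E, b i ^ 2 * k i j ≤ C * ∑ i ∈ E, b i ^ 2 := by
    rw [Finset.mul_sum]
    refine Finset.sum_le_sum fun i hi => ?_
    rw [← Finset.mul_sum, mul_comm C]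
    exact mul_le_mul_of_nonneg_left (hC i hi) (sq_nonneg _)
  simp_rw [add_div, Finset.sum_add_distrib, ← Finset.sum_div] at h1
  rw [h2] at h1
  linarith

/-- Upper (Bessel type) inequality for exponential sums with separated frequencies. -/
theorem exists_integral_sq_sum_expI_le (c T : ℝ) (hc : 0 < c) (hT : 0 ≤ T) :
    ∃ C > 0, ∀ (E : Finset ℤ) (x : ℤ → ℝ),
      (∀ i ∈ E, ∀ j ∈ E, i ≠ j → c ≤ |x i - x j|) → ∀ b : ℤ → ℂ,
      ∫ t in (0 : ℝ)..T, ‖∑ i ∈ E, b i * expI (x i) t‖ ^ 2 ≤ C * ∑ i ∈ E, ‖b i‖ ^ 2 := by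
  obtain ⟨C, hC, h⟩ := exists_sum_poisson_le c hc
  refine ⟨Real.exp T * C, by positivity, fun E x hx b => ?_⟩
  set f : ℝ → ℂ := fun t => ∑ i ∈ E, b i * expI (x i) t with hf
  have hfc : Continuous f := continuous_finsetSum _ fun i _ =>
    continuous_const.mul (continuous_expI _)
  have hfb : ∀ t, ‖f t‖ ≤ ∑ i ∈ E, ‖b i‖ := fun t =>
    (norm_sum_le _ _).trans (Finset.sum_le_sum fun i _ => by rw [norm_mul, norm_expI, mul_one])
  have hw : Integrable fun t : ℝ => Real.exp (-|t|) * ‖f t‖ ^ 2 := by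
    refine integrable_exp_neg_abs.mul_bdd (c := (∑ i ∈ E, ‖b i‖) ^ 2)
      (hfc.norm.pow 2).aestronglyMeasurable (Eventually.of_forall fun t => ?_)
    rw [Real.norm_of_nonneg (by positivity)]
    exact pow_le_pow_left₀ (norm_nonneg _) (hfb t) 2
  -- On [0, T] the weight e^T e^{-|t|} is at least 1.
  have h1 : ∫ t in (0 : ℝ)..T, ‖f t‖ ^ 2 ≤ Real.exp T * ∫ t, Real.exp (-|t|) * ‖f t‖ ^ 2 := by
    rw [intervalIntegral.integral_of_le hT, ← integral_const_mul]
    refine (setIntegral_mono_on (Continuous.integrableOn_Ioc (by fun_prop))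
      (hw.const_mul _).integrableOn measurableSet_Ioc fun t ht => ?_).trans
      (setIntegral_le_integral (hw.const_mul _) (Eventually.of_forall fun t => by positivity))
    rw [← mul_assoc, ← Real.exp_add, abs_of_pos ht.1]
    exact le_mul_of_one_le_left (by positivity) (Real.one_le_exp (by linarith [ht.2]))
  have h2 : ((∫ t, Real.exp (-|t|) * ‖f t‖ ^ 2 : ℝ) : ℂ)
      = ∑ i ∈ E, ∑ j ∈ E, b i * (starRingEnd ℂ) (b j) * ((2 / (1 + (x i - x j) ^ 2) : ℝ) : ℂ) := by
    rw [← integral_complex_ofReal]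
    have : ∀ t : ℝ, ((Real.exp (-|t|) * ‖f t‖ ^ 2 : ℝ) : ℂ)
        = ∑ i ∈ E, ∑ j ∈ E, b i * (starRingEnd ℂ) (b j) *
          ((Real.exp (-|t|) : ℂ) * expI (x i - x j) t) := by
      intro t
      have : (((‖f t‖ ^ 2 : ℝ)) : ℂ) = f t * (starRingEnd ℂ) (f t) := by
        rw [Complex.mul_conj, Complex.normSq_eq_norm_sq]
      rw [Complex.ofReal_mul, this, hf, map_sum, Finset.sum_mul_sum, Finset.mul_sum]
      refine Finset.sum_congr rfl fun i _ => ?_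
      rw [Finset.mul_sum]
      refine Finset.sum_congr rfl fun j _ => ?_
      rw [map_mul, conj_expI, sub_eq_add_neg, expI_add_left]
      ring
    simp_rw [this]
    have hi : ∀ i j, Integrable fun t : ℝ => b i * (starRingEnd ℂ) (b j) *
        ((Real.exp (-|t|) : ℂ) * expI (x i - x j) t) := fun i j =>
      (integrable_exp_neg_abs_mul (continuous_expI _) (fun t => (norm_expI _ t).le)).const_mul _
    rw [integral_finsetSum _ fun i _ => integrable_finsetSum _ fun j _ => hi i j]
    refine Finset.sum_congr rfl fun i _ => ?_
    rw [integral_finsetSum _ fun j _ => hi i j]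
    refine Finset.sum_congr rfl fun j _ => ?_
    rw [integral_const_mul, integral_exp_neg_abs_mul_expI]
  have h3 : ∫ t, Real.exp (-|t|) * ‖f t‖ ^ 2 ≤ C * ∑ i ∈ E, ‖b i‖ ^ 2 := by
    have h4 : ∫ t, Real.exp (-|t|) * ‖f t‖ ^ 2
        ≤ ∑ i ∈ E, ∑ j ∈ E, ‖b i‖ * ‖b j‖ * (2 / (1 + (x i - x j) ^ 2)) := by
      refine (le_abs_self _).trans ?_
      rw [← Real.norm_eq_abs, ← Complex.norm_real, h2]
      refine (norm_sum_le _ _).trans (Finset.sum_le_sum fun i _ => (norm_sum_le _ _).trans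
        (Finset.sum_le_sum fun j _ => ?_))
      rw [norm_mul, norm_mul, RCLike.norm_conj, Complex.norm_real,
        Real.norm_of_nonneg (by positivity)]
    refine h4.trans (sum_sum_mul_le_of_schur (k := fun i j => 2 / (1 + (x i - x j) ^ 2))
      (fun i j => by positivity) (fun i j => ?_) (fun i _ => h E x hx (x i)) _)
    rw [← neg_sub (x i) (x j), neg_sq]
  calc _ ≤ Real.exp T * ∫ t, Real.exp (-|t|) * ‖f t‖ ^ 2 := h1
    _ ≤ Real.exp T * (C * ∑ i ∈ E, ‖b i‖ ^ 2) := by gcongr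
    _ = _ := by ring

/-! ### Upper estimate for sums with close pairs -/

open scoped Classical in
/-- The group of terms of an exponential sum led by the index `n`: a pair if `n ∈ A`. -/
noncomputable def pairSum (ω : ℤ → ℝ) (A : Set ℤ) (a : ℤ → ℂ) (n : ℤ) (t : ℝ) : ℂ :=
  a n * expI (ω n) t + if n ∈ A then a (n + 1) * expI (ω (n + 1)) t else 0

open scoped Classical in
/-- The contribution of the group led by `n` to the divided difference norm. -/
noncomputable def ddTerm (ω : ℤ → ℝ) (A : Set ℤ) (a : ℤ → ℂ) (n : ℤ) : ℝ :=
  if n ∈ A then (‖a n‖ ^ 2 + ‖a (n + 1)‖ ^ 2) * gap ω n ^ 2 + ‖a (n + 1) + a n‖ ^ 2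
  else ‖a n‖ ^ 2

/-- First indices of the groups: the elements of `A` and the isolated indices. -/
def leaders (A : Set ℤ) : Set ℤ := {n | n - 1 ∉ A}

theorem ddTerm_nonneg (ω : ℤ → ℝ) (A : Set ℤ) (a : ℤ → ℂ) (n : ℤ) : 0 ≤ ddTerm ω A a n := by
  unfold ddTerm; split_ifs <;> positivity

theorem continuous_pairSum (ω : ℤ → ℝ) (A : Set ℤ) (a : ℤ → ℂ) (n : ℤ) :
    Continuous (pairSum ω A a n) := by
  unfold pairSum
  split_ifs
  · exact (continuous_const.mul (continuous_expI _)).add (continuous_const.mul (continuous_expI _))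
  · exact (continuous_const.mul (continuous_expI _)).add continuous_const

/-- The gap following the last member of a group has an index outside `A`: for a pair {m, m + 1}
this is m + 1, which is where disjointness of the pairs enters. -/
theorem IsPairing.gap_le_sub {ω : ℤ → ℝ} (hω : StrictMono ω) {A : Set ℤ} (hA : IsPairing ω A) :
    ∃ c > 0, ∀ m ∈ leaders A, ∀ n ∈ leaders A, m < n →
      (m ∈ A → ω (m + 1) + c ≤ ω n) ∧ (m ∉ A → ω m + c ≤ ω n) := by
  obtain ⟨h1, c, hc, h2⟩ := hA
  refine ⟨c, hc, fun m hm n hn hmn => ⟨fun hmA => ?_, fun hmA => ?_⟩⟩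
  · have hne : n ≠ m + 1 := fun h => hn (by rw [h]; simpa using hmA)
    have h3 := h2 (m + 1) (h1 m hmA)
    have h4 : ω (m + 1 + 1) ≤ ω n := hω.monotone (by omega)
    unfold gap at h3
    linarith
  · have h3 := h2 m hmA
    have h4 : ω (m + 1) ≤ ω n := hω.monotone (by omega)
    unfold gap at h3
    linarith

-- Each pair is replaced by one point sliding from its first to its second frequency. The separation
-- constant does not depend on the position s, so the Bessel constant will not either.
open scoped Classical in
theorem IsPairing.separated {ω : ℤ → ℝ} (hω : StrictMono ω) {A : Set ℤ} (hA : IsPairing ω A) :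
    ∃ c > 0, ∀ s ∈ Icc (0 : ℝ) 1, ∀ m ∈ leaders A, ∀ n ∈ leaders A, m ≠ n →
      c ≤ |(ω m + if m ∈ A then s * gap ω m else 0) - (ω n + if n ∈ A then s * gap ω n else 0)| := by
  obtain ⟨c, hc, h⟩ := hA.gap_le_sub hω
  have key : ∀ s ∈ Icc (0 : ℝ) 1, ∀ m ∈ leaders A, ∀ n ∈ leaders A, m < n →
      c ≤ (ω n + if n ∈ A then s * gap ω n else 0) - (ω m + if m ∈ A then s * gap ω m else 0) := by
    intro s hs m hm n hn hmn
    have hgap : ∀ k, 0 < gap ω k := fun k => sub_pos.2 (hω (by omega))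
    have h1 : 0 ≤ if n ∈ A then s * gap ω n else 0 := by
      split_ifs
      · exact mul_nonneg hs.1 (hgap n).le
      · exact le_rfl
    obtain ⟨h2, h3⟩ := h m hm n hn hmn
    by_cases hmA : m ∈ A
    · have := h2 hmA
      have h4 : s * gap ω m ≤ gap ω m := mul_le_of_le_one_left (hgap m).le hs.2
      rw [if_pos hmA]
      unfold gap at h4 ⊢
      unfold gap at h1
      linarith
    · have := h3 hmA
      rw [if_neg hmA]
      linarith
  refine ⟨c, hc, fun s hs m hm n hn hmn => ?_⟩
  rcases lt_or_gt_of_ne hmn with hlt | hlt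
  · rw [abs_sub_comm]
    exact (key s hs m hm n hn hlt).trans (le_abs_self _)
  · exact (key s hs n hn m hm hlt).trans (le_abs_self _)

/-- The factor d is the source of the weight `gap ω n ^ 2` in the divided-difference norm. -/
theorem expI_sub_expI (x d t : ℝ) :
    expI (x + d) t - expI x t
      = Complex.I * (t : ℂ) * (d : ℂ) * ∫ s in (0 : ℝ)..1, expI (x + s * d) t := by
  have hd : ∀ s ∈ uIcc (0 : ℝ) 1, HasDerivAt (fun s : ℝ => expI (x + s * d) t)
      (Complex.I * (t : ℂ) * (d : ℂ) * expI (x + s * d) t) s := by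
    intro s _
    have h1 : HasDerivAt (fun s : ℝ => Complex.I * ((x + s * d : ℝ) : ℂ) * (t : ℂ))
        (Complex.I * (d : ℂ) * (t : ℂ)) s := by
      have h0 : HasDerivAt (fun s : ℝ => ((x + s * d : ℝ) : ℂ)) (d : ℂ) s := by
        have := ((hasDerivAt_id s).mul_const d).const_add x
        simpa using this.ofReal_comp
      exact (h0.const_mul Complex.I).mul_const _
    have := h1.cexp
    unfold expI
    convert this using 1
    ring
  have hint : IntervalIntegrable
      (fun s : ℝ => Complex.I * (t : ℂ) * (d : ℂ) * expI (x + s * d) t) volume 0 1 :=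
    Continuous.intervalIntegrable (continuous_const.mul
      ((continuous_expI_left t).comp (by fun_prop))) _ _
  have := intervalIntegral.integral_eq_sub_of_hasDerivAt hd hint
  rw [intervalIntegral.integral_const_mul] at this
  rw [this]
  simp

theorem intervalIntegral_swap_of_continuous {E : Type*} [NormedAddCommGroup E] [NormedSpace ℝ E]
    {F : ℝ → ℝ → E} (hF : Continuous fun p : ℝ × ℝ => F p.1 p.2) {a b c d : ℝ} :
    ∫ x in a..b, ∫ y in c..d, F x y = ∫ y in c..d, ∫ x in a..b, F x y := by
  refine intervalIntegral_intervalIntegral_swap ?_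
  exact (hF.continuousOn.integrableOn_compact (isCompact_uIcc.prod isCompact_uIcc)).mono_set
    (Set.prod_mono uIoc_subset_uIcc uIoc_subset_uIcc)

/-- Cauchy–Schwarz on [0, 1], read off from the nonnegative variance of ‖g‖ about its mean. -/
theorem norm_integral_sq_le {g : ℝ → ℂ} (hg : Continuous g) :
    ‖∫ s in (0 : ℝ)..1, g s‖ ^ 2 ≤ ∫ s in (0 : ℝ)..1, ‖g s‖ ^ 2 := by
  set m := ∫ s in (0 : ℝ)..1, ‖g s‖ with hm
  have h1 : ‖∫ s in (0 : ℝ)..1, g s‖ ≤ m :=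
    intervalIntegral.norm_integral_le_integral_norm zero_le_one
  have h2 : 0 ≤ ∫ s in (0 : ℝ)..1, (‖g s‖ - m) ^ 2 :=
    intervalIntegral.integral_nonneg zero_le_one fun s _ => sq_nonneg _
  have h3 : ∫ s in (0 : ℝ)..1, (‖g s‖ - m) ^ 2
      = (∫ s in (0 : ℝ)..1, ‖g s‖ ^ 2) - 2 * m * m + m ^ 2 := by
    have : ∀ s, (‖g s‖ - m) ^ 2 = ‖g s‖ ^ 2 - 2 * m * ‖g s‖ + m ^ 2 := fun s => by ring
    simp_rw [this]
    rw [intervalIntegral.integral_add, intervalIntegral.integral_sub,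
      intervalIntegral.integral_const_mul]
    · simp [hm]
    all_goals exact Continuous.intervalIntegrable (by fun_prop) _ _
  have h4 : ‖∫ s in (0 : ℝ)..1, g s‖ ^ 2 ≤ m ^ 2 := pow_le_pow_left₀ (norm_nonneg _) h1 2
  nlinarith

open scoped Classical in
/-- Upper estimate of a finite sum of groups by the divided difference norm. -/
theorem IsPairing.exists_integral_sq_sum_pairSum_le {ω : ℤ → ℝ} (hω : StrictMono ω) {A : Set ℤ}
    (hA : IsPairing ω A) {T : ℝ} (hT : 0 ≤ T) :
    ∃ C > 0, ∀ J : Finset ℤ, (∀ n ∈ J, n ∈ leaders A) → ∀ a : ℤ → ℂ,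
      ∫ t in (0 : ℝ)..T, ‖∑ n ∈ J, pairSum ω A a n t‖ ^ 2 ≤ C * ∑ n ∈ J, ddTerm ω A a n := by
  obtain ⟨c, hc, hsep⟩ := hA.separated hω
  obtain ⟨C, hC, hup⟩ := exists_integral_sq_sum_expI_le c T hc hT
  refine ⟨2 * C + 2 * T ^ 2 * C, by positivity, fun J hJ a => ?_⟩
  -- A pair is rewritten as (a_n + a_{n+1}) e^{iω_n t} + it ∫₀¹ a_{n+1} gap_n e^{i(ω_n + s gap_n)t}
  -- ds. The squares of the coefficients u and v are then bounded by the terms of the norm.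
  set u : ℤ → ℂ := fun n => a n + if n ∈ A then a (n + 1) else 0 with hu
  set v : ℤ → ℂ := fun n => if n ∈ A then a (n + 1) * (gap ω n : ℂ) else 0 with hv
  set x : ℝ → ℤ → ℝ := fun s n => ω n + if n ∈ A then s * gap ω n else 0 with hx
  have hx0 : ∀ n, x 0 n = ω n := fun n => by simp [hx]
  have hxc : ∀ n, Continuous fun s => x s n := by
    intro n
    by_cases hn : n ∈ A
    · simp only [hx, hn, if_true]; fun_prop
    · simp only [hx, hn, if_false]; fun_prop
  set g : ℝ → ℝ → ℂ := fun s t => ∑ n ∈ J, v n * expI (x s n) t with hg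
  have hgc : Continuous fun p : ℝ × ℝ => g p.1 p.2 := by
    refine continuous_finsetSum _ fun n _ => continuous_const.mul ?_
    have := hxc n
    unfold expI
    fun_prop
  clear_value u v x g
  have hgs : ∀ t, Continuous fun s => g s t := fun t =>
    hgc.comp (continuous_id.prodMk continuous_const)
  have hgt : ∀ s, Continuous fun t => g s t := fun s =>
    hgc.comp (continuous_const.prodMk continuous_id)
  have hterm : ∀ n t, pairSum ω A a n t = u n * expI (ω n) t
      + Complex.I * (t : ℂ) * ∫ s in (0 : ℝ)..1, v n * expI (x s n) t := by
    intro n t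
    by_cases hn : n ∈ A
    · have h1 := expI_sub_expI (ω n) (gap ω n) t
      have h2 : ω n + gap ω n = ω (n + 1) := by unfold gap; ring
      rw [h2] at h1
      simp only [pairSum, hu, hv, hx, hn, if_true, intervalIntegral.integral_const_mul]
      linear_combination a (n + 1) * h1
    · simp [pairSum, hu, hv, hn]
  have hsum : ∀ t, ∑ n ∈ J, pairSum ω A a n t = ∑ n ∈ J, u n * expI (ω n) t
      + Complex.I * (t : ℂ) * ∫ s in (0 : ℝ)..1, g s t := by
    intro t
    simp_rw [hterm, Finset.sum_add_distrib, ← Finset.mul_sum, hg]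
    rw [intervalIntegral.integral_finsetSum]
    intro n _
    exact Continuous.intervalIntegrable (continuous_const.mul
      ((continuous_expI_left t).comp (hxc n))) _ _
  have hsepJ : ∀ s ∈ Icc (0 : ℝ) 1, ∀ i ∈ J, ∀ j ∈ J, i ≠ j → c ≤ |x s i - x s j| :=
    fun s hs i hi j hj hij => by rw [hx]; exact hsep s hs i (hJ i hi) j (hJ j hj) hij
  have b1 : ∫ t in (0 : ℝ)..T, ‖∑ n ∈ J, u n * expI (ω n) t‖ ^ 2 ≤ C * ∑ n ∈ J, ‖u n‖ ^ 2 := by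
    have := hup J (x 0) (hsepJ 0 (by simp)) u
    simpa only [hx0] using this
  -- After exchanging the integrals, the Bessel inequality applies for each fixed s to the separated
  -- points x s n.
  have b2 : ∫ t in (0 : ℝ)..T, ∫ s in (0 : ℝ)..1, ‖g s t‖ ^ 2 ≤ C * ∑ n ∈ J, ‖v n‖ ^ 2 := by
    rw [intervalIntegral_swap_of_continuous (F := fun t s => ‖g s t‖ ^ 2)
      ((hgc.comp continuous_swap).norm.pow 2)]
    have : ∫ s in (0 : ℝ)..1, (C * ∑ n ∈ J, ‖v n‖ ^ 2) = C * ∑ n ∈ J, ‖v n‖ ^ 2 := by simp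
    rw [← this]
    refine intervalIntegral.integral_mono_on zero_le_one ?_ (by simp) fun s hs => by
      rw [hg]; exact hup J (x s) (hsepJ s hs) v
    exact (intervalIntegral.continuous_parametric_intervalIntegral_of_continuous'
      (f := fun s t => ‖g s t‖ ^ 2) (by
        exact hgc.norm.pow 2) 0 T).intervalIntegrable _ _
  have b3 : ∫ t in (0 : ℝ)..T, ‖∑ n ∈ J, pairSum ω A a n t‖ ^ 2
      ≤ 2 * (∫ t in (0 : ℝ)..T, ‖∑ n ∈ J, u n * expI (ω n) t‖ ^ 2)
        + 2 * T ^ 2 * ∫ t in (0 : ℝ)..T, ∫ s in (0 : ℝ)..1, ‖g s t‖ ^ 2 := by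
    have c0 : Continuous fun t => ∑ n ∈ J, pairSum ω A a n t :=
      continuous_finsetSum _ fun n _ => continuous_pairSum ω A a n
    have c1 : Continuous fun t => ∑ n ∈ J, u n * expI (ω n) t :=
      continuous_finsetSum _ fun n _ => continuous_const.mul (continuous_expI _)
    have c2 : Continuous fun t => ∫ s in (0 : ℝ)..1, ‖g s t‖ ^ 2 :=
      intervalIntegral.continuous_parametric_intervalIntegral_of_continuous'
        (f := fun t s => ‖g s t‖ ^ 2) (by exact (hgc.comp continuous_swap).norm.pow 2) 0 1
    rw [← intervalIntegral.integral_const_mul, ← intervalIntegral.integral_const_mul,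
      ← intervalIntegral.integral_add]
    rotate_left
    · exact Continuous.intervalIntegrable (by fun_prop) _ _
    · exact Continuous.intervalIntegrable (by fun_prop) _ _
    refine intervalIntegral.integral_mono_on hT (Continuous.intervalIntegrable (by fun_prop) _ _)
      (Continuous.intervalIntegrable (by fun_prop) _ _) fun t ht => ?_
    rw [hsum t]
    set X := ∑ n ∈ J, u n * expI (ω n) t
    set Y := ∫ s in (0 : ℝ)..1, g s t
    have hY : ‖Y‖ ^ 2 ≤ ∫ s in (0 : ℝ)..1, ‖g s t‖ ^ 2 := norm_integral_sq_le (hgs t)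
    have hn : ‖X + Complex.I * (t : ℂ) * Y‖ ≤ ‖X‖ + T * ‖Y‖ := by
      refine (norm_add_le _ _).trans ?_
      rw [norm_mul, norm_mul, Complex.norm_I, one_mul, Complex.norm_real,
        Real.norm_of_nonneg ht.1]
      gcongr
      exact ht.2
    have hsq : (‖X‖ + T * ‖Y‖) ^ 2 ≤ 2 * ‖X‖ ^ 2 + 2 * T ^ 2 * ‖Y‖ ^ 2 := by
      nlinarith [sq_nonneg (‖X‖ - T * ‖Y‖)]
    calc _ ≤ (‖X‖ + T * ‖Y‖) ^ 2 := pow_le_pow_left₀ (norm_nonneg _) hn 2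
      _ ≤ _ := hsq
      _ ≤ _ := by gcongr
  have hu' : ∀ n, ‖u n‖ ^ 2 ≤ ddTerm ω A a n := by
    intro n
    by_cases hn : n ∈ A
    · simp only [hu, ddTerm, hn, if_true, add_comm (a n)]
      have : 0 ≤ (‖a n‖ ^ 2 + ‖a (n + 1)‖ ^ 2) * gap ω n ^ 2 := by positivity
      linarith
    · simp [hu, ddTerm, hn]
  have hv' : ∀ n, ‖v n‖ ^ 2 ≤ ddTerm ω A a n := by
    intro n
    by_cases hn : n ∈ A
    · simp only [hv, ddTerm, hn, if_true, norm_mul, mul_pow, Complex.norm_real, Real.norm_eq_abs,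
        sq_abs]
      have h1 : 0 ≤ ‖a n‖ ^ 2 * gap ω n ^ 2 := by positivity
      have h2 : 0 ≤ ‖a (n + 1) + a n‖ ^ 2 := by positivity
      linarith
    · simp only [hv, hn, if_false, norm_zero]
      simpa using ddTerm_nonneg ω A a n
  have hU := Finset.sum_le_sum fun n (_ : n ∈ J) => hu' n
  have hV := Finset.sum_le_sum fun n (_ : n ∈ J) => hv' n
  calc _ ≤ _ := b3
    _ ≤ 2 * (C * ∑ n ∈ J, ‖u n‖ ^ 2) + 2 * T ^ 2 * (C * ∑ n ∈ J, ‖v n‖ ^ 2) := by gcongr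
    _ ≤ 2 * (C * ∑ n ∈ J, ddTerm ω A a n) + 2 * T ^ 2 * (C * ∑ n ∈ J, ddTerm ω A a n) := by gcongr
    _ = _ := by ring

/-! ### Band-limited functions -/

/-- `F` is the Fourier transform of a finite complex measure carried by `[lo, hi]`, given as
`F ω = ∫ θ e^{iωs}`. -/
def IsBand (lo hi : ℝ) (F : ℝ → ℂ) : Prop :=
  ∃ (Ω : Type) (_ : MeasurableSpace Ω) (ν : Measure Ω) (_ : SFinite ν) (θ : Ω → ℂ) (s : Ω → ℝ),
    Integrable θ ν ∧ Measurable s ∧ (∀ σ, s σ ∈ Icc lo hi) ∧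
    ∀ ω, F ω = ∫ σ, θ σ * expI ω (s σ) ∂ν

theorem integrable_mul_expI {Ω : Type} [MeasurableSpace Ω] {ν : Measure Ω} {θ : Ω → ℂ}
    {s : Ω → ℝ} (hθ : Integrable θ ν) (hs : Measurable s) (ω : ℝ) :
    Integrable (fun σ => θ σ * expI ω (s σ)) ν :=
  hθ.mul_bdd (c := 1) ((continuous_expI ω).measurable.comp hs).aestronglyMeasurable
    (Eventually.of_forall fun _ => (norm_expI _ _).le)

/-- A point mass. Multiplication by it translates a band, which later moves [-γ, γ] to [0, 2γ]. -/
theorem isBand_expI (s : ℝ) : IsBand s s fun ω => expI ω s :=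
  ⟨Unit, inferInstance, Measure.dirac (), inferInstance, fun _ => 1, fun _ => s,
    integrable_dirac (by simp), measurable_const, fun _ => ⟨le_rfl, le_rfl⟩, fun ω => by simp⟩

theorem IsBand.mono {lo hi lo' hi' : ℝ} {F : ℝ → ℂ} (hF : IsBand lo hi F) (h1 : lo' ≤ lo)
    (h2 : hi ≤ hi') : IsBand lo' hi' F := by
  obtain ⟨Ω, m, ν, hν, θ, s, hθ, hs, hr, h⟩ := hF
  exact ⟨Ω, m, ν, hν, θ, s, hθ, hs, fun σ => ⟨h1.trans (hr σ).1, (hr σ).2.trans h2⟩, h⟩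

theorem IsBand.const_mul {lo hi : ℝ} {F : ℝ → ℂ} (hF : IsBand lo hi F) (c : ℂ) :
    IsBand lo hi fun ω => c * F ω := by
  obtain ⟨Ω, m, ν, hν, θ, s, hθ, hs, hr, h⟩ := hF
  refine ⟨Ω, m, ν, hν, fun σ => c * θ σ, s, hθ.const_mul c, hs, hr, fun ω => ?_⟩
  simp_rw [h, mul_assoc, integral_const_mul]

/-- The parameter space of a sum is the disjoint union of the two parameter spaces. -/
theorem IsBand.add {lo hi : ℝ} {F G : ℝ → ℂ} (hF : IsBand lo hi F) (hG : IsBand lo hi G) :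
    IsBand lo hi fun ω => F ω + G ω := by
  obtain ⟨Ω, m, ν, hν, θ, s, hθ, hs, hr, h⟩ := hF
  obtain ⟨Ω', m', ν', hν', θ', s', hθ', hs', hr', h'⟩ := hG
  have hl : MeasurableEmbedding (Sum.inl : Ω → Ω ⊕ Ω') :=
    ⟨Sum.inl_injective, measurable_inl, fun {_} hs => hs.inl_image⟩
  have hri : MeasurableEmbedding (Sum.inr : Ω' → Ω ⊕ Ω') :=
    ⟨Sum.inr_injective, measurable_inr, fun {_} hs => hs.inr_image⟩
  have hi : ∀ (f : Ω → ℂ) (g : Ω' → ℂ), Integrable f ν → Integrable g ν' →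
      Integrable (Sum.elim f g) (ν.map Sum.inl) ∧ Integrable (Sum.elim f g) (ν'.map Sum.inr) :=
    fun f g hf hg => ⟨(hl.integrable_map_iff).2 (by simpa using hf),
      (hri.integrable_map_iff).2 (by simpa using hg)⟩
  refine ⟨Ω ⊕ Ω', inferInstance, ν.map Sum.inl + ν'.map Sum.inr, inferInstance,
    Sum.elim θ θ', Sum.elim s s', (hi _ _ hθ hθ').1.add_measure (hi _ _ hθ hθ').2,
    hs.sumElim hs', ?_, fun ω => ?_⟩
  · rintro (σ | σ)
    · exact hr σ
    · exact hr' σ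
  · have he : (fun σ => Sum.elim θ θ' σ * expI ω (Sum.elim s s' σ))
        = Sum.elim (fun σ => θ σ * expI ω (s σ)) (fun σ => θ' σ * expI ω (s' σ)) := by
      ext (σ | σ) <;> rfl
    have hi' := hi _ _ (integrable_mul_expI hθ hs ω) (integrable_mul_expI hθ' hs' ω)
    rw [he, integral_add_measure hi'.1 hi'.2, hl.integral_map, hri.integral_map]
    simp [h, h']

/-- The transform of a convolution: on the product of the parameter spaces densities multiply and
positions add. Allowing arbitrary parameter spaces avoids convolving measures on the line. -/
theorem IsBand.mul {lo hi lo' hi' : ℝ} {F G : ℝ → ℂ} (hF : IsBand lo hi F)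
    (hG : IsBand lo' hi' G) : IsBand (lo + lo') (hi + hi') fun ω => F ω * G ω := by
  obtain ⟨Ω, m, ν, hν, θ, s, hθ, hs, hr, h⟩ := hF
  obtain ⟨Ω', m', ν', hν', θ', s', hθ', hs', hr', h'⟩ := hG
  refine ⟨Ω × Ω', inferInstance, ν.prod ν', inferInstance, fun p => θ p.1 * θ' p.2,
    fun p => s p.1 + s' p.2, hθ.mul_prod hθ', (hs.comp measurable_fst).add
    (hs'.comp measurable_snd), fun p => ⟨add_le_add (hr _).1 (hr' _).1,
    add_le_add (hr _).2 (hr' _).2⟩, fun ω => ?_⟩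
  simp only [h, h']
  rw [← integral_prod_mul]
  congr 1
  ext p
  rw [expI_add_right]
  ring

theorem IsBand.exists_bound {lo hi : ℝ} {F : ℝ → ℂ} (hF : IsBand lo hi F) :
    ∃ C > 0, ∀ ω, ‖F ω‖ ≤ C := by
  obtain ⟨Ω, m, ν, hν, θ, s, hθ, hs, hr, h⟩ := hF
  have h0 : 0 ≤ ∫ σ, ‖θ σ‖ ∂ν := integral_nonneg fun σ => norm_nonneg _
  refine ⟨(∫ σ, ‖θ σ‖ ∂ν) + 1, by positivity, fun ω => ?_⟩
  rw [h]
  refine (norm_integral_le_integral_norm _).trans ?_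
  simp_rw [norm_mul, norm_expI, mul_one]
  linarith

theorem hasDerivAt_expI (ω s : ℝ) :
    HasDerivAt (fun ω => expI ω s) (Complex.I * (s : ℂ) * expI ω s) ω := by
  have h1 : HasDerivAt (fun ω : ℝ => Complex.I * (ω : ℂ) * (s : ℂ)) (Complex.I * (s : ℂ)) ω := by
    simpa using ((hasDerivAt_id ω).ofReal_comp.const_mul Complex.I).mul_const (s : ℂ)
  have := h1.cexp
  unfold expI
  convert this using 1
  ring

theorem integrable_mul_I_mul {Ω : Type} [MeasurableSpace Ω] {ν : Measure Ω} {θ : Ω → ℂ}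
    {s : Ω → ℝ} {lo hi : ℝ} (hθ : Integrable θ ν) (hs : Measurable s)
    (hr : ∀ σ, s σ ∈ Icc lo hi) : Integrable (fun σ => θ σ * (Complex.I * (s σ : ℂ))) ν := by
  refine hθ.mul_bdd (c := max |lo| |hi|)
    (measurable_const.mul (Complex.measurable_ofReal.comp hs)).aestronglyMeasurable
    (Eventually.of_forall fun σ => ?_)
  rw [norm_mul, Complex.norm_I, one_mul, Complex.norm_real]
  exact abs_le_max_abs_abs (hr σ).1 (hr σ).2

theorem hasDerivAt_integral_mul_expI {Ω : Type} [MeasurableSpace Ω] {ν : Measure Ω} {θ : Ω → ℂ}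
    {s : Ω → ℝ} {lo hi : ℝ} (hθ : Integrable θ ν) (hs : Measurable s)
    (hr : ∀ σ, s σ ∈ Icc lo hi) (ω : ℝ) :
    HasDerivAt (fun ω => ∫ σ, θ σ * expI ω (s σ) ∂ν)
      (∫ σ, θ σ * (Complex.I * (s σ : ℂ)) * expI ω (s σ) ∂ν) ω := by
  have hθ' := integrable_mul_I_mul hθ hs hr
  refine (hasDerivAt_integral_of_dominated_loc_of_deriv_le (s := univ) univ_mem
    (F := fun ω σ => θ σ * expI ω (s σ))
    (F' := fun ω σ => θ σ * (Complex.I * (s σ : ℂ)) * expI ω (s σ))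
    (bound := fun σ => ‖θ σ * (Complex.I * (s σ : ℂ))‖)
    (Eventually.of_forall fun ω => (integrable_mul_expI hθ hs ω).aestronglyMeasurable)
    (integrable_mul_expI hθ hs ω) (integrable_mul_expI hθ' hs ω).aestronglyMeasurable
    (Eventually.of_forall fun σ x _ => by rw [norm_mul _ (expI _ _), norm_expI, mul_one])
    hθ'.norm (Eventually.of_forall fun σ x _ => ?_)).2
  rw [mul_assoc (θ σ)]
  exact (hasDerivAt_expI x (s σ)).const_mul _

theorem IsBand.differentiable {lo hi : ℝ} {F : ℝ → ℂ} (hF : IsBand lo hi F) :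
    Differentiable ℝ F := by
  obtain ⟨Ω, m, ν, hν, θ, s, hθ, hs, hr, h⟩ := hF
  rw [funext h]
  exact fun ω => (hasDerivAt_integral_mul_expI hθ hs hr ω).differentiableAt

/-- Differentiation multiplies the density by is, which is bounded on the band. Thus all derivatives
of a band-limited function are bounded on the whole line. -/
theorem IsBand.deriv {lo hi : ℝ} {F : ℝ → ℂ} (hF : IsBand lo hi F) : IsBand lo hi (deriv F) := by
  obtain ⟨Ω, m, ν, hν, θ, s, hθ, hs, hr, h⟩ := hF
  refine ⟨Ω, m, ν, hν, _, s, integrable_mul_I_mul hθ hs hr, hs, hr, fun ω => ?_⟩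
  rw [funext h]
  exact (hasDerivAt_integral_mul_expI hθ hs hr ω).deriv

/-! ### Convolution test against a band-limited function -/

/-- A combination of e^{ixs} and e^{iys} alone, hence annihilated by any measure whose transform
vanishes at x and at y. -/
theorem intervalIntegral_expI_convolution {x y : ℝ} (hxy : x ≠ y) (s : ℝ) :
    ∫ r in (0 : ℝ)..s, expI x r * expI y (s - r)
      = (expI x s - expI y s) / (Complex.I * ((x - y : ℝ) : ℂ)) := by
  have hne : Complex.I * ((x - y : ℝ) : ℂ) ≠ 0 :=
    mul_ne_zero Complex.I_ne_zero (by exact_mod_cast sub_ne_zero.2 hxy)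
  have h1 : ∀ r, expI x r * expI y (s - r)
      = expI y s * Complex.exp (Complex.I * ((x - y : ℝ) : ℂ) * r) := by
    intro r
    rw [expI, expI, expI, ← Complex.exp_add, ← Complex.exp_add]
    push_cast
    ring_nf
  simp_rw [h1]
  rw [intervalIntegral.integral_const_mul, integral_exp_mul_complex hne, mul_div_assoc']
  congr 1
  rw [mul_sub, expI, expI, ← Complex.exp_add]
  push_cast
  simp only [mul_zero, Complex.exp_zero, mul_one]
  ring_nf

/-- Weighted arithmetic-geometric mean inequality. The free parameter l is needed later to absorb
the contribution of h. -/
theorem norm_convolution_le {f h : ℝ → ℂ} (hf : Continuous f) (hh : Continuous h) {s T l : ℝ}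
    (hs : s ∈ Icc 0 T) (hl : 0 < l) :
    ‖∫ r in (0 : ℝ)..s, f r * h (s - r)‖
      ≤ l * (∫ t in (0 : ℝ)..T, ‖f t‖ ^ 2) + l⁻¹ * ∫ t in (0 : ℝ)..T, ‖h t‖ ^ 2 := by
  have hmono : ∀ {g : ℝ → ℂ}, Continuous g →
      ∫ t in (0 : ℝ)..s, ‖g t‖ ^ 2 ≤ ∫ t in (0 : ℝ)..T, ‖g t‖ ^ 2 := fun {g} hg =>
    intervalIntegral.integral_mono_interval le_rfl hs.1 hs.2
      (Eventually.of_forall fun t => by positivity)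
      (Continuous.intervalIntegrable (by fun_prop) _ _)
  have hshift : ∫ r in (0 : ℝ)..s, ‖h (s - r)‖ ^ 2 = ∫ t in (0 : ℝ)..s, ‖h t‖ ^ 2 := by
    simpa using intervalIntegral.integral_comp_sub_left (a := 0) (b := s) (fun t => ‖h t‖ ^ 2) s
  calc ‖∫ r in (0 : ℝ)..s, f r * h (s - r)‖
      ≤ ∫ r in (0 : ℝ)..s, ‖f r * h (s - r)‖ :=
        intervalIntegral.norm_integral_le_integral_norm hs.1
    _ ≤ ∫ r in (0 : ℝ)..s, (l * ‖f r‖ ^ 2 + l⁻¹ * ‖h (s - r)‖ ^ 2) := by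
        refine intervalIntegral.integral_mono_on hs.1
          (Continuous.intervalIntegrable (by fun_prop) _ _)
          (Continuous.intervalIntegrable (by fun_prop) _ _) fun r _ => ?_
        rw [norm_mul]
        have h1 : 0 ≤ (l * ‖f r‖ - ‖h (s - r)‖) ^ 2 := sq_nonneg _
        have h2 : l * ‖f r‖ ^ 2 + l⁻¹ * ‖h (s - r)‖ ^ 2 - ‖f r‖ * ‖h (s - r)‖
            = l⁻¹ * ((l * ‖f r‖ - ‖h (s - r)‖) ^ 2 + l * (‖f r‖ * ‖h (s - r)‖)) := by
          field_simp
          ring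
        have h3 : 0 ≤ l⁻¹ * ((l * ‖f r‖ - ‖h (s - r)‖) ^ 2 + l * (‖f r‖ * ‖h (s - r)‖)) := by
          positivity
        linarith
    _ = l * (∫ r in (0 : ℝ)..s, ‖f r‖ ^ 2) + l⁻¹ * ∫ t in (0 : ℝ)..s, ‖h t‖ ^ 2 := by
        rw [intervalIntegral.integral_add, intervalIntegral.integral_const_mul,
          intervalIntegral.integral_const_mul, hshift]
        all_goals exact Continuous.intervalIntegrable (by fun_prop) _ _
    _ ≤ _ := by
        have := hmono hf
        have := hmono hh
        gcongr

/-- If the band limited function `F` vanishes at the frequencies `ω n`, the numbers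
`a n * F' (ω n)` are controlled by the exponential sum with coefficients `a n`. -/
theorem IsBand.exists_norm_sum_mul_deriv_le {T : ℝ} {F : ℝ → ℂ} (hT : 0 ≤ T) (hF : IsBand 0 T F) :
    ∃ K > 0, ∀ (ω : ℤ → ℝ) (E : Finset ℤ), Set.InjOn ω E → (∀ n ∈ E, F (ω n) = 0) →
      ∀ (a b : ℤ → ℂ) (l : ℝ), 0 < l →
      ‖∑ n ∈ E, b n * a n * _root_.deriv F (ω n)‖
        ≤ K * (l * (∫ t in (0 : ℝ)..T, ‖∑ n ∈ E, a n * expI (ω n) t‖ ^ 2)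
          + l⁻¹ * ∫ t in (0 : ℝ)..T, ‖∑ n ∈ E, b n * expI (ω n) t‖ ^ 2) := by
  obtain ⟨Ω, m, ν, hν, θ, s, hθ, hs, hr, h⟩ := hF
  have h0 : 0 ≤ ∫ σ, ‖θ σ‖ ∂ν := integral_nonneg fun σ => norm_nonneg _
  refine ⟨(∫ σ, ‖θ σ‖ ∂ν) + 1, by positivity, fun ω E hinj hz a b l hl => ?_⟩
  set f : ℝ → ℂ := fun t => ∑ n ∈ E, a n * expI (ω n) t with hf
  set g : ℝ → ℂ := fun t => ∑ n ∈ E, b n * expI (ω n) t with hg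
  have hfc : Continuous f := continuous_finsetSum _ fun i _ =>
    continuous_const.mul (continuous_expI _)
  have hgc : Continuous g := continuous_finsetSum _ fun i _ =>
    continuous_const.mul (continuous_expI _)
  set e : ℤ → ℤ → ℝ → ℂ := fun n m s => ∫ r in (0 : ℝ)..s, expI (ω m) r * expI (ω n) (s - r)
    with he
  have hediag : ∀ n s, e n n s = (s : ℂ) * expI (ω n) s := by
    intro n s
    simp only [he, ← expI_add_right, add_sub_cancel]
    simp
  have heoff : ∀ n ∈ E, ∀ m ∈ E, n ≠ m → ∀ s, e n m s
      = (Complex.I * ((ω m - ω n : ℝ) : ℂ))⁻¹ * (expI (ω m) s - expI (ω n) s) := by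
    intro n hn m hm hnm s
    simp only [he]
    rw [intervalIntegral_expI_convolution fun h => hnm (hinj hm hn h).symm, div_eq_inv_mul]
  have hint : ∀ n ∈ E, ∀ m ∈ E, Integrable (fun σ => θ σ * e n m (s σ)) ν := by
    intro n hn m hm
    by_cases hnm : n = m
    · subst hnm
      have := (integrable_mul_expI (integrable_mul_I_mul hθ hs hr) hs (ω n)).const_mul (-Complex.I)
      refine this.congr (Eventually.of_forall fun σ => ?_)
      simp only [hediag]
      linear_combination (-(θ σ * (s σ : ℂ) * expI (ω n) (s σ))) * Complex.I_mul_I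
    · have := ((integrable_mul_expI hθ hs (ω m)).sub
        (integrable_mul_expI hθ hs (ω n))).const_mul (Complex.I * ((ω m - ω n : ℝ) : ℂ))⁻¹
      refine this.congr (Eventually.of_forall fun σ => ?_)
      simp only [heoff n hn m hm hnm, Pi.sub_apply]
      ring
  -- Biorthogonality: off the diagonal the integral is a multiple of F(ω_m) - F(ω_n) = 0; on the
  -- diagonal the convolution is s e^{iω_n s}, whose integral is -iF'(ω_n).
  have hval : ∀ n ∈ E, ∀ m ∈ E, ∫ σ, θ σ * e n m (s σ) ∂ν
      = if n = m then -Complex.I * _root_.deriv F (ω n) else 0 := by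
    intro n hn m hm
    split_ifs with hnm
    · subst hnm
      have hd : _root_.deriv F (ω n)
          = ∫ σ, θ σ * (Complex.I * (s σ : ℂ)) * expI (ω n) (s σ) ∂ν := by
        rw [funext h]
        exact (hasDerivAt_integral_mul_expI hθ hs hr (ω n)).deriv
      rw [hd, ← integral_const_mul]
      congr 1
      ext σ
      rw [hediag]
      linear_combination (θ σ * (s σ : ℂ) * expI (ω n) (s σ)) * Complex.I_mul_I
    · have h1 := hz n hn
      have h2 := hz m hm
      rw [h] at h1 h2
      have : ∀ σ, θ σ * e n m (s σ) = (Complex.I * ((ω m - ω n : ℝ) : ℂ))⁻¹ *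
          (θ σ * expI (ω m) (s σ) - θ σ * expI (ω n) (s σ)) := by
        intro σ
        rw [heoff n hn m hm hnm]
        ring
      simp_rw [this]
      rw [integral_const_mul, integral_sub (integrable_mul_expI hθ hs _)
        (integrable_mul_expI hθ hs _), h1, h2, sub_zero, mul_zero]
  have hconv : ∀ s, ∫ r in (0 : ℝ)..s, f r * g (s - r)
      = ∑ n ∈ E, ∑ m ∈ E, b n * a m * e n m s := by
    intro s
    have : ∀ r, f r * g (s - r)
        = ∑ n ∈ E, ∑ m ∈ E, b n * a m * (expI (ω m) r * expI (ω n) (s - r)) := by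
      intro r
      rw [mul_comm, hf, hg, Finset.sum_mul_sum]
      refine Finset.sum_congr rfl fun n _ => Finset.sum_congr rfl fun m _ => by ring
    simp_rw [this, he]
    have hc : ∀ n m, Continuous fun r => b n * a m * (expI (ω m) r * expI (ω n) (s - r)) :=
      fun n m => continuous_const.mul ((continuous_expI _).mul
        ((continuous_expI _).comp (by fun_prop)))
    rw [intervalIntegral.integral_finsetSum fun n _ =>
      (continuous_finsetSum _ fun m _ => hc n m).intervalIntegrable _ _]
    refine Finset.sum_congr rfl fun n _ => ?_
    rw [intervalIntegral.integral_finsetSum fun m _ => (hc n m).intervalIntegrable _ _]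
    refine Finset.sum_congr rfl fun m _ => ?_
    rw [intervalIntegral.integral_const_mul]
  set R := l * (∫ t in (0 : ℝ)..T, ‖f t‖ ^ 2) + l⁻¹ * ∫ t in (0 : ℝ)..T, ‖g t‖ ^ 2 with hR
  have hbound : ∀ σ, ‖θ σ * ∑ n ∈ E, ∑ m ∈ E, b n * a m * e n m (s σ)‖ ≤ ‖θ σ‖ * R := by
    intro σ
    rw [norm_mul, ← hconv]
    exact mul_le_mul_of_nonneg_left (norm_convolution_le hfc hgc (hr σ) hl) (norm_nonneg _)
  have htot : ∫ σ, θ σ * ∑ n ∈ E, ∑ m ∈ E, b n * a m * e n m (s σ) ∂ν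
      = -Complex.I * ∑ n ∈ E, b n * a n * _root_.deriv F (ω n) := by
    have : ∀ σ, θ σ * ∑ n ∈ E, ∑ m ∈ E, b n * a m * e n m (s σ)
        = ∑ n ∈ E, ∑ m ∈ E, b n * a m * (θ σ * e n m (s σ)) := by
      intro σ
      simp_rw [Finset.mul_sum]
      refine Finset.sum_congr rfl fun n _ => Finset.sum_congr rfl fun m _ => by ring
    simp_rw [this]
    rw [integral_finsetSum _ fun n hn => integrable_finsetSum _ fun m hm =>
      (hint n hn m hm).const_mul _, Finset.mul_sum]
    refine Finset.sum_congr rfl fun n hn => ?_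
    rw [integral_finsetSum _ fun m hm => (hint n hn m hm).const_mul _]
    have : ∀ m ∈ E, ∫ σ, b n * a m * (θ σ * e n m (s σ)) ∂ν
        = if n = m then -Complex.I * (b n * a n * _root_.deriv F (ω n)) else 0 := by
      intro m hm
      rw [integral_const_mul, hval n hn m hm]
      split_ifs with hnm
      · subst hnm; ring
      · simp
    rw [Finset.sum_congr rfl this, Finset.sum_ite_eq, if_pos hn]
  have hR0 : 0 ≤ R := by
    have i1 : 0 ≤ ∫ t in (0 : ℝ)..T, ‖f t‖ ^ 2 :=
      intervalIntegral.integral_nonneg hT fun t _ => by positivity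
    have i2 : 0 ≤ ∫ t in (0 : ℝ)..T, ‖g t‖ ^ 2 :=
      intervalIntegral.integral_nonneg hT fun t _ => by positivity
    positivity
  calc ‖∑ n ∈ E, b n * a n * _root_.deriv F (ω n)‖
      = ‖∫ σ, θ σ * ∑ n ∈ E, ∑ m ∈ E, b n * a m * e n m (s σ) ∂ν‖ := by
        rw [htot, norm_mul, norm_neg, Complex.norm_I, one_mul]
    _ ≤ ∫ σ, ‖θ σ‖ * R ∂ν := norm_integral_le_of_norm_le (hθ.norm.mul_const R)
        (Eventually.of_forall hbound)
    _ = (∫ σ, ‖θ σ‖ ∂ν) * R := integral_mul_const _ _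
    _ ≤ _ := by nlinarith

/-! ### Lower estimate by duality -/

open scoped Classical in
/-- All indices occurring in the groups led by the elements of `J`. -/
noncomputable def members (A : Set ℤ) (J : Finset ℤ) : Finset ℤ :=
  J ∪ (J.filter (· ∈ A)).image (· + 1)

open scoped Classical in
theorem sum_members {M : Type*} [AddCommMonoid M] {A : Set ℤ} {J : Finset ℤ}
    (hJ : ∀ n ∈ J, n ∈ leaders A) (φ : ℤ → M) :
    ∑ n ∈ members A J, φ n = ∑ n ∈ J, (φ n + if n ∈ A then φ (n + 1) else 0) := by
  have hd : Disjoint J ((J.filter (· ∈ A)).image (· + 1)) := by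
    rw [Finset.disjoint_left]
    intro n hn hn'
    obtain ⟨m, hm, rfl⟩ := Finset.mem_image.1 hn'
    have := hJ _ hn
    simp only [leaders, mem_ofPred_eq, add_sub_cancel_right] at this
    exact this (Finset.mem_filter.1 hm).2
  rw [members, Finset.sum_union hd, Finset.sum_image (fun x _ y _ h => by simpa using h),
    Finset.sum_add_distrib, Finset.sum_filter]

theorem sum_pairSum_eq {A : Set ℤ} {J : Finset ℤ} (hJ : ∀ n ∈ J, n ∈ leaders A) (ω : ℤ → ℝ)
    (a : ℤ → ℂ) (t : ℝ) :
    ∑ n ∈ J, pairSum ω A a n t = ∑ n ∈ members A J, a n * expI (ω n) t := by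
  rw [sum_members hJ fun n => a n * expI (ω n) t]
  rfl

/-- Lower bounds for the derivative, at its zeros `ω n`, of the function generating the
frequencies; in each pair the two derivatives are opposite up to a small error. -/
structure DerivBounds (ω : ℤ → ℝ) (A : Set ℤ) (c : ℤ → ℂ) (κ K D : ℝ) : Prop where
  isolated_le : ∀ n, n ∈ leaders A → n ∉ A → κ ≤ ‖c n‖
  first_le : ∀ n ∈ A, κ * gap ω n ≤ ‖c n‖
  second_le : ∀ n ∈ A, κ * gap ω n ≤ ‖c (n + 1)‖
  add_le : ∀ n ∈ A, ‖c n + c (n + 1)‖ ≤ K * gap ω n ^ 2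
  gap_le : ∀ n, gap ω n ≤ D

theorem normSq_conj_mul_self (z : ℂ) : (starRingEnd ℂ) z * z = ((‖z‖ ^ 2 : ℝ) : ℂ) := by
  rw [mul_comm, Complex.mul_conj, Complex.normSq_eq_norm_sq]

-- The convolution test controls the products a_n c_n and, inside a pair, their divided difference.
-- As both c_n and c_{n+1} have size at least κ·gap and their sum is O(gap²), the divided difference
-- of the products dominates a_n + a_{n+1} up to terms of size |a_n|·gap.
open scoped Classical in
theorem DerivBounds.exists_ddTerm_le {ω : ℤ → ℝ} (hω : StrictMono ω) {A : Set ℤ} {c : ℤ → ℂ}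
    {κ K D : ℝ} (hκ : 0 < κ) (hc : DerivBounds ω A c κ K D) :
    ∃ C > 0, ∀ (a : ℤ → ℂ) (n : ℤ), n ∈ leaders A →
      ddTerm ω A a n ≤ C * ((‖a n * c n‖ ^ 2 + if n ∈ A then ‖a (n + 1) * c (n + 1)‖ ^ 2 else 0)
        + if n ∈ A then ‖(a (n + 1) * c (n + 1) - a n * c n) / (gap ω n : ℂ)‖ ^ 2 else 0) := by
  refine ⟨3 / κ ^ 2 + 2 * K ^ 2 / κ ^ 4, by positivity, fun a n hn => ?_⟩
  by_cases hA : n ∈ A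
  · have hg : 0 < gap ω n := sub_pos.2 (hω (by omega))
    simp only [ddTerm, hA, if_true]
    have h1 := hc.first_le n hA
    have h2 := hc.second_le n hA
    have h3 := hc.add_le n hA
    set δ := gap ω n
    set t : ℂ := (a (n + 1) * c (n + 1) - a n * c n) / (δ : ℂ) with ht
    have hδ : (δ : ℂ) ≠ 0 := by exact_mod_cast hg.ne'
    have e1 : κ * (‖a n‖ * δ) ≤ ‖a n * c n‖ := by
      rw [norm_mul]; nlinarith [norm_nonneg (a n)]
    have e2 : κ * (‖a (n + 1)‖ * δ) ≤ ‖a (n + 1) * c (n + 1)‖ := by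
      rw [norm_mul]; nlinarith [norm_nonneg (a (n + 1))]
    -- Here δt is the difference of the products; the remaining term is O(δ²)|a_n|. Dividing by
    -- |c_{n+1}| ≥ κδ loses exactly one power of δ.
    have e3 : (a (n + 1) + a n) * c (n + 1) = δ * t + a n * (c n + c (n + 1)) := by
      rw [ht]; field_simp; ring
    have e4 : κ * ‖a (n + 1) + a n‖ ≤ ‖t‖ + K * (‖a n‖ * δ) := by
      have h5 : ‖a (n + 1) + a n‖ * ‖c (n + 1)‖ ≤ δ * ‖t‖ + ‖a n‖ * ‖c n + c (n + 1)‖ := by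
        rw [← norm_mul, e3]
        refine (norm_add_le _ _).trans (le_of_eq ?_)
        rw [norm_mul, norm_mul, Complex.norm_real, Real.norm_of_nonneg hg.le]
      have h6 : δ * (κ * ‖a (n + 1) + a n‖) ≤ δ * (‖t‖ + K * (‖a n‖ * δ)) := by
        nlinarith [norm_nonneg (a (n + 1) + a n), norm_nonneg (a n),
          mul_le_mul_of_nonneg_left h2 (norm_nonneg (a (n + 1) + a n)),
          mul_le_mul_of_nonneg_left h3 (norm_nonneg (a n))]
      exact le_of_mul_le_mul_left h6 hg
    set x := ‖a n * c n‖
    set y := ‖a (n + 1) * c (n + 1)‖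
    have s1 : κ ^ 2 * (‖a n‖ ^ 2 * δ ^ 2) ≤ x ^ 2 := by
      have := pow_le_pow_left₀ (by positivity) e1 2
      nlinarith
    have s2 : κ ^ 2 * (‖a (n + 1)‖ ^ 2 * δ ^ 2) ≤ y ^ 2 := by
      have := pow_le_pow_left₀ (by positivity) e2 2
      nlinarith
    have s3 : κ ^ 2 * ‖a (n + 1) + a n‖ ^ 2 ≤ 2 * ‖t‖ ^ 2 + 2 * K ^ 2 * (‖a n‖ ^ 2 * δ ^ 2) := by
      have := pow_le_pow_left₀ (by positivity) e4 2
      nlinarith [sq_nonneg (‖t‖ - K * (‖a n‖ * δ))]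
    have s4 : κ ^ 4 * ‖a (n + 1) + a n‖ ^ 2 ≤ 2 * κ ^ 2 * ‖t‖ ^ 2 + 2 * K ^ 2 * x ^ 2 := by
      nlinarith [mul_le_mul_of_nonneg_left s3 (sq_nonneg κ),
        mul_le_mul_of_nonneg_left s1 (sq_nonneg K)]
    have hfin : κ ^ 4 * ((‖a n‖ ^ 2 + ‖a (n + 1)‖ ^ 2) * δ ^ 2 + ‖a (n + 1) + a n‖ ^ 2)
        ≤ (3 * κ ^ 2 + 2 * K ^ 2) * (x ^ 2 + y ^ 2 + ‖t‖ ^ 2) := by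
      nlinarith [mul_le_mul_of_nonneg_left s1 (sq_nonneg κ),
        mul_le_mul_of_nonneg_left s2 (sq_nonneg κ), mul_nonneg (sq_nonneg κ) (sq_nonneg x),
        mul_nonneg (sq_nonneg κ) (sq_nonneg y), mul_nonneg (sq_nonneg κ) (sq_nonneg ‖t‖),
        mul_nonneg (sq_nonneg K) (sq_nonneg y), mul_nonneg (sq_nonneg K) (sq_nonneg ‖t‖)]
    have hC : 3 / κ ^ 2 + 2 * K ^ 2 / κ ^ 4 = (3 * κ ^ 2 + 2 * K ^ 2) / κ ^ 4 := by
      field_simp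
    rw [hC, div_mul_eq_mul_div, le_div_iff₀ (by positivity)]
    linarith
  · simp only [ddTerm, hA, if_false, add_zero]
    have h1 := hc.isolated_le n hn hA
    rw [norm_mul, mul_pow]
    have h2 : κ ^ 2 ≤ ‖c n‖ ^ 2 := pow_le_pow_left₀ hκ.le h1 2
    have h3 : 1 / κ ^ 2 * (‖a n‖ ^ 2 * κ ^ 2) = ‖a n‖ ^ 2 := by field_simp
    have h4 : 1 / κ ^ 2 ≤ 3 / κ ^ 2 + 2 * K ^ 2 / κ ^ 4 := by
      have : 0 ≤ 2 * K ^ 2 / κ ^ 4 := by positivity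
      have : 1 / κ ^ 2 ≤ 3 / κ ^ 2 := by gcongr; norm_num
      linarith
    calc ‖a n‖ ^ 2 = 1 / κ ^ 2 * (‖a n‖ ^ 2 * κ ^ 2) := h3.symm
      _ ≤ _ := by gcongr

open scoped Classical in
/-- Lower estimate of a finite sum of groups by the divided difference norm. -/
theorem IsPairing.exists_sum_ddTerm_le {ω : ℤ → ℝ} (hω : StrictMono ω) {A : Set ℤ}
    (hA : IsPairing ω A) {T : ℝ} (hT : 0 ≤ T) {F : ℝ → ℂ} (hF : IsBand 0 T F)
    (hz : ∀ n, F (ω n) = 0) {κ K D : ℝ} (hκ : 0 < κ)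
    (hc : DerivBounds ω A (fun n => deriv F (ω n)) κ K D) :
    ∃ C > 0, ∀ J : Finset ℤ, (∀ n ∈ J, n ∈ leaders A) → ∀ a : ℤ → ℂ,
      ∑ n ∈ J, ddTerm ω A a n ≤ C * ∫ t in (0 : ℝ)..T, ‖∑ n ∈ J, pairSum ω A a n t‖ ^ 2 := by
  obtain ⟨C₂, hC₂, hup⟩ := hA.exists_integral_sq_sum_pairSum_le hω hT
  obtain ⟨K₀, hK₀, hkey⟩ := hF.exists_norm_sum_mul_deriv_le hT
  obtain ⟨C₃, hC₃, hdd⟩ := hc.exists_ddTerm_le hω hκ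
  set c : ℤ → ℂ := fun n => deriv F (ω n) with hcdef
  -- Duality: for coefficients b whose pairing with a c is ΣX_n and whose norm is at most M ΣX_n,
  -- the test inequality and the upper estimate for b bound ΣX_n by the integral of the sum with
  -- coefficients a.
  have main : ∀ J : Finset ℤ, (∀ n ∈ J, n ∈ leaders A) → ∀ (a b : ℤ → ℂ) (X : ℤ → ℝ) (M : ℝ),
      0 < M → (∀ n ∈ J, (b n * a n * c n + if n ∈ A then b (n + 1) * a (n + 1) * c (n + 1) else 0)
        = (X n : ℂ)) → (∀ n ∈ J, ddTerm ω A b n ≤ M * X n) →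
      ∑ n ∈ J, X n
        ≤ 4 * K₀ ^ 2 * C₂ * M * ∫ t in (0 : ℝ)..T, ‖∑ n ∈ J, pairSum ω A a n t‖ ^ 2 := by
    intro J hJ a b X M hM h1 h2
    -- With this l the contribution of b is at most ΣX_n / 2 and is absorbed on the left.
    set l := 2 * K₀ * C₂ * M with hl
    have hl0 : 0 < l := by positivity
    have h3 := hkey ω (members A J) hω.injective.injOn (fun n _ => hz n) a b l hl0
    simp_rw [← sum_pairSum_eq hJ] at h3
    rw [sum_members hJ fun n => b n * a n * deriv F (ω n), Finset.sum_congr rfl h1,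
      ← Complex.ofReal_sum, Complex.norm_real] at h3
    have h4 := (le_abs_self _).trans h3
    have h5 := hup J hJ b
    have h6 : ∑ n ∈ J, ddTerm ω A b n ≤ M * ∑ n ∈ J, X n := by
      rw [Finset.mul_sum]; exact Finset.sum_le_sum h2
    set I := ∫ t in (0 : ℝ)..T, ‖∑ n ∈ J, pairSum ω A a n t‖ ^ 2
    set S := ∑ n ∈ J, X n
    have h7 : l⁻¹ * (∫ t in (0 : ℝ)..T, ‖∑ n ∈ J, pairSum ω A b n t‖ ^ 2)
        ≤ l⁻¹ * (C₂ * (M * S)) := by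
      gcongr
      exact h5.trans (by gcongr)
    have h8 : K₀ * (l⁻¹ * (C₂ * (M * S))) = S / 2 := by
      rw [hl]; field_simp
    have h9 : S ≤ K₀ * (l * I) + S / 2 := by
      rw [← h8, ← mul_add]
      exact h4.trans (by gcongr)
    have : K₀ * (l * I) = 2 * K₀ ^ 2 * C₂ * M * I := by rw [hl]; ring
    linarith
  have hgap : ∀ n, 0 < gap ω n := fun n => sub_pos.2 (hω (by omega))
  -- Test with b_n the conjugate of a_n c_n, so that X_n is a sum of |a_n c_n|². The factor D² + 2
  -- comes from gap ≤ D and |x + y|² ≤ 2(|x|² + |y|²).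
  have step1 : ∀ J : Finset ℤ, (∀ n ∈ J, n ∈ leaders A) → ∀ a : ℤ → ℂ,
      ∑ n ∈ J, (‖a n * c n‖ ^ 2 + if n ∈ A then ‖a (n + 1) * c (n + 1)‖ ^ 2 else 0)
        ≤ 4 * K₀ ^ 2 * C₂ * (D ^ 2 + 2)
          * ∫ t in (0 : ℝ)..T, ‖∑ n ∈ J, pairSum ω A a n t‖ ^ 2 := by
    intro J hJ a
    refine main J hJ a (fun n => (starRingEnd ℂ) (a n * c n)) _ _ (by positivity)
      (fun n _ => ?_) (fun n _ => ?_)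
    · simp only [mul_assoc, normSq_conj_mul_self]
      split_ifs
      · push_cast; ring
      · push_cast; ring
    · by_cases hn : n ∈ A
      · simp only [ddTerm, hn, if_true, ← map_add, RCLike.norm_conj]
        set x := a n * c n
        set y := a (n + 1) * c (n + 1)
        have h1 : gap ω n ^ 2 ≤ D ^ 2 := pow_le_pow_left₀ (hgap n).le (hc.gap_le n) 2
        have h2 : ‖y + x‖ ^ 2 ≤ 2 * (‖x‖ ^ 2 + ‖y‖ ^ 2) := by
          have := pow_le_pow_left₀ (norm_nonneg _) (norm_add_le y x) 2
          nlinarith [sq_nonneg (‖x‖ - ‖y‖)]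
        nlinarith [mul_le_mul_of_nonneg_left h1 (by positivity : 0 ≤ ‖x‖ ^ 2 + ‖y‖ ^ 2)]
      · simp only [ddTerm, hn, if_false, RCLike.norm_conj, add_zero]
        nlinarith [sq_nonneg D, sq_nonneg ‖a n * c n‖,
          mul_nonneg (sq_nonneg D) (sq_nonneg ‖a n * c n‖)]
  have step2 : ∀ J : Finset ℤ, (∀ n ∈ J, n ∈ leaders A) → ∀ a : ℤ → ℂ,
      ∑ n ∈ J, (if n ∈ A then ‖(a (n + 1) * c (n + 1) - a n * c n) / (gap ω n : ℂ)‖ ^ 2 else 0)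
        ≤ 4 * K₀ ^ 2 * C₂ * 2 * ∫ t in (0 : ℝ)..T, ‖∑ n ∈ J, pairSum ω A a n t‖ ^ 2 := by
    intro J hJ a
    set τ : ℤ → ℂ := fun n => (a (n + 1) * c (n + 1) - a n * c n) / (gap ω n : ℂ) with hτ
    -- Opposite values on the two members of a pair: their sum vanishes, so the norm of b on the
    -- pair is exactly 2|τ_n|² although b itself has size |τ_n|/gap, while the pairing with a c
    -- gives |τ_n|².
    set b : ℤ → ℂ := fun n => if n ∈ A then -((starRingEnd ℂ) (τ n) / (gap ω n : ℂ))
      else if n - 1 ∈ A then (starRingEnd ℂ) (τ (n - 1)) / (gap ω (n - 1) : ℂ) else 0 with hb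
    have b0 : ∀ n ∈ A, b n = -((starRingEnd ℂ) (τ n) / (gap ω n : ℂ)) := fun n hn => by
      simp only [hb, hn, if_true]
    have b1 : ∀ n ∈ A, b (n + 1) = (starRingEnd ℂ) (τ n) / (gap ω n : ℂ) := fun n hn => by
      simp only [hb, hA.1 n hn, if_false, add_sub_cancel_right, hn, if_true]
    have b2 : ∀ n ∈ leaders A, n ∉ A → b n = 0 := fun n hn hn' => by
      simp only [leaders, mem_ofPred_eq] at hn
      simp only [hb, hn', if_false, hn]
    clear_value b
    refine main J hJ a b _ _ two_pos (fun n hn => ?_) (fun n hn => ?_)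
    · by_cases hnA : n ∈ A
      · simp only [hnA, if_true]
        rw [b0 n hnA, b1 n hnA, ← normSq_conj_mul_self]
        have : (gap ω n : ℂ) ≠ 0 := by exact_mod_cast (hgap n).ne'
        have e : τ n * (gap ω n : ℂ) = a (n + 1) * c (n + 1) - a n * c n := by
          simp only [hτ]; field_simp
        change _ = (starRingEnd ℂ) (τ n) * τ n
        have e' : τ n = (a (n + 1) * c (n + 1) - a n * c n) / (gap ω n : ℂ) := rfl
        generalize (starRingEnd ℂ) (τ n) = z
        rw [e']
        field_simp
        ring
      · simp [hnA, b2 n (hJ n hn) hnA]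
    · by_cases hnA : n ∈ A
      · simp only [ddTerm, hnA, if_true]
        rw [b0 n hnA, b1 n hnA]
        have hg := hgap n
        change _ ≤ 2 * ‖τ n‖ ^ 2
        generalize τ n = z
        simp only [norm_neg, norm_div, RCLike.norm_conj, Complex.norm_real, add_neg_cancel,
          Real.norm_of_nonneg hg.le, norm_zero]
        apply le_of_eq
        field_simp
        ring
      · simp [ddTerm, hnA, b2 n (hJ n hn) hnA]
  refine ⟨C₃ * (4 * K₀ ^ 2 * C₂ * (D ^ 2 + 2) + 4 * K₀ ^ 2 * C₂ * 2), by positivity,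
    fun J hJ a => ?_⟩
  calc ∑ n ∈ J, ddTerm ω A a n ≤ _ := Finset.sum_le_sum fun n hn => hdd a n (hJ n hn)
    _ ≤ _ := by
      rw [← Finset.mul_sum, Finset.sum_add_distrib, mul_assoc, add_mul]
      exact mul_le_mul_of_nonneg_left (add_le_add (step1 J hJ a) (step2 J hJ a)) hC₃.le

/-! ### Passage from finite sums to series -/

theorem IsPairing.mem_leaders {ω : ℤ → ℝ} {A : Set ℤ} (hA : IsPairing ω A) {n : ℤ} (hn : n ∈ A) :
    n ∈ leaders A := fun h => hA.1 _ h (by simpa using hn)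

open scoped Classical in
/-- The divided difference norm as a sum over all integers. -/
theorem IsPairing.ddNorm_eq {ω : ℤ → ℝ} {A : Set ℤ} (hA : IsPairing ω A) (a : ℤ → ℂ) :
    ddNorm ω A a = ∑' n : ℤ, if n ∈ leaders A then ENNReal.ofReal (ddTerm ω A a n) else 0 := by
  rw [ddNorm, tsum_subtype A fun n => ENNReal.ofReal
      ((‖a n‖ ^ 2 + ‖a (n + 1)‖ ^ 2) * gap ω n ^ 2 + ‖a (n + 1) + a n‖ ^ 2),
    tsum_subtype (isolated A) fun n => ENNReal.ofReal (‖a n‖ ^ 2), ← ENNReal.tsum_add]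
  refine tsum_congr fun n => ?_
  by_cases h1 : n ∈ A
  · have h2 := hA.mem_leaders h1
    have h3 : n ∉ isolated A := fun h => h.2 h1
    simp [h1, h2, h3, ddTerm]
  · by_cases h2 : n ∈ leaders A
    · have h3 : n ∈ isolated A := ⟨h2, h1⟩
      simp [h1, h2, h3, ddTerm]
    · have h3 : n ∉ isolated A := fun h => h2 h.1
      simp [h1, h2, h3]

open scoped Classical in
theorem IsPairing.sum_ddTerm_le_ddNorm {ω : ℤ → ℝ} {A : Set ℤ} (hA : IsPairing ω A) (a : ℤ → ℂ)
    {J : Finset ℤ} (hJ : ∀ n ∈ J, n ∈ leaders A) :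
    ENNReal.ofReal (∑ n ∈ J, ddTerm ω A a n) ≤ ddNorm ω A a := by
  rw [hA.ddNorm_eq, ENNReal.ofReal_sum_of_nonneg fun n _ => ddTerm_nonneg ω A a n]
  refine le_trans (le_of_eq (Finset.sum_congr rfl fun n hn => ?_)) (ENNReal.sum_le_tsum J)
  rw [if_pos (hJ n hn)]

open scoped Classical in
theorem IsPairing.ddNorm_le {ω : ℤ → ℝ} {A : Set ℤ} (hA : IsPairing ω A) (a : ℤ → ℂ)
    {B : ENNReal} (h : ∀ J : Finset ℤ, (∀ n ∈ J, n ∈ leaders A) →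
      ENNReal.ofReal (∑ n ∈ J, ddTerm ω A a n) ≤ B) : ddNorm ω A a ≤ B := by
  rw [hA.ddNorm_eq, ENNReal.tsum_eq_iSup_sum]
  refine iSup_le fun J => ?_
  rw [← Finset.sum_filter, ← ENNReal.ofReal_sum_of_nonneg fun n _ => ddTerm_nonneg ω A a n]
  exact h _ fun n hn => (Finset.mem_filter.1 hn).2

theorem ddTerm_le_two_mul (ω : ℤ → ℝ) (A : Set ℤ) (a b : ℤ → ℂ) (n : ℤ) :
    ddTerm ω A b n ≤ 2 * ddTerm ω A a n + 2 * ddTerm ω A (a - b) n := by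
  have key : ∀ x y : ℂ, ‖y‖ ^ 2 ≤ 2 * ‖x‖ ^ 2 + 2 * ‖x - y‖ ^ 2 := by
    intro x y
    have h1 : ‖y‖ ≤ ‖x‖ + ‖x - y‖ := by
      calc ‖y‖ = ‖x - (x - y)‖ := by rw [sub_sub_cancel]
        _ ≤ _ := norm_sub_le _ _
    have := pow_le_pow_left₀ (norm_nonneg _) h1 2
    nlinarith [sq_nonneg (‖x‖ - ‖x - y‖)]
  unfold ddTerm
  split_ifs
  · have h1 := mul_le_mul_of_nonneg_right (key (a n) (b n)) (sq_nonneg (gap ω n))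
    have h2 := mul_le_mul_of_nonneg_right (key (a (n + 1)) (b (n + 1))) (sq_nonneg (gap ω n))
    have h3 := key (a (n + 1) + a n) (b (n + 1) + b n)
    have h4 : (a - b) (n + 1) + (a - b) n = a (n + 1) + a n - (b (n + 1) + b n) := by
      simp only [Pi.sub_apply]; ring
    rw [h4]
    simp only [Pi.sub_apply]
    linarith
  · exact key _ _

-- A finite index set may cut a pair in two. It is embedded in a union of whole groups, and the
-- missing coefficients are then taken to be zero.
open scoped Classical in
theorem exists_subset_members (A : Set ℤ) (F : Finset ℤ) :
    ∃ J : Finset ℤ, (∀ n ∈ J, n ∈ leaders A ∨ n ∈ A) ∧ F ⊆ members A J := by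
  refine ⟨(F.filter (· ∈ leaders A)) ∪ (F.image (· - 1)).filter (· ∈ A), ?_, ?_⟩
  · intro n hn
    rcases Finset.mem_union.1 hn with h | h
    · exact Or.inl (Finset.mem_filter.1 h).2
    · exact Or.inr (Finset.mem_filter.1 h).2
  · intro n hn
    by_cases h : n ∈ leaders A
    · exact Finset.mem_union_left _ (Finset.mem_union_left _ (Finset.mem_filter.2 ⟨hn, h⟩))
    · have h' : n - 1 ∈ A := not_not.1 h
      refine Finset.mem_union_right _ (Finset.mem_image.2 ⟨n - 1, ?_, by simp⟩)
      exact Finset.mem_filter.2 ⟨Finset.mem_union_right _ (Finset.mem_filter.2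
        ⟨Finset.mem_image_of_mem _ hn, h'⟩), h'⟩

theorem members_mono (A : Set ℤ) {J J' : Finset ℤ} (h : J ⊆ J') : members A J ⊆ members A J' := by
  classical
  exact Finset.union_subset_union h (Finset.image_subset_image (Finset.filter_subset_filter _ h))

theorem sum_expI_eq_sum_pairSum {A : Set ℤ} {F J : Finset ℤ} (hJ : ∀ n ∈ J, n ∈ leaders A)
    (hFJ : F ⊆ members A J) (ω : ℤ → ℝ) (a : ℤ → ℂ) (t : ℝ) :
    ∑ n ∈ F, a n * expI (ω n) t
      = ∑ n ∈ J, pairSum ω A (Set.indicator (F : Set ℤ) a) n t := by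
  classical
  rw [sum_pairSum_eq hJ, ← Finset.sum_subset hFJ]
  · refine Finset.sum_congr rfl fun n hn => ?_
    rw [Set.indicator_of_mem (by simpa using hn)]
  · intro n _ hn
    rw [Set.indicator_of_notMem (by simpa using hn), zero_mul]

theorem eLpNorm_two_sq {α : Type*} [MeasurableSpace α] (μ : Measure α) (f : α → ℂ) :
    eLpNorm f 2 μ ^ 2 = ∫⁻ x, ‖f x‖ₑ ^ 2 ∂μ := by
  rw [eLpNorm_eq_lintegral_rpow_enorm_toReal (by norm_num) (by norm_num), ← ENNReal.rpow_natCast,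
    ← ENNReal.rpow_mul]
  simp

theorem eLpNorm_two_sq_of_continuous {f : ℝ → ℂ} (hf : Continuous f) {T : ℝ} (hT : 0 ≤ T) :
    eLpNorm f 2 (volume.restrict (Ioc 0 T)) ^ 2
      = ENNReal.ofReal (∫ t in (0 : ℝ)..T, ‖f t‖ ^ 2) := by
  rw [eLpNorm_two_sq, intervalIntegral.integral_of_le hT, ofReal_integral_eq_lintegral_ofReal
    (Continuous.integrableOn_Ioc (by fun_prop)) (Eventually.of_forall fun t => by positivity)]
  refine lintegral_congr fun t => ?_
  rw [ENNReal.ofReal_pow (norm_nonneg _), ofReal_norm]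

theorem ennreal_add_sq_le (x y : ENNReal) : (x + y) ^ 2 ≤ 4 * (x ^ 2 + y ^ 2) := by
  rcases le_total x y with h | h
  · calc (x + y) ^ 2 ≤ (y + y) ^ 2 := by gcongr
      _ = 4 * y ^ 2 := by ring
      _ ≤ _ := by gcongr; exact le_add_self
  · calc (x + y) ^ 2 ≤ (x + x) ^ 2 := by gcongr
      _ = 4 * x ^ 2 := by ring
      _ ≤ _ := by gcongr; exact le_self_add

theorem memLp_of_continuous {f : ℝ → ℂ} (hf : Continuous f) (T : ℝ) :
    MemLp f 2 (volume.restrict (Ioc 0 T)) :=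
  (memLp_two_iff_integrable_sq_norm hf.aestronglyMeasurable).2
    (Continuous.integrableOn_Ioc (by fun_prop))

theorem continuous_sum_expI (ω : ℤ → ℝ) (F : Finset ℤ) (a : ℤ → ℂ) :
    Continuous fun t => ∑ n ∈ F, a n * expI (ω n) t :=
  continuous_finsetSum _ fun _ _ => continuous_const.mul (continuous_expI _)

theorem continuous_sum_pairSum (ω : ℤ → ℝ) (A : Set ℤ) (J : Finset ℤ) (a : ℤ → ℂ) :
    Continuous fun t => ∑ n ∈ J, pairSum ω A a n t :=
  continuous_finsetSum _ fun _ _ => continuous_pairSum _ _ _ _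

section

variable {ω : ℤ → ℝ} {A : Set ℤ} {T C : ℝ}

/-- Every sum of an exponential series satisfies the lower estimate valid for finite sums. -/
theorem IsExpSum.ddNorm_le (hA : IsPairing ω A) (hT : 0 ≤ T)
    (hlo : ∀ J : Finset ℤ, (∀ n ∈ J, n ∈ leaders A) → ∀ a : ℤ → ℂ,
      ∑ n ∈ J, ddTerm ω A a n ≤ C * ∫ t in (0 : ℝ)..T, ‖∑ n ∈ J, pairSum ω A a n t‖ ^ 2)
    (hC : 0 < C) {a : ℤ → ℂ} {f : ℝ → ℂ} (hf : IsExpSum T ω a f) :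
    ddNorm ω A a ≤ ENNReal.ofReal C * eLpNorm f 2 (volume.restrict (Ioc 0 T)) ^ 2 := by
  classical
  obtain ⟨hfL, F, hF, hlim⟩ := hf
  set μ := volume.restrict (Ioc (0 : ℝ) T)
  refine hA.ddNorm_le a fun J hJ => ?_
  have hlim' : Tendsto (fun k => ENNReal.ofReal C * (eLpNorm f 2 μ + eLpNorm (fun t : ℝ => f t -
      ∑ n ∈ F k, a n * Complex.exp (Complex.I * (ω n : ℂ) * (t : ℂ))) 2 μ) ^ 2) atTop
      (𝓝 (ENNReal.ofReal C * (eLpNorm f 2 μ + 0) ^ 2)) :=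
    ENNReal.Tendsto.const_mul (ENNReal.Tendsto.pow (hlim.const_add _))
      (Or.inr ENNReal.ofReal_ne_top)
  rw [add_zero] at hlim'
  refine ge_of_tendsto hlim' ?_
  filter_upwards [hF.eventually_ge_atTop (members A J)] with k hk
  obtain ⟨J₁, hJ₁, hJ₁F⟩ := exists_subset_members A (F k)
  have hJ₂ : ∀ n ∈ J ∪ J₁, n ∈ leaders A := fun n hn => by
    rcases Finset.mem_union.1 hn with h | h
    · exact hJ n h
    · exact (hJ₁ n h).elim id hA.mem_leaders
  have hS := sum_expI_eq_sum_pairSum hJ₂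
    (hJ₁F.trans (members_mono A Finset.subset_union_right)) ω a
  set a' := Set.indicator (F k : Set ℤ) a with ha'
  -- The index set `F k` already contains all members of the groups in J, so truncating the
  -- coefficients to it does not change these terms.
  have h1 : ∑ n ∈ J, ddTerm ω A a n ≤ ∑ n ∈ J ∪ J₁, ddTerm ω A a' n := by
    refine le_trans (le_of_eq (Finset.sum_congr rfl fun n hn => ?_))
      (Finset.sum_le_sum_of_subset_of_nonneg (Finset.subset_union_left (s₂ := J₁))
        fun n _ _ => ddTerm_nonneg ω A a' n)
    have hn1 : a' n = a n := Set.indicator_of_mem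
      (by exact_mod_cast hk (Finset.mem_union_left _ hn)) a
    by_cases hnA : n ∈ A
    · have hn2 : a' (n + 1) = a (n + 1) := Set.indicator_of_mem
        (by exact_mod_cast hk (Finset.mem_union_right _ (Finset.mem_image.2
          ⟨n, Finset.mem_filter.2 ⟨hn, hnA⟩, rfl⟩))) a
      simp only [ddTerm, hn1, hn2]
    · simp only [ddTerm, hnA, if_false, hn1]
  have h2 := h1.trans (hlo _ hJ₂ a')
  refine (ENNReal.ofReal_le_ofReal h2).trans ?_
  rw [ENNReal.ofReal_mul hC.le,
    ← eLpNorm_two_sq_of_continuous (continuous_sum_pairSum ω A _ a') hT]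
  have h3 : (fun t => ∑ n ∈ J ∪ J₁, pairSum ω A a' n t)
      = fun t => ∑ n ∈ F k, a n * expI (ω n) t := funext fun t => (hS t).symm
  rw [h3]
  gcongr
  have hs := memLp_of_continuous (continuous_sum_expI ω (F k) a) T
  have h4 : (fun t => ∑ n ∈ F k, a n * expI (ω n) t)
      = f - fun t => f t - ∑ n ∈ F k, a n * expI (ω n) t := by
    ext t; simp
  rw [h4]
  exact eLpNorm_sub_le hfL.1 (hfL.sub hs).1 (by norm_num)

theorem IsExpSum.sub_finite {a : ℤ → ℂ} {f : ℝ → ℂ} (hf : IsExpSum T ω a f) (G : Finset ℤ) :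
    IsExpSum T ω (a - Set.indicator (G : Set ℤ) a)
      fun t => f t - ∑ n ∈ G, a n * expI (ω n) t := by
  classical
  obtain ⟨hfL, F, hF, hlim⟩ := hf
  refine ⟨hfL.sub (memLp_of_continuous (continuous_sum_expI ω G a) T), F, hF, ?_⟩
  refine hlim.congr' ?_
  filter_upwards [hF.eventually_ge_atTop G] with k hk
  congr 1
  ext t
  have : ∑ n ∈ G, a n * expI (ω n) t
      = ∑ n ∈ F k, Set.indicator (G : Set ℤ) a n * expI (ω n) t := by
    rw [← Finset.sum_subset hk]
    · exact Finset.sum_congr rfl fun n hn => by rw [Set.indicator_of_mem (by simpa using hn)]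
    · exact fun n _ hn => by rw [Set.indicator_of_notMem (by simpa using hn), zero_mul]
  rw [this]
  simp only [Pi.sub_apply, sub_mul, Finset.sum_sub_distrib, expI]
  ring

/-- Every sum of an exponential series satisfies the upper estimate valid for finite sums. -/
theorem IsExpSum.le_ddNorm (hA : IsPairing ω A) (hT : 0 ≤ T)
    (hlo : ∀ J : Finset ℤ, (∀ n ∈ J, n ∈ leaders A) → ∀ a : ℤ → ℂ,
      ∑ n ∈ J, ddTerm ω A a n ≤ C * ∫ t in (0 : ℝ)..T, ‖∑ n ∈ J, pairSum ω A a n t‖ ^ 2)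
    (hC : 0 < C) {C' : ℝ}
    (hup : ∀ J : Finset ℤ, (∀ n ∈ J, n ∈ leaders A) → ∀ a : ℤ → ℂ,
      ∫ t in (0 : ℝ)..T, ‖∑ n ∈ J, pairSum ω A a n t‖ ^ 2 ≤ C' * ∑ n ∈ J, ddTerm ω A a n)
    (hC' : 0 < C') {a : ℤ → ℂ} {f : ℝ → ℂ} (hf : IsExpSum T ω a f) :
    eLpNorm f 2 (volume.restrict (Ioc 0 T)) ^ 2
      ≤ ENNReal.ofReal (8 * C') * ddNorm ω A a := by
  classical
  have hf' := hf
  obtain ⟨hfL, F, hF, hlim⟩ := hf'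
  set μ := volume.restrict (Ioc (0 : ℝ) T)
  set ε : ℕ → ENNReal := fun k => eLpNorm (fun t : ℝ => f t -
      ∑ n ∈ F k, a n * Complex.exp (Complex.I * (ω n : ℂ) * (t : ℂ))) 2 μ with hε
  have hlim' : Tendsto (fun k => ENNReal.ofReal (8 * C') * ddNorm ω A a
      + (ENNReal.ofReal (8 * C') * ENNReal.ofReal C + 4) * ε k ^ 2) atTop
      (𝓝 (ENNReal.ofReal (8 * C') * ddNorm ω A a
      + (ENNReal.ofReal (8 * C') * ENNReal.ofReal C + 4) * 0 ^ 2)) :=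
    (ENNReal.Tendsto.const_mul (ENNReal.Tendsto.pow hlim)
      (Or.inr (by finiteness))).const_add _
  rw [zero_pow two_ne_zero, mul_zero, add_zero] at hlim'
  refine ge_of_tendsto hlim' (Eventually.of_forall fun k => ?_)
  obtain ⟨J, hJ', hJF⟩ := exists_subset_members A (F k)
  have hJ : ∀ n ∈ J, n ∈ leaders A := fun n hn => (hJ' n hn).elim id hA.mem_leaders
  have hS := sum_expI_eq_sum_pairSum hJ hJF ω a
  -- Truncation can split a pair, so the norm of a' is not obviously dominated by that of a. But a -
  -- a' are the coefficients of f minus its partial sum, and the lower estimate bounds their norm by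
  -- C ε_k², which tends to 0.
  have hdiff := (hf.sub_finite (F k)).ddNorm_le hA hT hlo hC
  set a' := Set.indicator (F k : Set ℤ) a with ha'
  have hs := memLp_of_continuous (continuous_sum_expI ω (F k) a) T
  have h1 : eLpNorm f 2 μ ≤ eLpNorm (fun t => ∑ n ∈ F k, a n * expI (ω n) t) 2 μ + ε k := by
    have : f = (fun t => ∑ n ∈ F k, a n * expI (ω n) t)
        + fun t => f t - ∑ n ∈ F k, a n * expI (ω n) t := by ext t; simp
    conv_lhs => rw [this]
    exact eLpNorm_add_le hs.1 (hfL.sub hs).1 (by norm_num)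
  have h2 : eLpNorm (fun t => ∑ n ∈ F k, a n * expI (ω n) t) 2 μ ^ 2
      ≤ ENNReal.ofReal (2 * C') * ddNorm ω A a + ENNReal.ofReal (2 * C') *
        (ENNReal.ofReal C * ε k ^ 2) := by
    rw [funext hS, eLpNorm_two_sq_of_continuous (continuous_sum_pairSum ω A _ a') hT]
    have h3 : ∑ n ∈ J, ddTerm ω A a' n
        ≤ 2 * ∑ n ∈ J, ddTerm ω A a n + 2 * ∑ n ∈ J, ddTerm ω A (a - a') n := by
      rw [Finset.mul_sum, Finset.mul_sum, ← Finset.sum_add_distrib]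
      exact Finset.sum_le_sum fun n _ => ddTerm_le_two_mul ω A a a' n
    have n1 : 0 ≤ ∑ n ∈ J, ddTerm ω A a n := Finset.sum_nonneg fun n _ => ddTerm_nonneg _ _ _ _
    have n2 : 0 ≤ ∑ n ∈ J, ddTerm ω A (a - a') n :=
      Finset.sum_nonneg fun n _ => ddTerm_nonneg _ _ _ _
    calc ENNReal.ofReal (∫ t in (0 : ℝ)..T, ‖∑ n ∈ J, pairSum ω A a' n t‖ ^ 2)
        ≤ ENNReal.ofReal ((2 * C') * (∑ n ∈ J, ddTerm ω A a n)
            + (2 * C') * ∑ n ∈ J, ddTerm ω A (a - a') n) := by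
          refine ENNReal.ofReal_le_ofReal ((hup J hJ a').trans ?_)
          nlinarith
      _ = ENNReal.ofReal (2 * C') * ENNReal.ofReal (∑ n ∈ J, ddTerm ω A a n)
            + ENNReal.ofReal (2 * C') * ENNReal.ofReal (∑ n ∈ J, ddTerm ω A (a - a') n) := by
          rw [ENNReal.ofReal_add (by positivity) (by positivity), ENNReal.ofReal_mul (p := 2 * C') (by positivity),
            ENNReal.ofReal_mul (p := 2 * C') (by positivity)]
      _ ≤ _ := by
          gcongr
          · exact hA.sum_ddTerm_le_ddNorm a hJ
          · exact (hA.sum_ddTerm_le_ddNorm _ hJ).trans hdiff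
  have h4 : ENNReal.ofReal (8 * C') = 4 * ENNReal.ofReal (2 * C') := by
    rw [show 8 * C' = 4 * (2 * C') by ring, ENNReal.ofReal_mul (by norm_num)]
    norm_num
  calc eLpNorm f 2 μ ^ 2
      ≤ (eLpNorm (fun t => ∑ n ∈ F k, a n * expI (ω n) t) 2 μ + ε k) ^ 2 := by gcongr
    _ ≤ 4 * (eLpNorm (fun t => ∑ n ∈ F k, a n * expI (ω n) t) 2 μ ^ 2 + ε k ^ 2) :=
        ennreal_add_sq_le _ _
    _ ≤ 4 * (ENNReal.ofReal (2 * C') * ddNorm ω A a + ENNReal.ofReal (2 * C') *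
        (ENNReal.ofReal C * ε k ^ 2) + ε k ^ 2) := by gcongr
    _ = _ := by rw [h4]; ring

/-- A series of finite divided difference norm has a sum. -/
theorem exists_isExpSum (hA : IsPairing ω A) (hT : 0 ≤ T) {C' : ℝ}
    (hup : ∀ J : Finset ℤ, (∀ n ∈ J, n ∈ leaders A) → ∀ a : ℤ → ℂ,
      ∫ t in (0 : ℝ)..T, ‖∑ n ∈ J, pairSum ω A a n t‖ ^ 2 ≤ C' * ∑ n ∈ J, ddTerm ω A a n)
    (hC' : 0 < C') {a : ℤ → ℂ} (ha : ddNorm ω A a < ⊤) : ∃ f, IsExpSum T ω a f := by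
  classical
  set μ := volume.restrict (Ioc (0 : ℝ) T)
  set J : ℕ → Finset ℤ := fun k => (Finset.Icc (-(k : ℤ)) k).filter (· ∈ leaders A) with hJdef
  have hJ : ∀ k, ∀ n ∈ J k, n ∈ leaders A := fun k n hn => (Finset.mem_filter.1 hn).2
  have hJmono : Monotone J := fun k l hkl => Finset.filter_subset_filter _
    (Finset.Icc_subset_Icc (by omega) (by exact_mod_cast hkl))
  set N : ℕ → ℝ := fun k => ∑ n ∈ J k, ddTerm ω A a n with hN
  have hNmono : Monotone N := fun k l hkl =>
    Finset.sum_le_sum_of_subset_of_nonneg (hJmono hkl) fun n _ _ => ddTerm_nonneg _ _ _ _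
  have hNbdd : BddAbove (range N) := by
    refine ⟨(ddNorm ω A a).toReal, ?_⟩
    rintro _ ⟨k, rfl⟩
    exact (ENNReal.ofReal_le_iff_le_toReal ha.ne).1 (hA.sum_ddTerm_le_ddNorm a (hJ k))
  have hNc : CauchySeq N := (tendsto_atTop_ciSup hNmono hNbdd).cauchySeq
  set s : ℕ → ℝ → ℂ := fun k t => ∑ n ∈ J k, pairSum ω A a n t with hs
  have hsc : ∀ k, Continuous (s k) := fun k => continuous_sum_pairSum ω A (J k) a
  have hsL : ∀ k, MemLp (s k) 2 μ := fun k => memLp_of_continuous (hsc k) T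
  -- Groupwise partial sums differ by at most the increments of N, which is monotone and bounded and
  -- hence Cauchy.
  have hle : ∀ k l, k ≤ l → eLpNorm (s l - s k) 2 μ ^ 2 ≤ ENNReal.ofReal (C' * (N l - N k)) := by
    intro k l hkl
    have h1 : s l - s k = fun t => ∑ n ∈ J l \ J k, pairSum ω A a n t := by
      ext t
      simp only [hs, Pi.sub_apply]
      rw [← Finset.sum_sdiff (hJmono hkl), add_sub_cancel_right]
    have h2 : N l - N k = ∑ n ∈ J l \ J k, ddTerm ω A a n := by
      simp only [hN]
      rw [← Finset.sum_sdiff (hJmono hkl), add_sub_cancel_right]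
    rw [h1, h2, eLpNorm_two_sq_of_continuous (continuous_sum_pairSum ω A _ a) hT]
    exact ENNReal.ofReal_le_ofReal (hup _ (fun n hn => hJ l n (Finset.mem_sdiff.1 hn).1) a)
  have hcau : CauchySeq fun k => (hsL k).toLp (s k) := by
    rw [EMetric.cauchySeq_iff']
    intro ε hε
    obtain ⟨e, he0, heε⟩ : ∃ e : ℝ, 0 < e ∧ ENNReal.ofReal e < ε := by
      obtain ⟨e, he, he'⟩ := ENNReal.lt_iff_exists_nnreal_btwn.1 hε
      exact ⟨e, by exact_mod_cast he, by simpa using he'⟩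
    obtain ⟨K, hK⟩ := Metric.cauchySeq_iff'.1 hNc (e ^ 2 / C') (by positivity)
    refine ⟨K, fun n hn => ?_⟩
    rw [Lp.edist_toLp_toLp]
    refine lt_of_le_of_lt ?_ heε
    have h1 := hle K n hn
    have h2 := (le_abs_self _).trans_lt (hK n hn)
    rw [lt_div_iff₀ hC', mul_comm] at h2
    have h3 := h1.trans (ENNReal.ofReal_le_ofReal h2.le)
    rw [ENNReal.ofReal_pow he0.le] at h3
    exact (ENNReal.pow_le_pow_left_iff two_ne_zero).1 h3
  obtain ⟨f, hf⟩ := cauchySeq_tendsto_of_complete hcau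
  refine ⟨f, Lp.memLp f, fun k => members A (J k), ?_, ?_⟩
  · refine tendsto_atTop_finset_of_monotone (fun k l hkl => members_mono A (hJmono hkl)) fun n => ?_
    have hmem : ∀ m : ℤ, m ∈ leaders A → m ∈ J m.natAbs := fun m hm =>
      Finset.mem_filter.2 ⟨Finset.mem_Icc.2 (by omega), hm⟩
    by_cases h : n ∈ leaders A
    · exact ⟨n.natAbs, Finset.mem_union_left _ (hmem n h)⟩
    · have h' : n - 1 ∈ A := not_not.1 h
      exact ⟨(n - 1).natAbs, Finset.mem_union_right _ (Finset.mem_image.2 ⟨n - 1,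
        Finset.mem_filter.2 ⟨hmem _ (hA.mem_leaders h'), h'⟩, by simp⟩)⟩
  · have h1 := (Lp.tendsto_Lp_iff_tendsto_eLpNorm' _ _).1 hf
    refine h1.congr fun k => ?_
    rw [← eLpNorm_neg]
    refine eLpNorm_congr_ae ?_
    filter_upwards [(hsL k).coeFn_toLp] with t ht
    have h2 : s k t = ∑ n ∈ members A (J k), a n * expI (ω n) t := sum_pairSum_eq (hJ k) ω a t
    simp only [Pi.neg_apply, Pi.sub_apply, ht, h2, neg_sub]
    rfl

end

/-- The two-sided estimate for exponential series whose frequencies are zeros of a suitable band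
limited function. -/
theorem IsPairing.exists_expSum_estimate {ω : ℤ → ℝ} (hω : StrictMono ω) {A : Set ℤ}
    (hA : IsPairing ω A) {T : ℝ} (hT : 0 ≤ T) {F : ℝ → ℂ} (hF : IsBand 0 T F)
    (hz : ∀ n, F (ω n) = 0) {κ K D : ℝ} (hκ : 0 < κ)
    (hc : DerivBounds ω A (fun n => deriv F (ω n)) κ K D) :
    ∃ C₁ C₂ : ℝ, 0 < C₁ ∧ 0 < C₂ ∧ ∀ a : ℤ → ℂ,
      (ddNorm ω A a < ⊤ → ∃ f : ℝ → ℂ, IsExpSum T ω a f) ∧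
      ∀ f : ℝ → ℂ, IsExpSum T ω a f →
        ENNReal.ofReal C₁ * ddNorm ω A a ≤ ∫⁻ t in Set.Ioc (0 : ℝ) T, ‖f t‖ₑ ^ 2 ∧
        ∫⁻ t in Set.Ioc (0 : ℝ) T, ‖f t‖ₑ ^ 2 ≤ ENNReal.ofReal C₂ * ddNorm ω A a := by
  obtain ⟨C', hC', hup⟩ := hA.exists_integral_sq_sum_pairSum_le hω hT
  obtain ⟨C, hC, hlo⟩ := hA.exists_sum_ddTerm_le hω hT hF hz hκ hc
  refine ⟨C⁻¹, 8 * C', by positivity, by positivity, fun a =>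
    ⟨exists_isExpSum hA hT hup hC', fun f hf => ?_⟩⟩
  rw [← eLpNorm_two_sq]
  refine ⟨?_, hf.le_ddNorm hA hT hlo hC hup hC'⟩
  calc ENNReal.ofReal C⁻¹ * ddNorm ω A a
      ≤ ENNReal.ofReal C⁻¹ * (ENNReal.ofReal C * eLpNorm f 2 (volume.restrict (Ioc 0 T)) ^ 2) := by
        gcongr
        exact hf.ddNorm_le hA hT hlo hC
    _ = _ := by
        rw [← mul_assoc, ← ENNReal.ofReal_mul (by positivity), inv_mul_cancel₀ hC.ne',
          ENNReal.ofReal_one, one_mul]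

/-! ### Calculus of absolutely continuous functions -/

/-- `f` is absolutely continuous on `[a, b]` with derivative `f'`: it is an indefinite integral of
the integrable function `f'`. -/
def IsPrimitive (a b : ℝ) (f f' : ℝ → ℝ) : Prop :=
  IntervalIntegrable f' volume a b ∧ ∀ x ∈ Icc a b, f x = f a + ∫ t in a..x, f' t

section

variable {a b : ℝ} {f f' g g' : ℝ → ℝ}

theorem IntervalIntegrable.mono_left_endpoint {f' : ℝ → ℝ} (h : IntervalIntegrable f' volume a b)
    {x : ℝ} (hx : x ∈ Icc a b) : IntervalIntegrable f' volume a x :=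
  h.mono_set (by
    rw [uIcc_of_le hx.1, uIcc_of_le (hx.1.trans hx.2)]
    exact Icc_subset_Icc_right hx.2)

theorem IsPrimitive.continuousOn (hf : IsPrimitive a b f f') : ContinuousOn f (Icc a b) := by
  rcases le_or_gt a b with hab | hab
  · have h1 := intervalIntegral.continuousOn_primitive_interval' hf.1 left_mem_uIcc
    rw [uIcc_of_le hab] at h1
    exact (h1.const_add (f a)).congr fun x hx => hf.2 x hx
  · simp [hab]

theorem IsPrimitive.add (hf : IsPrimitive a b f f') (hg : IsPrimitive a b g g') :
    IsPrimitive a b (fun x => f x + g x) fun x => f' x + g' x := by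
  refine ⟨hf.1.add hg.1, fun x hx => ?_⟩
  beta_reduce
  rw [intervalIntegral.integral_add (IntervalIntegrable.mono_left_endpoint hf.1 hx)
    (IntervalIntegrable.mono_left_endpoint hg.1 hx), hf.2 x hx, hg.2 x hx]
  ring

theorem IsPrimitive.const_mul (hf : IsPrimitive a b f f') (c : ℝ) :
    IsPrimitive a b (fun x => c * f x) fun x => c * f' x := by
  refine ⟨hf.1.const_mul c, fun x hx => ?_⟩
  beta_reduce
  rw [intervalIntegral.integral_const_mul, hf.2 x hx]
  ring

theorem IsPrimitive.sub (hf : IsPrimitive a b f f') (hg : IsPrimitive a b g g') :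
    IsPrimitive a b (fun x => f x - g x) fun x => f' x - g' x := by
  simpa [sub_eq_add_neg] using hf.add (hg.const_mul (-1))

theorem IsPrimitive.congr (hf : IsPrimitive a b f f') (hab : a ≤ b) (h1 : ∀ x ∈ Icc a b, g x = f x)
    (h2 : ∀ᵐ x, x ∈ Ioc a b → f' x = g' x) : IsPrimitive a b g g' := by
  have h2' : ∀ᵐ x, x ∈ uIoc a b → f' x = g' x := by rwa [uIoc_of_le hab]
  refine ⟨hf.1.congr_ae ((ae_restrict_iff' measurableSet_uIoc).2 h2'), fun x hx => ?_⟩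
  rw [h1 x hx, h1 a (left_mem_Icc.2 hab), hf.2 x hx]
  congr 1
  refine intervalIntegral.integral_congr_ae ?_
  filter_upwards [h2] with t ht htx
  rw [uIoc_of_le hx.1] at htx
  exact ht ⟨htx.1, htx.2.trans hx.2⟩

theorem isPrimitive_integral (hf : IntervalIntegrable f' volume a b) (c : ℝ) :
    IsPrimitive a b (fun x => c + ∫ t in a..x, f' t) f' :=
  ⟨hf, fun x _ => by simp⟩

theorem isPrimitive_of_hasDerivWithinAt (hab : a ≤ b)
    (h : ∀ x ∈ Icc a b, HasDerivWithinAt f (f' x) (Icc a b) x) (hc : ContinuousOn f' (Icc a b)) :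
    IsPrimitive a b f f' := by
  have hi : IntervalIntegrable f' volume a b :=
    ContinuousOn.intervalIntegrable (by rwa [uIcc_of_le hab])
  refine ⟨hi, fun x hx => ?_⟩
  have hsub : Icc a x ⊆ Icc a b := Icc_subset_Icc_right hx.2
  rw [intervalIntegral.integral_eq_sub_of_hasDeriv_right_of_le hx.1
    (fun y hy => ((h y (hsub hy)).continuousWithinAt).mono hsub) (fun y hy => ?_)
    (IntervalIntegrable.mono_left_endpoint hi hx)]
  · ring
  · have hy' : y ∈ Icc a b := hsub (Ioo_subset_Icc_self hy)
    exact ((h y hy').hasDerivAt (Icc_mem_nhds hy.1 (hy.2.trans_le hx.2))).hasDerivWithinAt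

theorem IsPrimitive.hasDerivWithinAt (hf : IsPrimitive a b f f') (hc : ContinuousOn f' (Icc a b))
    {x : ℝ} (hx : x ∈ Icc a b) : HasDerivWithinAt f (f' x) (Icc a b) x := by
  have : Fact (x ∈ Icc a b) := ⟨hx⟩
  have h1 : HasDerivWithinAt (fun u => ∫ t in a..u, f' t) (f' x) (Icc a b) x :=
    intervalIntegral.integral_hasDerivWithinAt_right
      (IntervalIntegrable.mono_left_endpoint hf.1 hx)
      (hc.stronglyMeasurableAtFilter_nhdsWithin measurableSet_Icc x) (hc x hx)
  exact (h1.const_add (f a)).congr (fun y hy => hf.2 y hy) (hf.2 x hx)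

theorem IsPrimitive.mul (hab : a ≤ b) (hf : IsPrimitive a b f f') (hg : IsPrimitive a b g g') :
    IsPrimitive a b (fun x => f x * g x) fun x => f' x * g x + f x * g' x := by
  have huIcc : uIcc a b = Icc a b := uIcc_of_le hab
  refine ⟨(hf.1.mul_continuousOn (by rw [huIcc]; exact hg.continuousOn)).add
    (hg.1.continuousOn_mul (by rw [huIcc]; exact hf.continuousOn)), fun x hx => ?_⟩
  -- f and g are only controlled on [a, b]; the almost everywhere derivatives are computed for the
  -- primitives, which are defined on the whole line and agree with them there.
  have key : ∀ {h h' : ℝ → ℝ}, IsPrimitive a b h h' →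
      AbsolutelyContinuousOnInterval (fun y => h a + ∫ t in a..y, h' t) a x ∧
      ∀ᵐ y, y ∈ uIoc a x → deriv (fun y => h a + ∫ t in a..y, h' t) y = h' y := by
    intro h h' hh
    have hi := IntervalIntegrable.mono_left_endpoint hh.1 hx
    refine ⟨?_, ?_⟩
    · refine AbsolutelyContinuousOnInterval.add (f := fun _ => h a) ?_
        (hi.absolutelyContinuousOnInterval_intervalIntegral (c := a) (by simp))
      exact (LipschitzOnWith.of_dist_le_mul (K := 0) (by simp)).absolutelyContinuousOnInterval
    · filter_upwards [hi.ae_hasDerivAt_integral] with y hy hyx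
      exact ((hy (uIoc_subset_uIcc hyx) a (by simp)).const_add (h a)).deriv
  obtain ⟨f1, f2⟩ := key hf
  obtain ⟨g1, g2⟩ := key hg
  have h1 := f1.integral_deriv_mul_eq_sub g1
  have h2 : ∫ y in a..x, (f' y * g y + f y * g' y)
      = ∫ y in a..x, (deriv (fun y => f a + ∫ t in a..y, f' t) y * (g a + ∫ t in a..y, g' t)
        + (f a + ∫ t in a..y, f' t) * deriv (fun y => g a + ∫ t in a..y, g' t) y) := by
    refine intervalIntegral.integral_congr_ae ?_
    filter_upwards [f2, g2] with y hy1 hy2 hy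
    have hy' : y ∈ Icc a b := by
      rw [uIoc_of_le hx.1] at hy
      exact ⟨hy.1.le, hy.2.trans hx.2⟩
    rw [hy1 hy, hy2 hy, ← hf.2 y hy', ← hg.2 y hy']
  rw [h2, h1, ← hf.2 x hx, ← hg.2 x hx]
  simp

end

/-! ### The wave kernel and its Neumann series -/

/-- Half of the indicator function of `|u| ≤ d`: the fundamental solution of the wave equation. -/
noncomputable def boxKernel (d u : ℝ) : ℝ := if |u| ≤ d then 1 / 2 else 0

theorem measurable_boxKernel : Measurable fun p : ℝ × ℝ => boxKernel p.1 p.2 :=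
  Measurable.ite (measurableSet_le (by fun_prop) measurable_fst) measurable_const measurable_const

theorem boxKernel_nonneg (d u : ℝ) : 0 ≤ boxKernel d u := by
  unfold boxKernel; split_ifs <;> norm_num

theorem boxKernel_le (d u : ℝ) : boxKernel d u ≤ 1 / 2 := by
  unfold boxKernel; split_ifs <;> norm_num

theorem boxKernel_eq_zero {d u : ℝ} (h : d < |u|) : boxKernel d u = 0 := if_neg (not_le.2 h)

theorem integral_boxKernel_mul (d y : ℝ) (f : ℝ → ℝ) :
    ∫ t, boxKernel d (t - y) * f t = 1 / 2 * ∫ t in (y - max d 0)..(y + max d 0), f t := by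
  rcases le_or_gt 0 d with hd | hd
  · rw [max_eq_left hd, intervalIntegral.integral_of_le (by linarith), ← integral_Icc_eq_integral_Ioc,
      ← integral_const_mul, ← integral_indicator measurableSet_Icc]
    congr 1
    ext t
    by_cases ht : t ∈ Icc (y - d) (y + d)
    · rw [indicator_of_mem ht, boxKernel, if_pos]
      rw [abs_le]
      exact ⟨by linarith [ht.1], by linarith [ht.2]⟩
    · rw [indicator_of_notMem ht, boxKernel, if_neg, zero_mul]
      intro h
      rw [abs_le] at h
      exact ht ⟨by linarith, by linarith⟩
  · have : ∀ t, boxKernel d (t - y) = 0 := fun t => boxKernel_eq_zero (hd.trans_le (abs_nonneg _))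
    simp [this, max_eq_right hd.le]

theorem integral_boxKernel_sub (d y : ℝ) : ∫ t, boxKernel d (t - y) = max d 0 := by
  have := integral_boxKernel_mul d y fun _ => 1
  simp only [mul_one] at this
  rw [this]
  simp
  ring

/-- The box has cosine transform sin(ωd)/ω, the Green function of y'' + ω²y. For d < 0 the box is
empty, and max d 0 gives the causal cut-off of a Volterra kernel. -/
theorem integral_boxKernel_mul_cos (d y : ℝ) {ω : ℝ} (hω : ω ≠ 0) :
    ∫ t, boxKernel d (t - y) * Real.cos (ω * t)
      = Real.sin (ω * max d 0) / ω * Real.cos (ω * y) := by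
  rw [integral_boxKernel_mul, intervalIntegral.integral_comp_mul_left _ hω, integral_cos]
  rw [mul_add, mul_sub, Real.sin_add, Real.sin_sub, smul_eq_mul]
  field_simp
  ring

theorem integrable_boxKernel (d y : ℝ) : Integrable fun t => boxKernel d (t - y) := by
  refine Integrable.mono' (g := (Icc (y - d) (y + d)).indicator fun _ => (1 : ℝ))
    ((integrable_indicator_iff measurableSet_Icc).2 (by simp))
    (measurable_boxKernel.comp (by fun_prop : Measurable fun t : ℝ =>
      ((d, t - y) : ℝ × ℝ))).aestronglyMeasurable (Eventually.of_forall fun t => ?_)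
  rw [Real.norm_of_nonneg (boxKernel_nonneg _ _)]
  by_cases ht : t ∈ Icc (y - d) (y + d)
  · rw [indicator_of_mem ht]
    linarith [boxKernel_le d (t - y)]
  · rw [indicator_of_notMem ht, boxKernel, if_neg]
    intro h
    rw [abs_le] at h
    exact ht ⟨by linarith, by linarith⟩

/-- Terms of the Neumann series of the kernel transforming the solution of the wave equation
without potential into the solution with potential `κ`. -/
noncomputable def waveTerm (μ : Measure ℝ) (τ κ : ℝ → ℝ) : ℕ → ℝ → ℝ → ℝ
  | 0, x, t => boxKernel (τ x) t
  | j + 1, x, t => ∫ r, κ r * (∫ t', boxKernel (τ x - τ r) (t' - t) * waveTerm μ τ κ j r t') ∂μ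

section

variable {μ : Measure ℝ} {τ κ : ℝ → ℝ}

theorem measurable_waveTerm [SFinite μ] (hτ : Measurable τ) (hκ : Measurable κ) (j : ℕ) :
    Measurable fun p : ℝ × ℝ => waveTerm μ τ κ j p.1 p.2 := by
  induction j with
  | zero => exact measurable_boxKernel.comp ((hτ.comp measurable_fst).prodMk measurable_snd)
  | succ j ih =>
    have h1 : Measurable fun q : ((ℝ × ℝ) × ℝ) × ℝ =>
        boxKernel (τ q.1.1.1 - τ q.1.2) (q.2 - q.1.1.2) * waveTerm μ τ κ j q.1.2 q.2 :=
      (measurable_boxKernel.comp (f := fun q : ((ℝ × ℝ) × ℝ) × ℝ =>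
        (τ q.1.1.1 - τ q.1.2, q.2 - q.1.1.2)) (by fun_prop)).mul
        (ih.comp (f := fun q : ((ℝ × ℝ) × ℝ) × ℝ => (q.1.2, q.2)) (by fun_prop))
    have h2 : Measurable fun q : (ℝ × ℝ) × ℝ =>
        ∫ t', boxKernel (τ q.1.1 - τ q.2) (t' - q.1.2) * waveTerm μ τ κ j q.2 t' :=
      (h1.stronglyMeasurable.integral_prod_right' (ν := volume)).measurable
    have h3 : Measurable fun q : (ℝ × ℝ) × ℝ =>
        κ q.2 * ∫ t', boxKernel (τ q.1.1 - τ q.2) (t' - q.1.2) * waveTerm μ τ κ j q.2 t' :=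
      (hκ.comp measurable_snd).mul h2
    exact (h3.stronglyMeasurable.integral_prod_right' (ν := μ)).measurable

/-- Finite speed of propagation: a box of half-width τ(x) - τ(r) spreads a support |t'| ≤ τ(r) to at
most |t| ≤ τ(x). This is the origin of the band limits. -/
theorem waveTerm_eq_zero (j : ℕ) {x t : ℝ} (h : τ x < |t|) : waveTerm μ τ κ j x t = 0 := by
  induction j generalizing x t with
  | zero => exact boxKernel_eq_zero h
  | succ j ih =>
    have : ∀ r t', boxKernel (τ x - τ r) (t' - t) * waveTerm μ τ κ j r t' = 0 := by
      intro r t'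
      rcases lt_or_ge (τ r) |t'| with h1 | h1
      · rw [ih h1, mul_zero]
      · rw [boxKernel_eq_zero, zero_mul]
        have := abs_sub_abs_le_abs_sub t t'
        rw [abs_sub_comm] at this
        linarith
    simp [waveTerm, this]

/-- Each iteration gains a factor 1/L because d ≤ L⁻¹ e^{Ld}. The exponential weight in τ replaces
the usual factorials and needs only the L¹ norm of κ. -/
theorem abs_waveTerm_le (hκi : Integrable κ μ) {L : ℝ} (hL : 0 < L)
    (j : ℕ) {x : ℝ} (hx : 0 ≤ τ x) (t : ℝ) :
    |waveTerm μ τ κ j x t| ≤ ((∫ r, |κ r| ∂μ) / L) ^ j * Real.exp (L * τ x) := by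
  have hκ0 : 0 ≤ ∫ r, |κ r| ∂μ := integral_nonneg fun r => abs_nonneg _
  induction j generalizing x t with
  | zero =>
    simp only [waveTerm, pow_zero, one_mul]
    rw [abs_of_nonneg (boxKernel_nonneg _ _)]
    have := Real.one_le_exp (by positivity : 0 ≤ L * τ x)
    linarith [boxKernel_le (τ x) t]
  | succ j ih =>
    set q := (∫ r, |κ r| ∂μ) / L with hq
    have hq0 : 0 ≤ q := by positivity
    have h1 : ∀ r, |∫ t', boxKernel (τ x - τ r) (t' - t) * waveTerm μ τ κ j r t'|
        ≤ q ^ j * (L⁻¹ * Real.exp (L * τ x)) := by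
      intro r
      set d := τ x - τ r with hd
      have hb : ∀ t', |waveTerm μ τ κ j r t'| ≤ q ^ j * Real.exp (L * τ r) := by
        intro t'
        rcases le_or_gt 0 (τ r) with h | h
        · exact ih h t'
        · rw [waveTerm_eq_zero j (h.trans_le (abs_nonneg _)), abs_zero]
          positivity
      calc |∫ t', boxKernel d (t' - t) * waveTerm μ τ κ j r t'|
          ≤ ∫ t', boxKernel d (t' - t) * (q ^ j * Real.exp (L * τ r)) := by
            rw [← Real.norm_eq_abs]
            refine norm_integral_le_of_norm_le ((integrable_boxKernel d t).mul_const _)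
              (Eventually.of_forall fun t' => ?_)
            rw [norm_mul, Real.norm_of_nonneg (boxKernel_nonneg _ _)]
            exact mul_le_mul_of_nonneg_left (hb t') (boxKernel_nonneg _ _)
        _ = max d 0 * (q ^ j * Real.exp (L * τ r)) := by
            rw [integral_mul_const, integral_boxKernel_sub]
        _ = q ^ j * (max d 0 * Real.exp (L * τ r)) := by ring
        _ ≤ q ^ j * (L⁻¹ * Real.exp (L * τ x)) := by
            refine mul_le_mul_of_nonneg_left ?_ (by positivity)
            rcases le_or_gt 0 d with h | h
            · rw [max_eq_left h, show L * τ x = L * d + L * τ r by rw [hd]; ring, Real.exp_add,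
                ← mul_assoc]
              refine mul_le_mul_of_nonneg_right ?_ (Real.exp_pos _).le
              rw [inv_mul_eq_div, le_div_iff₀ hL]
              linarith [Real.add_one_le_exp (L * d)]
            · rw [max_eq_right h.le, zero_mul]
              positivity
    simp only [waveTerm]
    rw [← Real.norm_eq_abs]
    refine (norm_integral_le_of_norm_le (μ := μ) (hκi.abs.mul_const (q ^ j * (L⁻¹ * Real.exp (L * τ x))))
      (Eventually.of_forall fun r => ?_)).trans (le_of_eq ?_)
    · rw [norm_mul, Real.norm_eq_abs]
      exact mul_le_mul_of_nonneg_left (h1 r) (abs_nonneg _)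
    · rw [integral_mul_const, pow_succ, hq]
      field_simp

theorem integrable_of_bound_of_support {f : ℝ → ℝ} (hf : Measurable f) {B R : ℝ}
    (hB : ∀ t, |f t| ≤ B) (hR : ∀ t, R < |t| → f t = 0) : Integrable f := by
  refine Integrable.mono' (g := (Icc (-R) R).indicator fun _ => B)
    ((integrable_indicator_iff measurableSet_Icc).2 (by simp)) hf.aestronglyMeasurable
    (Eventually.of_forall fun t => ?_)
  by_cases ht : t ∈ Icc (-R) R
  · rw [indicator_of_mem ht]; exact hB t
  · rw [indicator_of_notMem ht, hR t, norm_zero]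
    rw [mem_Icc, ← abs_le, not_le] at ht
    exact ht

end

/-- Data of a string in Liouville normal form: the optical coordinate `τ`, with values in `[0, R]`,
and the potential `κ`. -/
structure IsWaveData (μ : Measure ℝ) (τ κ : ℝ → ℝ) (R : ℝ) : Prop where
  meas_tau : Measurable τ
  tau_nonneg : ∀ x, 0 ≤ τ x
  tau_le : ∀ x, τ x ≤ R
  meas_pot : Measurable κ
  pot_integrable : Integrable κ μ

namespace IsWaveData

variable {μ : Measure ℝ} {τ κ : ℝ → ℝ} {R : ℝ}

theorem R_nonneg (h : IsWaveData μ τ κ R) : 0 ≤ R := (h.tau_nonneg 0).trans (h.tau_le 0)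

theorem exists_abs_waveTerm_le (h : IsWaveData μ τ κ R) :
    ∃ E > 0, ∀ j x t, |waveTerm μ τ κ j x t| ≤ (1 / 2) ^ j * E := by
  have hκ0 : 0 ≤ ∫ r, |κ r| ∂μ := integral_nonneg fun r => abs_nonneg _
  -- Chosen so that the ratio of the geometric series is at most 1/2.
  set L := 2 * (∫ r, |κ r| ∂μ) + 1 with hL
  have hL0 : 0 < L := by positivity
  have hq : (∫ r, |κ r| ∂μ) / L ≤ 1 / 2 := by
    rw [div_le_iff₀ hL0]; linarith
  refine ⟨Real.exp (L * R), Real.exp_pos _, fun j x t => ?_⟩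
  refine (abs_waveTerm_le h.pot_integrable hL0 j (h.tau_nonneg x) t).trans ?_
  gcongr
  exact h.tau_le x

theorem waveTerm_eq_zero (h : IsWaveData μ τ κ R) (j : ℕ) (x : ℝ) {t : ℝ} (ht : R < |t|) :
    waveTerm μ τ κ j x t = 0 := StringMass.waveTerm_eq_zero j ((h.tau_le x).trans_lt ht)

/-- By Fubini, the recursion in time becomes Picard iteration of the Volterra equation in frequency:
integrating the box against a cosine multiplies it by sin(ωd)/ω. -/
theorem integral_waveTerm_succ_mul_cos [SFinite μ] (h : IsWaveData μ τ κ R) (j : ℕ) (x : ℝ) {ω : ℝ}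
    (hω : ω ≠ 0) :
    ∫ t, waveTerm μ τ κ (j + 1) x t * Real.cos (ω * t)
      = ∫ r, κ r * (Real.sin (ω * max (τ x - τ r) 0) / ω *
        ∫ t, waveTerm μ τ κ j r t * Real.cos (ω * t)) ∂μ := by
  obtain ⟨E, hE, hb⟩ := h.exists_abs_waveTerm_le
  have hR := h.R_nonneg
  set w := waveTerm μ τ κ j with hw
  have hwm : Measurable fun p : ℝ × ℝ => w p.1 p.2 := measurable_waveTerm h.meas_tau h.meas_pot j
  set G : ℝ → ℝ × ℝ → ℝ := fun t p =>
    κ p.1 * (boxKernel (τ x - τ p.1) (p.2 - t) * w p.1 p.2) * Real.cos (ω * t) with hG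
  have hint : Integrable (Function.uncurry G) (volume.prod (μ.prod volume)) := by
    have i1 : Integrable ((Icc (-(2 * R)) (2 * R)).indicator fun _ => (1 : ℝ)) :=
      (integrable_indicator_iff measurableSet_Icc).2 (by simp)
    have i2 : Integrable ((Icc (-R) R).indicator fun _ => E) :=
      (integrable_indicator_iff measurableSet_Icc).2 (by simp)
    refine (i1.mul_prod (h.pot_integrable.mul_prod i2)).mono ?_
      (Eventually.of_forall fun ⟨t, r, t'⟩ => ?_)
    · refine Measurable.aestronglyMeasurable ?_
      refine ((h.meas_pot.comp (f := fun q : ℝ × ℝ × ℝ => q.2.1) (by fun_prop)).mul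
        ((measurable_boxKernel.comp (f := fun q : ℝ × ℝ × ℝ => (τ x - τ q.2.1, q.2.2 - q.1))
          ?_).mul (hwm.comp (f := fun q : ℝ × ℝ × ℝ => q.2) measurable_snd))).mul (by fun_prop)
      exact (measurable_const.sub (h.meas_tau.comp (by fun_prop))).prodMk (by fun_prop)
    · simp only [Function.uncurry, hG]
      rcases lt_or_ge R |t'| with h1 | h1
      · rw [hw, h.waveTerm_eq_zero j r h1]
        simp only [mul_zero, zero_mul, norm_zero]
        exact norm_nonneg _
      rcases lt_or_ge (2 * R) |t| with h2 | h2
      · rw [boxKernel_eq_zero]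
        · simp only [mul_zero, zero_mul, norm_zero]
          exact norm_nonneg _
        · have h3 := abs_sub_abs_le_abs_sub t t'
          rw [abs_sub_comm] at h3
          linarith [h.tau_le x, h.tau_nonneg r]
      · rw [indicator_of_mem (show t' ∈ Icc (-R) R from abs_le.1 h1),
          indicator_of_mem (show t ∈ Icc (-(2 * R)) (2 * R) from abs_le.1 h2), one_mul, norm_mul,
          norm_mul, norm_mul, norm_mul, Real.norm_of_nonneg (boxKernel_nonneg _ _),
          Real.norm_of_nonneg hE.le]
        have h3 : ‖w r t'‖ ≤ E := (hb j r t').trans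
          (mul_le_of_le_one_left hE.le (pow_le_one₀ (by norm_num) (by norm_num)))
        have h4 : boxKernel (τ x - τ r) (t' - t) ≤ 1 := (boxKernel_le _ _).trans (by norm_num)
        have h5 : ‖Real.cos (ω * t)‖ ≤ 1 := Real.abs_cos_le_one _
        calc ‖κ r‖ * (boxKernel (τ x - τ r) (t' - t) * ‖w r t'‖) * ‖Real.cos (ω * t)‖
            ≤ ‖κ r‖ * (1 * E) * 1 := by
              gcongr
          _ = ‖κ r‖ * E := by ring
  calc ∫ t, waveTerm μ τ κ (j + 1) x t * Real.cos (ω * t)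
      = ∫ t, ∫ p, G t p ∂(μ.prod volume) := by
        refine integral_congr_ae ?_
        filter_upwards [hint.prod_right_ae] with t ht
        refine Eq.trans ?_ (integral_prod _ ht).symm
        simp only [waveTerm, Function.uncurry, hG]
        rw [← integral_mul_const]
        congr 1
        ext r
        rw [integral_mul_const, integral_const_mul]
    _ = ∫ p, (∫ t, G t p) ∂(μ.prod volume) := integral_integral_swap hint
    _ = ∫ r, (∫ t', ∫ t, G t (r, t')) ∂μ := integral_prod _ hint.integral_prod_right
    _ = _ := by
        congr 1
        ext r
        rw [← integral_const_mul, ← integral_const_mul]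
        congr 1
        ext t'
        have h1 : ∀ t, G t (r, t')
            = κ r * w r t' * (boxKernel (τ x - τ r) (t - t') * Real.cos (ω * t)) := by
          intro t
          simp only [hG]
          have : boxKernel (τ x - τ r) (t' - t) = boxKernel (τ x - τ r) (t - t') := by
            rw [boxKernel, boxKernel, abs_sub_comm]
          rw [this]
          ring
        simp_rw [h1]
        rw [integral_const_mul, integral_boxKernel_mul_cos _ _ hω]
        ring

end IsWaveData

/-- The kernel transforming the solution of the wave equation without potential into the solution
with potential `κ`. -/
noncomputable def waveKernel (μ : Measure ℝ) (τ κ : ℝ → ℝ) (x t : ℝ) : ℝ :=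
  ∑' j, waveTerm μ τ κ j x t

/-- The solution of the Sturm-Liouville problem in normal form, at frequency `ω`. -/
noncomputable def waveSol (μ : Measure ℝ) (τ κ : ℝ → ℝ) (ω x : ℝ) : ℝ :=
  ∫ t, waveKernel μ τ κ x t * Real.cos (ω * t)

namespace IsWaveData

variable {μ : Measure ℝ} {τ κ : ℝ → ℝ} {R : ℝ}

theorem summable_waveTerm (h : IsWaveData μ τ κ R) (x t : ℝ) :
    Summable fun j => waveTerm μ τ κ j x t := by
  obtain ⟨E, hE, hb⟩ := h.exists_abs_waveTerm_le
  exact Summable.of_norm_bounded (g := fun j : ℕ => (1 / 2 : ℝ) ^ j * E)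
    (summable_geometric_two.mul_right E) fun j => hb j x t

theorem measurable_waveKernel [SFinite μ] (h : IsWaveData μ τ κ R) :
    Measurable fun p : ℝ × ℝ => waveKernel μ τ κ p.1 p.2 := by
  refine measurable_of_tendsto_metrizable (f := fun n (p : ℝ × ℝ) =>
    ∑ j ∈ Finset.range n, waveTerm μ τ κ j p.1 p.2) (fun n => ?_) (tendsto_pi_nhds.2 fun p =>
    (h.summable_waveTerm p.1 p.2).hasSum.tendsto_sum_nat)
  exact Finset.measurable_fun_sum _ fun j _ => measurable_waveTerm h.meas_tau h.meas_pot j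

theorem waveKernel_eq_zero (h : IsWaveData μ τ κ R) (x : ℝ) {t : ℝ} (ht : R < |t|) :
    waveKernel μ τ κ x t = 0 := by
  simp [waveKernel, h.waveTerm_eq_zero _ x ht]

theorem exists_abs_waveKernel_le (h : IsWaveData μ τ κ R) :
    ∃ E > 0, ∀ x t, |waveKernel μ τ κ x t| ≤ E := by
  obtain ⟨E, hE, hb⟩ := h.exists_abs_waveTerm_le
  refine ⟨2 * E, by positivity, fun x t => ?_⟩
  exact tsum_of_norm_bounded (f := fun j => waveTerm μ τ κ j x t)
    ((hasSum_geometric_two).mul_right E) fun j => hb j x t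

theorem integrable_waveTerm [SFinite μ] (h : IsWaveData μ τ κ R) (j : ℕ) (x : ℝ) :
    Integrable (waveTerm μ τ κ j x) := by
  obtain ⟨E, hE, hb⟩ := h.exists_abs_waveTerm_le
  exact integrable_of_bound_of_support ((measurable_waveTerm h.meas_tau h.meas_pot j).comp
    (measurable_const.prodMk measurable_id)) (hb j x) fun t ht => h.waveTerm_eq_zero j x ht

theorem integrable_waveKernel [SFinite μ] (h : IsWaveData μ τ κ R) (x : ℝ) :
    Integrable (waveKernel μ τ κ x) := by
  obtain ⟨E, hE, hb⟩ := h.exists_abs_waveKernel_le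
  exact integrable_of_bound_of_support (h.measurable_waveKernel.comp
    (measurable_const.prodMk measurable_id)) (hb x) fun t ht => h.waveKernel_eq_zero x ht

theorem integral_abs_waveTerm_le [SFinite μ] (h : IsWaveData μ τ κ R) :
    ∃ E > 0, ∀ j x, ∫ t, |waveTerm μ τ κ j x t| ≤ (1 / 2) ^ j * E := by
  obtain ⟨E, hE, hb⟩ := h.exists_abs_waveTerm_le
  have hR := h.R_nonneg
  refine ⟨E * (2 * R + 1), by positivity, fun j x => ?_⟩
  have i2 : Integrable ((Icc (-R) R).indicator fun _ => (1 / 2) ^ j * E) :=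
    (integrable_indicator_iff measurableSet_Icc).2 (integrableOn_const (by simp))
  calc ∫ t, |waveTerm μ τ κ j x t| ≤ ∫ t, (Icc (-R) R).indicator (fun _ => (1 / 2) ^ j * E) t := by
        refine integral_mono (h.integrable_waveTerm j x).abs i2 fun t => ?_
        by_cases ht : t ∈ Icc (-R) R
        · rw [indicator_of_mem ht]; exact hb j x t
        · rw [indicator_of_notMem ht, h.waveTerm_eq_zero j x, abs_zero]
          rw [mem_Icc, ← abs_le, not_le] at ht
          exact ht
    _ = 2 * R * ((1 / 2) ^ j * E) := by
        rw [integral_indicator measurableSet_Icc, setIntegral_const, smul_eq_mul,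
          Real.volume_real_Icc_of_le (by linarith)]
        ring
    _ ≤ _ := by
        have : 0 ≤ (1 / 2 : ℝ) ^ j * E := by positivity
        nlinarith

theorem abs_integral_waveTerm_mul_cos_le [SFinite μ] (h : IsWaveData μ τ κ R) (j : ℕ) (ω x : ℝ) :
    |∫ t, waveTerm μ τ κ j x t * Real.cos (ω * t)| ≤ ∫ t, |waveTerm μ τ κ j x t| := by
  rw [← Real.norm_eq_abs]
  refine norm_integral_le_of_norm_le (h.integrable_waveTerm j x).abs
    (Eventually.of_forall fun t => ?_)
  rw [norm_mul]
  exact mul_le_of_le_one_right (norm_nonneg _) (Real.abs_cos_le_one _)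

theorem hasSum_waveSol [SFinite μ] (h : IsWaveData μ τ κ R) (ω x : ℝ) :
    HasSum (fun j => ∫ t, waveTerm μ τ κ j x t * Real.cos (ω * t)) (waveSol μ τ κ ω x) := by
  obtain ⟨E, hE, hb⟩ := h.integral_abs_waveTerm_le
  have hi : ∀ j, Integrable fun t => waveTerm μ τ κ j x t * Real.cos (ω * t) := fun j =>
    (h.integrable_waveTerm j x).mul_bdd (c := 1) (Continuous.aestronglyMeasurable (by fun_prop))
      (Eventually.of_forall fun t => Real.abs_cos_le_one _)
  have hs : Summable fun j => ∫ t, ‖waveTerm μ τ κ j x t * Real.cos (ω * t)‖ := by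
    refine Summable.of_nonneg_of_le (fun j => integral_nonneg fun t => norm_nonneg _) (fun j => ?_)
      (summable_geometric_two.mul_right E)
    refine le_trans (integral_mono (hi j).norm (h.integrable_waveTerm j x).abs fun t => ?_) (hb j x)
    rw [norm_mul]
    exact mul_le_of_le_one_right (norm_nonneg _) (Real.abs_cos_le_one _)
  have := hasSum_integral_of_summable_integral_norm hi hs
  have he : waveSol μ τ κ ω x = ∫ t, ∑' j, waveTerm μ τ κ j x t * Real.cos (ω * t) := by
    simp_rw [tsum_mul_right]
    rfl
  rwa [he]

theorem measurable_waveSol [SFinite μ] (h : IsWaveData μ τ κ R) (ω : ℝ) :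
    Measurable (waveSol μ τ κ ω) := by
  have : Measurable fun p : ℝ × ℝ => waveKernel μ τ κ p.1 p.2 * Real.cos (ω * p.2) :=
    h.measurable_waveKernel.mul (by fun_prop)
  exact (this.stronglyMeasurable.integral_prod_right' (ν := volume)).measurable

theorem exists_abs_waveSol_le [SFinite μ] (h : IsWaveData μ τ κ R) :
    ∃ E > 0, ∀ ω x, |waveSol μ τ κ ω x| ≤ E := by
  obtain ⟨E, hE, hb⟩ := h.integral_abs_waveTerm_le
  refine ⟨2 * E, by positivity, fun ω x => ?_⟩
  rw [← (h.hasSum_waveSol ω x).tsum_eq]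
  exact tsum_of_norm_bounded (f := fun j => ∫ t, waveTerm μ τ κ j x t * Real.cos (ω * t))
    ((hasSum_geometric_two).mul_right E) fun j =>
    (h.abs_integral_waveTerm_mul_cos_le j ω x).trans (hb j x)

/-- The Volterra equation for the solution. -/
theorem waveSol_eq [SFinite μ] (h : IsWaveData μ τ κ R) {ω : ℝ} (hω : ω ≠ 0) (x : ℝ) :
    waveSol μ τ κ ω x = Real.sin (ω * τ x) / ω
      + ∫ r, κ r * (Real.sin (ω * max (τ x - τ r) 0) / ω * waveSol μ τ κ ω r) ∂μ := by
  obtain ⟨E, hE, hb⟩ := h.integral_abs_waveTerm_le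
  set y : ℕ → ℝ → ℝ := fun j r => ∫ t, waveTerm μ τ κ j r t * Real.cos (ω * t) with hy
  have hyb : ∀ j r, |y j r| ≤ (1 / 2) ^ j * E := fun j r =>
    (h.abs_integral_waveTerm_mul_cos_le j ω r).trans (hb j r)
  have hym : ∀ j, Measurable (y j) := fun j => by
    have : Measurable fun p : ℝ × ℝ => waveTerm μ τ κ j p.1 p.2 * Real.cos (ω * p.2) :=
      (measurable_waveTerm h.meas_tau h.meas_pot j).mul (by fun_prop)
    exact (this.stronglyMeasurable.integral_prod_right' (ν := volume)).measurable
  have hbound : ∀ j r, ‖Real.sin (ω * max (τ x - τ r) 0) / ω * y j r‖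
      ≤ |ω|⁻¹ * ((1 / 2) ^ j * E) := by
    intro j r
    rw [norm_mul, norm_div, Real.norm_eq_abs, Real.norm_eq_abs, Real.norm_eq_abs, div_eq_inv_mul]
    have h1 := Real.abs_sin_le_one (ω * max (τ x - τ r) 0)
    have h2 := hyb j r
    have h3 : 0 < |ω|⁻¹ := inv_pos.2 (abs_pos.2 hω)
    calc |ω|⁻¹ * |Real.sin (ω * max (τ x - τ r) 0)| * |y j r|
        ≤ |ω|⁻¹ * 1 * ((1 / 2) ^ j * E) := by gcongr
      _ = _ := by ring
  have hi : ∀ j, Integrable (fun r => κ r * (Real.sin (ω * max (τ x - τ r) 0) / ω * y j r)) μ := by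
    intro j
    refine h.pot_integrable.mul_bdd ?_ (Eventually.of_forall (hbound j))
    have := h.meas_tau
    have := hym j
    exact Measurable.aestronglyMeasurable (by fun_prop)
  have hs : Summable fun j => ∫ r, ‖κ r * (Real.sin (ω * max (τ x - τ r) 0) / ω * y j r)‖ ∂μ := by
    refine Summable.of_nonneg_of_le (fun j => integral_nonneg fun t => norm_nonneg _) (fun j => ?_)
      (((summable_geometric_two.mul_right E).mul_left |ω|⁻¹).mul_left (∫ r, ‖κ r‖ ∂μ))
    rw [← integral_mul_const]
    refine integral_mono (hi j).norm (h.pot_integrable.norm.mul_const _) fun r => ?_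
    rw [norm_mul]
    exact mul_le_mul_of_nonneg_left (hbound j r) (norm_nonneg _)
  have h1 := hasSum_integral_of_summable_integral_norm hi hs
  have h2 := h.hasSum_waveSol ω x
  -- Dropping the first term, whose transform is sin(ωτ)/ω, leaves the series of iterates, which is
  -- the integral operator applied to the full solution.
  have h3 := (hasSum_nat_add_iff' 1).2 h2
  simp only [Finset.sum_range_one] at h3
  have h4 : ∀ j, ∫ t, waveTerm μ τ κ (j + 1) x t * Real.cos (ω * t)
      = ∫ r, κ r * (Real.sin (ω * max (τ x - τ r) 0) / ω * y j r) ∂μ := fun j =>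
    h.integral_waveTerm_succ_mul_cos j x hω
  simp_rw [h4] at h3
  have h5 := h3.unique h1
  have h6 : ∫ t, waveTerm μ τ κ 0 x t * Real.cos (ω * t) = Real.sin (ω * τ x) / ω := by
    have := integral_boxKernel_mul_cos (τ x) 0 hω
    simpa [waveTerm, max_eq_left (h.tau_nonneg x)] using this
  rw [h6] at h5
  have h7 : ∀ r, ∑' j, κ r * (Real.sin (ω * max (τ x - τ r) 0) / ω * y j r)
      = κ r * (Real.sin (ω * max (τ x - τ r) 0) / ω * waveSol μ τ κ ω r) := by
    intro r
    rw [tsum_mul_left, tsum_mul_left, (h.hasSum_waveSol ω r).tsum_eq]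
  simp_rw [h7] at h5
  linarith

end IsWaveData

/-! ### Sine and cosine integrals as band-limited functions -/

section

variable {Ω : Type} [MeasurableSpace Ω] {ν : Measure Ω} {θ : Ω → ℝ} {s : Ω → ℝ} {γ : ℝ}

theorem isBand_integral_expI [SFinite ν] (hγ : 0 ≤ γ) (hθ : Integrable θ ν) (hs : Measurable s)
    (hr : ∀ σ, θ σ ≠ 0 → |s σ| ≤ γ) :
    IsBand (-γ) γ fun ω => ∫ σ, (θ σ : ℂ) * expI ω (s σ) ∂ν := by
  -- Positions outside the band are moved to 0; the density vanishes there.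
  refine ⟨Ω, inferInstance, ν, inferInstance, fun σ => (θ σ : ℂ),
    fun σ => if |s σ| ≤ γ then s σ else 0, hθ.ofReal,
    Measurable.ite (measurableSet_le (by fun_prop) measurable_const) hs measurable_const,
    fun σ => ?_, fun ω => ?_⟩
  · beta_reduce
    split_ifs with h
    · exact abs_le.1 h
    · exact ⟨by linarith, hγ⟩
  · refine integral_congr_ae (Eventually.of_forall fun σ => ?_)
    beta_reduce
    by_cases h : θ σ = 0
    · simp [h]
    · rw [if_pos (hr σ h)]

theorem cos_eq_expI (ω s : ℝ) : (Real.cos (ω * s) : ℂ) = 1 / 2 * expI ω s + 1 / 2 * expI ω (-s) := by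
  rw [Complex.ofReal_cos, Complex.cos, expI, expI]
  push_cast
  ring_nf

theorem sin_eq_expI (ω s : ℝ) : (Real.sin (ω * s) : ℂ)
    = -Complex.I / 2 * expI ω s + Complex.I / 2 * expI ω (-s) := by
  rw [Complex.ofReal_sin, Complex.sin, expI, expI]
  push_cast
  ring_nf

theorem integral_mul_add_expI (hθ : Integrable θ ν) (hs : Measurable s) (u v : ℂ) (ω : ℝ) :
    ∫ σ, (θ σ : ℂ) * (u * expI ω (s σ) + v * expI ω (-s σ)) ∂ν
      = u * (∫ σ, (θ σ : ℂ) * expI ω (s σ) ∂ν) + v * ∫ σ, (θ σ : ℂ) * expI ω (-s σ) ∂ν := by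
  rw [← integral_const_mul, ← integral_const_mul, ← integral_add]
  · congr 1
    ext σ
    ring
  · exact (integrable_mul_expI hθ.ofReal hs ω).const_mul _
  · exact (integrable_mul_expI hθ.ofReal hs.neg ω).const_mul _

theorem isBand_integral_cos [SFinite ν] (hγ : 0 ≤ γ) (hθ : Integrable θ ν) (hs : Measurable s)
    (hr : ∀ σ, θ σ ≠ 0 → |s σ| ≤ γ) :
    IsBand (-γ) γ fun ω => ((∫ σ, θ σ * Real.cos (ω * s σ) ∂ν : ℝ) : ℂ) := by
  have h := ((isBand_integral_expI hγ hθ hs hr).const_mul (1 / 2)).add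
    ((isBand_integral_expI hγ hθ hs.neg (s := fun σ => -s σ)
      (fun σ h => by rw [abs_neg]; exact hr σ h)).const_mul (1 / 2))
  convert h using 2 with ω
  rw [← integral_mul_add_expI hθ hs, ← integral_complex_ofReal]
  congr 1
  ext σ
  rw [Complex.ofReal_mul, cos_eq_expI]

theorem isBand_integral_sin [SFinite ν] (hγ : 0 ≤ γ) (hθ : Integrable θ ν) (hs : Measurable s)
    (hr : ∀ σ, θ σ ≠ 0 → |s σ| ≤ γ) :
    IsBand (-γ) γ fun ω => ((∫ σ, θ σ * Real.sin (ω * s σ) ∂ν : ℝ) : ℂ) := by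
  have h := ((isBand_integral_expI hγ hθ hs hr).const_mul (-Complex.I / 2)).add
    ((isBand_integral_expI hγ hθ hs.neg (s := fun σ => -s σ)
      (fun σ h => by rw [abs_neg]; exact hr σ h)).const_mul (Complex.I / 2))
  convert h using 2 with ω
  rw [← integral_mul_add_expI hθ hs, ← integral_complex_ofReal]
  congr 1
  ext σ
  rw [Complex.ofReal_mul, sin_eq_expI]

theorem isBand_cos (hγ : 0 ≤ γ) : IsBand (-γ) γ fun ω => ((Real.cos (ω * γ) : ℝ) : ℂ) := by
  have := isBand_integral_cos (ν := Measure.dirac ()) (θ := fun _ => 1) (s := fun _ => γ) hγ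
    (integrable_dirac (by simp)) measurable_const (fun _ _ => by rw [abs_of_nonneg hγ])
  simpa using this

theorem isBand_sin (hγ : 0 ≤ γ) : IsBand (-γ) γ fun ω => ((Real.sin (ω * γ) : ℝ) : ℂ) := by
  have := isBand_integral_sin (ν := Measure.dirac ()) (θ := fun _ => 1) (s := fun _ => γ) hγ
    (integrable_dirac (by simp)) measurable_const (fun _ _ => by rw [abs_of_nonneg hγ])
  simpa using this

end

namespace IsWaveData

variable {μ : Measure ℝ} {τ κ : ℝ → ℝ} {R : ℝ}

theorem isBand_waveSol [SFinite μ] (h : IsWaveData μ τ κ R) (x : ℝ) :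
    IsBand (-R) R fun ω => (waveSol μ τ κ ω x : ℂ) :=
  isBand_integral_cos h.R_nonneg (h.integrable_waveKernel x) measurable_id fun t ht => by
    by_contra hn
    exact ht (h.waveKernel_eq_zero x (not_le.1 hn))

theorem integrable_pot_mul_waveKernel [SFinite μ] (h : IsWaveData μ τ κ R) :
    Integrable (fun p : ℝ × ℝ => κ p.1 * waveKernel μ τ κ p.1 p.2) (μ.prod volume) := by
  obtain ⟨E, hE, hb⟩ := h.exists_abs_waveKernel_le
  have i2 : Integrable ((Icc (-R) R).indicator fun _ => E) :=
    (integrable_indicator_iff measurableSet_Icc).2 (integrableOn_const (by simp))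
  refine (h.pot_integrable.mul_prod i2).mono
    ((h.meas_pot.comp measurable_fst).mul h.measurable_waveKernel).aestronglyMeasurable
    (Eventually.of_forall fun ⟨r, t⟩ => ?_)
  simp only
  rw [norm_mul, norm_mul]
  refine mul_le_mul_of_nonneg_left ?_ (norm_nonneg _)
  rcases lt_or_ge R |t| with h1 | h1
  · rw [h.waveKernel_eq_zero r h1, norm_zero]
    exact norm_nonneg _
  · rw [indicator_of_mem (show t ∈ Icc (-R) R from abs_le.1 h1), Real.norm_of_nonneg hE.le]
    exact hb r t

theorem abs_add_le_of_waveKernel_ne (h : IsWaveData μ τ κ R) {p : ℝ × ℝ}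
    (hp : κ p.1 * waveKernel μ τ κ p.1 p.2 ≠ 0) : |R - τ p.1 + p.2| ≤ R ∧ |R - τ p.1 - p.2| ≤ R := by
  have h1 : |p.2| ≤ τ p.1 := by
    by_contra hn
    refine hp ?_
    have : ∀ j, waveTerm μ τ κ j p.1 p.2 = 0 := fun j =>
      StringMass.waveTerm_eq_zero j (not_le.1 hn)
    simp [waveKernel, this]
  have h2 := h.tau_le p.1
  rw [abs_le] at h1
  constructor <;> rw [abs_le] <;> constructor <;> linarith [h1.1, h1.2]

theorem integral_pot_mul_eq [SFinite μ] (h : IsWaveData μ τ κ R) {u : ℝ → ℝ} (hu : Measurable u) {C : ℝ}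
    (hC : ∀ r, |u r| ≤ C) (ω : ℝ) :
    ∫ r, κ r * (u r * waveSol μ τ κ ω r) ∂μ
      = ∫ p : ℝ × ℝ, κ p.1 * waveKernel μ τ κ p.1 p.2 * (u p.1 * Real.cos (ω * p.2))
        ∂(μ.prod volume) := by
  rw [integral_prod]
  · congr 1
    ext r
    rw [waveSol, ← integral_const_mul, ← integral_const_mul]
    congr 1
    ext t
    ring
  · refine h.integrable_pot_mul_waveKernel.mul_bdd (c := C)
      ((hu.comp measurable_fst).mul (by fun_prop)).aestronglyMeasurable
      (Eventually.of_forall fun p => ?_)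
    rw [norm_mul]
    have h1 := hC p.1
    have h2 := Real.abs_cos_le_one (ω * p.2)
    calc ‖u p.1‖ * ‖Real.cos (ω * p.2)‖ ≤ C * 1 := by
          gcongr
          · exact (abs_nonneg _).trans h1
          · exact h1
          · exact h2
      _ = C := mul_one C

/-- By the product formula for sin(ω(R - τ)) cos(ωt), only the positions R - τ ± t occur, with |t| ≤
τ(r). The sharp support of the kernel thus keeps the band at R, where the crude bound |t| ≤ R would
give 2R. -/
theorem isBand_integral_pot_sin [SFinite μ] (h : IsWaveData μ τ κ R) :
    IsBand (-R) R fun ω =>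
      ((∫ r, κ r * (Real.sin (ω * (R - τ r)) * waveSol μ τ κ ω r) ∂μ : ℝ) : ℂ) := by
  have hτ := h.meas_tau
  have hi := h.integrable_pot_mul_waveKernel
  have b1 := isBand_integral_sin (s := fun p : ℝ × ℝ => R - τ p.1 + p.2) h.R_nonneg hi
    (by fun_prop) fun p hp => (h.abs_add_le_of_waveKernel_ne hp).1
  have b2 := isBand_integral_sin (s := fun p : ℝ × ℝ => R - τ p.1 - p.2) h.R_nonneg hi
    (by fun_prop) fun p hp => (h.abs_add_le_of_waveKernel_ne hp).2
  convert (b1.const_mul (1 / 2)).add (b2.const_mul (1 / 2)) using 2 with ω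
  rw [h.integral_pot_mul_eq (u := fun r => Real.sin (ω * (R - τ r))) (by fun_prop)
    (fun r => Real.abs_sin_le_one _)]
  have hs : ∀ {s : ℝ × ℝ → ℝ}, Measurable s → Integrable (fun p : ℝ × ℝ =>
      κ p.1 * waveKernel μ τ κ p.1 p.2 * Real.sin (ω * s p)) (μ.prod volume) := fun {s} hs =>
    hi.mul_bdd (c := 1) (Measurable.aestronglyMeasurable (by fun_prop))
      (Eventually.of_forall fun p => Real.abs_sin_le_one _)
  rw [← mul_add, ← Complex.ofReal_add, ← integral_add (hs (by fun_prop)) (hs (by fun_prop))]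
  have : (1 / 2 : ℂ) = ((1 / 2 : ℝ) : ℂ) := by push_cast; rfl
  rw [this, ← Complex.ofReal_mul, ← integral_const_mul]
  congr 2
  ext p
  rw [mul_add ω, mul_sub ω _ p.2, Real.sin_add, Real.sin_sub]
  ring

theorem isBand_integral_pot_cos [SFinite μ] (h : IsWaveData μ τ κ R) :
    IsBand (-R) R fun ω =>
      ((∫ r, κ r * (Real.cos (ω * (R - τ r)) * waveSol μ τ κ ω r) ∂μ : ℝ) : ℂ) := by
  have hτ := h.meas_tau
  have hi := h.integrable_pot_mul_waveKernel
  have b1 := isBand_integral_cos (s := fun p : ℝ × ℝ => R - τ p.1 + p.2) h.R_nonneg hi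
    (by fun_prop) fun p hp => (h.abs_add_le_of_waveKernel_ne hp).1
  have b2 := isBand_integral_cos (s := fun p : ℝ × ℝ => R - τ p.1 - p.2) h.R_nonneg hi
    (by fun_prop) fun p hp => (h.abs_add_le_of_waveKernel_ne hp).2
  convert (b1.const_mul (1 / 2)).add (b2.const_mul (1 / 2)) using 2 with ω
  rw [h.integral_pot_mul_eq (u := fun r => Real.cos (ω * (R - τ r))) (by fun_prop)
    (fun r => Real.abs_cos_le_one _)]
  have hs : ∀ {s : ℝ × ℝ → ℝ}, Measurable s → Integrable (fun p : ℝ × ℝ =>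
      κ p.1 * waveKernel μ τ κ p.1 p.2 * Real.cos (ω * s p)) (μ.prod volume) := fun {s} hs =>
    hi.mul_bdd (c := 1) (Measurable.aestronglyMeasurable (by fun_prop))
      (Eventually.of_forall fun p => Real.abs_cos_le_one _)
  rw [← mul_add, ← Complex.ofReal_add, ← integral_add (hs (by fun_prop)) (hs (by fun_prop))]
  have : (1 / 2 : ℂ) = ((1 / 2 : ℝ) : ℂ) := by push_cast; rfl
  rw [this, ← Complex.ofReal_mul, ← integral_const_mul]
  congr 2
  ext p
  rw [mul_add ω, mul_sub ω _ p.2, Real.cos_add, Real.cos_sub]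
  ring

theorem waveSol_neg (ω x : ℝ) : waveSol μ τ κ (-ω) x = waveSol μ τ κ ω x := by
  simp [waveSol]

theorem continuous_waveSol [SFinite μ] (h : IsWaveData μ τ κ R) (x : ℝ) :
    Continuous fun ω => waveSol μ τ κ ω x := by
  have := Complex.continuous_re.comp (h.isBand_waveSol x).differentiable.continuous
  exact this

/-- `waveSol` decays like `1 / ω`. -/
theorem exists_abs_waveSol_le_div [SFinite μ] (h : IsWaveData μ τ κ R) :
    ∃ C > 0, ∀ ω ≠ 0, ∀ x, |waveSol μ τ κ ω x| ≤ C / |ω| := by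
  obtain ⟨E, hE, hb⟩ := h.exists_abs_waveSol_le
  have h0 : 0 ≤ ∫ r, |κ r| ∂μ := integral_nonneg fun r => abs_nonneg _
  refine ⟨1 + (∫ r, |κ r| ∂μ) * E, by positivity, fun ω hω x => ?_⟩
  have hω' : 0 < |ω| := abs_pos.2 hω
  have hs : ∀ t, |Real.sin t / ω| ≤ |ω|⁻¹ := fun t => by
    rw [abs_div, div_eq_mul_inv]
    exact mul_le_of_le_one_left (inv_nonneg.2 hω'.le) (Real.abs_sin_le_one t)
  rw [h.waveSol_eq hω]
  refine (abs_add_le _ _).trans ?_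
  rw [add_div, one_div]
  refine add_le_add (hs _) ?_
  rw [← Real.norm_eq_abs, mul_div_assoc, ← integral_mul_const]
  refine norm_integral_le_of_norm_le (h.pot_integrable.abs.mul_const _)
    (Eventually.of_forall fun r => ?_)
  rw [norm_mul, norm_mul]
  refine mul_le_mul_of_nonneg_left ?_ (norm_nonneg _)
  rw [div_eq_inv_mul E]
  exact (mul_le_mul (hs _) (hb ω r) (norm_nonneg _)
    (inv_nonneg.2 hω'.le))

end IsWaveData

/-! ### The equation in Liouville normal form -/

/-- A string on `[a, b]` in Liouville normal form: `τ` is the optical coordinate with density `c`,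
and `κ` is the potential. -/
structure IsNormalForm (a b : ℝ) (τ c κ : ℝ → ℝ) (γ : ℝ) : Prop where
  le : a ≤ b
  wave : IsWaveData (volume.restrict (Ioc a b)) τ κ γ
  tau_prim : IsPrimitive a b τ c
  cont : ContinuousOn c (Icc a b)
  mono : MonotoneOn τ (Icc a b)
  tau_left : τ a = 0
  tau_right : τ b = γ

/-- The momentum conjugate to `waveSol`. -/
noncomputable def waveMom (a b : ℝ) (τ κ : ℝ → ℝ) (ω x : ℝ) : ℝ :=
  Real.cos (ω * τ x) * (1 + ∫ r in a..x, κ r * (Real.cos (ω * τ r) *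
      waveSol (volume.restrict (Ioc a b)) τ κ ω r))
    + Real.sin (ω * τ x) * (0 + ∫ r in a..x, κ r * (Real.sin (ω * τ r) *
      waveSol (volume.restrict (Ioc a b)) τ κ ω r))

namespace IsNormalForm

variable {a b : ℝ} {τ c κ : ℝ → ℝ} {γ : ℝ}

theorem intervalIntegrable_pot_mul (h : IsNormalForm a b τ c κ γ) {u : ℝ → ℝ} (hu : Measurable u)
    {C : ℝ} (hC : ∀ r, |u r| ≤ C) (ω : ℝ) :
    IntervalIntegrable (fun r => κ r * (u r * waveSol (volume.restrict (Ioc a b)) τ κ ω r))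
      volume a b := by
  rw [intervalIntegrable_iff_integrableOn_Ioc_of_le h.le]
  obtain ⟨E, hE, hb⟩ := h.wave.exists_abs_waveSol_le
  refine h.wave.pot_integrable.mul_bdd (c := C * E)
    (hu.mul (h.wave.measurable_waveSol ω)).aestronglyMeasurable (Eventually.of_forall fun r => ?_)
  rw [norm_mul]
  exact mul_le_mul (hC r) (hb ω r) (norm_nonneg _) ((abs_nonneg _).trans (hC r))

/-- The addition theorem separates x from r in the Volterra kernel, as in variation of constants, so
that differentiation in x needs only the product rule. Monotonicity of τ turns the cut-off max into
the limit r ≤ x. -/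
theorem mul_waveSol_eq (h : IsNormalForm a b τ c κ γ) {ω : ℝ} (hω : ω ≠ 0) {x : ℝ}
    (hx : x ∈ Icc a b) :
    waveSol (volume.restrict (Ioc a b)) τ κ ω x = ω⁻¹ *
      (Real.sin (ω * τ x) * (1 + ∫ r in a..x, κ r * (Real.cos (ω * τ r) *
        waveSol (volume.restrict (Ioc a b)) τ κ ω r))
      - Real.cos (ω * τ x) * (0 + ∫ r in a..x, κ r * (Real.sin (ω * τ r) *
        waveSol (volume.restrict (Ioc a b)) τ κ ω r))) := by
  have hτ := h.wave.meas_tau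
  set Y := waveSol (volume.restrict (Ioc a b)) τ κ ω with hY
  have e1 : ∫ r in Ioc a b, κ r * (Real.sin (ω * max (τ x - τ r) 0) / ω * Y r)
      = ∫ r in a..x, (ω⁻¹ * Real.sin (ω * τ x) * (κ r * (Real.cos (ω * τ r) * Y r))
        - ω⁻¹ * Real.cos (ω * τ x) * (κ r * (Real.sin (ω * τ r) * Y r))) := by
    rw [intervalIntegral.integral_of_le hx.1]
    rw [setIntegral_eq_of_subset_of_forall_sdiff_eq_zero (s := Ioc a x) measurableSet_Ioc
      (Ioc_subset_Ioc_right hx.2)]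
    · refine setIntegral_congr_fun measurableSet_Ioc fun r hr => ?_
      have : τ r ≤ τ x := h.mono ⟨hr.1.le, hr.2.trans hx.2⟩ hx hr.2
      rw [max_eq_left (by linarith), mul_sub, Real.sin_sub]
      ring
    · rintro r ⟨hr1, hr2⟩
      have hxr : x ≤ r := by
        by_contra hn
        exact hr2 ⟨hr1.1, (not_le.1 hn).le⟩
      have : τ x ≤ τ r := h.mono hx ⟨hr1.1.le, hr1.2⟩ hxr
      rw [max_eq_right (by linarith)]
      simp
  have i1 := IntervalIntegrable.mono_left_endpoint (h.intervalIntegrable_pot_mul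
    (u := fun r => Real.cos (ω * τ r)) (by fun_prop) (fun r => Real.abs_cos_le_one _) ω) hx
  have i2 := IntervalIntegrable.mono_left_endpoint (h.intervalIntegrable_pot_mul
    (u := fun r => Real.sin (ω * τ r)) (by fun_prop) (fun r => Real.abs_sin_le_one _) ω) hx
  rw [hY, h.wave.waveSol_eq hω x, ← hY, e1,
    intervalIntegral.integral_sub (i1.const_mul _) (i2.const_mul _),
    intervalIntegral.integral_const_mul, intervalIntegral.integral_const_mul]
  field_simp
  ring

theorem isPrimitive_trig (h : IsNormalForm a b τ c κ γ) (ω : ℝ) :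
    IsPrimitive a b (fun x => Real.sin (ω * τ x)) (fun x => Real.cos (ω * τ x) * (ω * c x)) ∧
    IsPrimitive a b (fun x => Real.cos (ω * τ x)) (fun x => -Real.sin (ω * τ x) * (ω * c x)) := by
  have hτ := h.tau_prim.continuousOn
  have hc := h.cont
  have hd := fun x (hx : x ∈ Icc a b) => (h.tau_prim.hasDerivWithinAt h.cont hx).const_mul ω
  exact ⟨isPrimitive_of_hasDerivWithinAt h.le (fun x hx => (hd x hx).sin) (by fun_prop),
    isPrimitive_of_hasDerivWithinAt h.le (fun x hx => (hd x hx).cos) (by fun_prop)⟩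

theorem isPrimitive_waveSol (h : IsNormalForm a b τ c κ γ) {ω : ℝ} (hω : ω ≠ 0) :
    IsPrimitive a b (waveSol (volume.restrict (Ioc a b)) τ κ ω)
      fun x => c x * waveMom a b τ κ ω x := by
  have hτ := h.wave.meas_tau
  obtain ⟨s, co⟩ := h.isPrimitive_trig ω
  have pa := isPrimitive_integral (h.intervalIntegrable_pot_mul
    (u := fun r => Real.cos (ω * τ r)) (by fun_prop) (fun r => Real.abs_cos_le_one _) ω) 1
  have pb := isPrimitive_integral (h.intervalIntegrable_pot_mul
    (u := fun r => Real.sin (ω * τ r)) (by fun_prop) (fun r => Real.abs_sin_le_one _) ω) 0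
  refine (((s.mul h.le pa).sub (co.mul h.le pb)).const_mul ω⁻¹).congr h.le
    (fun x hx => h.mul_waveSol_eq hω hx) (Eventually.of_forall fun x _ => ?_)
  rw [waveMom]
  field_simp
  ring

theorem isPrimitive_waveMom (h : IsNormalForm a b τ c κ γ) {ω : ℝ} (hω : ω ≠ 0) :
    IsPrimitive a b (waveMom a b τ κ ω)
      fun x => (κ x - ω ^ 2 * c x) * waveSol (volume.restrict (Ioc a b)) τ κ ω x := by
  have hτ := h.wave.meas_tau
  obtain ⟨s, co⟩ := h.isPrimitive_trig ω
  have pa := isPrimitive_integral (h.intervalIntegrable_pot_mul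
    (u := fun r => Real.cos (ω * τ r)) (by fun_prop) (fun r => Real.abs_cos_le_one _) ω) 1
  have pb := isPrimitive_integral (h.intervalIntegrable_pot_mul
    (u := fun r => Real.sin (ω * τ r)) (by fun_prop) (fun r => Real.abs_sin_le_one _) ω) 0
  refine ((co.mul h.le pa).add (s.mul h.le pb)).congr h.le
    (fun x hx => rfl) (Eventually.of_forall fun x hx => ?_)
  have e := h.mul_waveSol_eq hω ⟨hx.1.le, hx.2⟩
  have e2 := Real.sin_sq_add_cos_sq (ω * τ x)
  set Y := waveSol (volume.restrict (Ioc a b)) τ κ ω with hY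
  set A := ∫ r in a..x, κ r * (Real.cos (ω * τ r) * Y r)
  set B := ∫ r in a..x, κ r * (Real.sin (ω * τ r) * Y r)
  have e' : ω * Y x = Real.sin (ω * τ x) * (1 + A) - Real.cos (ω * τ x) * (0 + B) := by
    rw [e]; field_simp
  -- The integrals contribute κY through sin² + cos² = 1; the trigonometric factors contribute
  -- -ω²cY.
  linear_combination (κ x * Y x) * e2 + (ω * c x) * e'

theorem waveSol_left (h : IsNormalForm a b τ c κ γ) {ω : ℝ} (hω : ω ≠ 0) :
    waveSol (volume.restrict (Ioc a b)) τ κ ω a = 0 := by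
  rw [h.mul_waveSol_eq hω (left_mem_Icc.2 h.le), h.tau_left]
  simp

theorem waveMom_left (h : IsNormalForm a b τ c κ γ) (ω : ℝ) : waveMom a b τ κ ω a = 1 := by
  rw [waveMom, h.tau_left]
  simp

theorem waveMom_right (h : IsNormalForm a b τ c κ γ) (ω : ℝ) :
    waveMom a b τ κ ω b = Real.cos (ω * γ) + ∫ r in Ioc a b, κ r * (Real.cos (ω * (γ - τ r)) *
      waveSol (volume.restrict (Ioc a b)) τ κ ω r) := by
  have hτ := h.wave.meas_tau
  have i1 := h.intervalIntegrable_pot_mul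
    (u := fun r => Real.cos (ω * τ r)) (by fun_prop) (fun r => Real.abs_cos_le_one _) ω
  have i2 := h.intervalIntegrable_pot_mul
    (u := fun r => Real.sin (ω * τ r)) (by fun_prop) (fun r => Real.abs_sin_le_one _) ω
  rw [waveMom, h.tau_right, mul_add, zero_add, mul_one, add_assoc,
    ← intervalIntegral.integral_const_mul, ← intervalIntegral.integral_const_mul,
    ← intervalIntegral.integral_add (i1.const_mul _) (i2.const_mul _),
    intervalIntegral.integral_of_le h.le]
  congr 2
  ext r
  rw [mul_sub, Real.cos_sub]
  ring

theorem mul_waveSol_right (h : IsNormalForm a b τ c κ γ) (ω : ℝ) :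
    ω * waveSol (volume.restrict (Ioc a b)) τ κ ω b = Real.sin (ω * γ) +
      ∫ r in Ioc a b, κ r * (Real.sin (ω * (γ - τ r)) *
        waveSol (volume.restrict (Ioc a b)) τ κ ω r) := by
  rcases eq_or_ne ω 0 with rfl | hω
  · simp
  rw [h.wave.waveSol_eq hω b, mul_add, h.tau_right, mul_div_cancel₀ _ hω, ← integral_const_mul]
  congr 2
  ext r
  rw [max_eq_left (sub_nonneg.2 (h.wave.tau_le r))]
  field_simp

theorem isBand_waveMom_right (h : IsNormalForm a b τ c κ γ) :
    IsBand (-γ) γ fun ω => (waveMom a b τ κ ω b : ℂ) := by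
  have := (isBand_cos h.wave.R_nonneg).add h.wave.isBand_integral_pot_cos
  simpa only [h.waveMom_right, Complex.ofReal_add] using this

/-- A factor ω does not preserve this notion of band in general; here the Volterra equation
expresses the product without it. -/
theorem isBand_mul_waveSol_right (h : IsNormalForm a b τ c κ γ) :
    IsBand (-γ) γ fun ω => ((ω * waveSol (volume.restrict (Ioc a b)) τ κ ω b : ℝ) : ℂ) := by
  have := (isBand_sin h.wave.R_nonneg).add h.wave.isBand_integral_pot_sin
  simpa only [h.mul_waveSol_right, Complex.ofReal_add] using this

theorem waveMom_neg (ω x : ℝ) : waveMom a b τ κ (-ω) x = waveMom a b τ κ ω x := by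
  simp [waveMom, IsWaveData.waveSol_neg]

theorem exists_abs_mul_waveSol_sub_le (h : IsNormalForm a b τ c κ γ) :
    ∃ C > 0, ∀ ω ≠ 0, |ω * waveSol (volume.restrict (Ioc a b)) τ κ ω b - Real.sin (ω * γ)|
      ≤ C / |ω| := by
  obtain ⟨C, hC, hb⟩ := h.wave.exists_abs_waveSol_le_div
  have h0 : 0 ≤ ∫ r in Ioc a b, |κ r| := integral_nonneg fun r => abs_nonneg _
  refine ⟨(∫ r in Ioc a b, |κ r|) * C + 1, by positivity, fun ω hω => ?_⟩
  have hω' : 0 < |ω| := abs_pos.2 hω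
  rw [h.mul_waveSol_right, add_sub_cancel_left, ← Real.norm_eq_abs]
  calc _ ≤ ∫ r in Ioc a b, |κ r| * (C / |ω|) := by
        refine norm_integral_le_of_norm_le (h.wave.pot_integrable.abs.mul_const _)
          (Eventually.of_forall fun r => ?_)
        rw [norm_mul, norm_mul]
        refine mul_le_mul_of_nonneg_left ?_ (norm_nonneg _)
        exact (mul_le_of_le_one_left (norm_nonneg _) (Real.abs_sin_le_one _)).trans (hb ω hω r)
    _ = (∫ r in Ioc a b, |κ r|) * C / |ω| := by rw [integral_mul_const, mul_div_assoc]
    _ ≤ _ := by gcongr; linarith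

end IsNormalForm

/-! ### Liouville transformation of a string -/

theorem MemH2.exists_isPrimitive {a b : ℝ} {f : ℝ → ℝ} (hab : a ≤ b) (h : MemH2 a b f) :
    ∃ f' f'', IsPrimitive a b f f' ∧ IsPrimitive a b f' f'' ∧
      ∀ x ∈ Icc a b, HasDerivWithinAt f (f' x) (Icc a b) x := by
  obtain ⟨f', f'', h1, h2, h3⟩ := h
  have p1 : IsPrimitive a b f' f'' :=
    ⟨(intervalIntegrable_iff_integrableOn_Ioc_of_le hab).2 (h1.integrable (by norm_num)), h3⟩
  exact ⟨f', f'', isPrimitive_of_hasDerivWithinAt hab h2 p1.continuousOn, p1, h2⟩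

/-- The solutions `y` (with momenta `p = σ y'`) of a string equation on `[a, b]` that vanish at `a`,
indexed by the frequency, together with the properties of their values at `b`: these are
band-limited functions of the frequency with the expected asymptotics. -/
structure IsTransfer (a b : ℝ) (ρ σ q : ℝ → ℝ) (γ B C : ℝ) (y p : ℝ → ℝ → ℝ) : Prop where
  sol : ∀ ω ≠ 0, IsSLSolution a b ρ σ q (ω ^ 2) (y ω) (p ω)
  y_left : ∀ ω ≠ 0, y ω a = 0
  p_left : ∀ ω ≠ 0, p ω a ≠ 0
  y_neg : ∀ ω x, y (-ω) x = y ω x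
  p_neg : ∀ ω x, p (-ω) x = p ω x
  abs_le : ∀ ω, ∀ x ∈ Icc a b, |y ω x| ≤ C
  continuous : ∀ x, Continuous fun ω => y ω x
  band_y : IsBand (-γ) γ fun ω => (y ω b : ℂ)
  band_mul_y : IsBand (-γ) γ fun ω => ((ω * y ω b : ℝ) : ℂ)
  band_p : IsBand (-γ) γ fun ω => (p ω b : ℂ)
  abs_right_le : ∀ ω ≠ 0, |y ω b| ≤ C / |ω|
  asymptotic : ∀ ω ≠ 0, |ω * y ω b - B * Real.sin (ω * γ)| ≤ C / |ω|

namespace IsStringCoeff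

variable {a b : ℝ} {ρ σ q : ℝ → ℝ}

theorem rho_pos' (h : IsStringCoeff a b ρ σ q) {x : ℝ} (hx : x ∈ Icc a b) : 0 < ρ x := by
  obtain ⟨c, hc, h1⟩ := h.rho_pos
  exact hc.trans_le (h1 x hx)

theorem sigma_pos' (h : IsStringCoeff a b ρ σ q) {x : ℝ} (hx : x ∈ Icc a b) : 0 < σ x := by
  obtain ⟨c, hc, h1⟩ := h.sigma_pos
  exact hc.trans_le (h1 x hx)

theorem continuousOn_rho (h : IsStringCoeff a b ρ σ q) : ContinuousOn ρ (Icc a b) := by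
  obtain ⟨f', f'', _, h2, _⟩ := h.rho_mem
  exact fun x hx => (h2 x hx).continuousWithinAt

theorem continuousOn_sigma (h : IsStringCoeff a b ρ σ q) : ContinuousOn σ (Icc a b) := by
  obtain ⟨f', f'', _, h2, _⟩ := h.sigma_mem
  exact fun x hx => (h2 x hx).continuousWithinAt

theorem continuousOn_sqrt_div (h : IsStringCoeff a b ρ σ q) :
    ContinuousOn (fun x => √(ρ x / σ x)) (Icc a b) :=
  (h.continuousOn_rho.div h.continuousOn_sigma fun _ hx => (h.sigma_pos' hx).ne').sqrt

/-- The weight `(ρσ)^{1/4}` and the logarithmic derivative `η` of its optical form. -/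
theorem exists_liouville (h : IsStringCoeff a b ρ σ q) (hab : a ≤ b) :
    ∃ η η' : ℝ → ℝ, IsPrimitive a b η η' ∧
      IsPrimitive a b (fun x => √√(ρ x * σ x)) (fun x => √√(ρ x * σ x) * (η x * √(ρ x / σ x))) ∧
      IsPrimitive a b (fun x => (√√(ρ x * σ x))⁻¹)
        (fun x => -((√√(ρ x * σ x))⁻¹ * (η x * √(ρ x / σ x)))) := by
  obtain ⟨ρ₁, ρ₂, -, r1, dr⟩ := h.rho_mem.exists_isPrimitive hab
  obtain ⟨σ₁, σ₂, -, s1, ds⟩ := h.sigma_mem.exists_isPrimitive hab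
  have cr := h.continuousOn_rho
  have cs := h.continuousOn_sigma
  have cr1 := r1.continuousOn
  have cs1 := s1.continuousOn
  have hr : ∀ x ∈ Icc a b, 0 < ρ x := fun x hx => h.rho_pos' hx
  have hs : ∀ x ∈ Icc a b, 0 < σ x := fun x hx => h.sigma_pos' hx
  have pr : IsPrimitive a b (fun x => (ρ x)⁻¹) fun x => -ρ₁ x / ρ x ^ 2 :=
    isPrimitive_of_hasDerivWithinAt hab (fun x hx => (dr x hx).fun_inv (hr x hx).ne')
      (cr1.neg.div (cr.pow 2) fun x hx => (pow_pos (hr x hx) 2).ne')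
  have ps : IsPrimitive a b (fun x => (σ x)⁻¹) fun x => -σ₁ x / σ x ^ 2 :=
    isPrimitive_of_hasDerivWithinAt hab (fun x hx => (ds x hx).fun_inv (hs x hx).ne')
      (cs1.neg.div (cs.pow 2) fun x hx => (pow_pos (hs x hx) 2).ne')
  have pc := isPrimitive_of_hasDerivWithinAt (f := fun x => √(σ x / ρ x)) hab
    (fun x hx => ((ds x hx).fun_div (dr x hx) (hr x hx).ne').sqrt
      (div_pos (hs x hx) (hr x hx)).ne') (by
        refine ContinuousOn.div (ContinuousOn.div (by fun_prop) (by fun_prop)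
          fun x hx => (pow_pos (hr x hx) 2).ne')
          (continuousOn_const.mul (cs.div cr fun x hx => (hr x hx).ne').sqrt) fun x hx => ?_
        have := Real.sqrt_pos.2 (div_pos (hs x hx) (hr x hx))
        positivity)
  -- η = (ρ'/ρ + σ'/σ)√(σ/ρ)/4 is the logarithmic derivative of (ρσ)^{1/4} with respect to the
  -- optical coordinate. The H² assumption makes it absolutely continuous, so that η' may enter the
  -- potential.
  have pη := (((r1.mul hab pr).add (s1.mul hab ps)).mul hab pc).const_mul (1 / 4)
  have hb : ∀ x ∈ Icc a b, 0 < √√(ρ x * σ x) := fun x hx =>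
    Real.sqrt_pos.2 (Real.sqrt_pos.2 (mul_pos (hr x hx) (hs x hx)))
  have hder : ∀ x ∈ Icc a b, HasDerivWithinAt (fun x => √√(ρ x * σ x)) (√√(ρ x * σ x) *
      (1 / 4 * ((ρ₁ x * (ρ x)⁻¹ + σ₁ x * (σ x)⁻¹) * √(σ x / ρ x)) * √(ρ x / σ x)))
      (Icc a b) x := fun x hx => by
    have hp := mul_pos (hr x hx) (hs x hx)
    refine ((((dr x hx).fun_mul (ds x hx)).sqrt hp.ne').sqrt
      (Real.sqrt_pos.2 hp).ne').congr_deriv ?_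
    have e0 : √(σ x / ρ x) * √(ρ x / σ x) = 1 := by
      rw [← Real.sqrt_mul (div_pos (hs x hx) (hr x hx)).le]
      have := (hr x hx).ne'
      have := (hs x hx).ne'
      rw [show σ x / ρ x * (ρ x / σ x) = 1 by field_simp, Real.sqrt_one]
    rw [show 1 / 4 * ((ρ₁ x * (ρ x)⁻¹ + σ₁ x * (σ x)⁻¹) * √(σ x / ρ x)) * √(ρ x / σ x)
      = 1 / 4 * (ρ₁ x * (ρ x)⁻¹ + σ₁ x * (σ x)⁻¹) * (√(σ x / ρ x) * √(ρ x / σ x)) by ring, e0]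
    have e1 : √√(ρ x * σ x) * √√(ρ x * σ x) = √(ρ x * σ x) :=
      Real.mul_self_sqrt (Real.sqrt_nonneg _)
    have e2 : √(ρ x * σ x) * √(ρ x * σ x) = ρ x * σ x := Real.mul_self_sqrt hp.le
    have := hb x hx
    have h4 := Real.sqrt_pos.2 hp
    have h5 := hr x hx
    have h6 := hs x hx
    set β := √√(ρ x * σ x)
    set w := √(ρ x * σ x)
    rw [← e1]
    have e3 : ρ x * σ x = β ^ 4 := by rw [← e2, ← e1]; ring
    field_simp
    rw [← e3]
    ring
  have cc := h.continuousOn_sqrt_div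
  have cb : ContinuousOn (fun x => √√(ρ x * σ x)) (Icc a b) := (cr.mul cs).sqrt.sqrt
  have cη := pη.continuousOn
  refine ⟨_, _, pη, isPrimitive_of_hasDerivWithinAt hab hder (cb.mul (cη.mul cc)),
    isPrimitive_of_hasDerivWithinAt hab (fun x hx => ((hder x hx).fun_inv (hb x hx).ne').congr_deriv ?_)
      ((cb.inv₀ fun x hx => (hb x hx).ne').mul (cη.mul cc)).neg⟩
  have := hb x hx
  field_simp

theorem travelTime_pos (h : IsStringCoeff a b ρ σ q) (hab : a < b) : 0 < travelTime a b ρ σ := by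
  refine intervalIntegral.intervalIntegral_pos_of_pos_on
    (h.continuousOn_sqrt_div.intervalIntegrable_of_Icc hab.le) (fun x hx => ?_) hab
  have hx' := Ioo_subset_Icc_self hx
  exact Real.sqrt_pos.2 (div_pos (h.rho_pos' hx') (h.sigma_pos' hx'))

/-- The optical coordinate is continued constantly outside [a, b], and κ₀ is replaced by a
measurable representative: the kernel construction requires both to be defined and measurable on the
whole line. -/
theorem exists_isNormalForm (h : IsStringCoeff a b ρ σ q) (hab : a < b) {κ₀ : ℝ → ℝ}
    (hκ : IntervalIntegrable κ₀ volume a b) :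
    ∃ τ κ : ℝ → ℝ, IsNormalForm a b τ (fun x => √(ρ x / σ x)) κ (travelTime a b ρ σ) ∧
      ∀ᵐ x, x ∈ Ioc a b → κ x = κ₀ x := by
  have hi := (intervalIntegrable_iff_integrableOn_Ioc_of_le hab.le).1 hκ
  have cc := h.continuousOn_sqrt_div
  have ci : IntervalIntegrable (fun x => √(ρ x / σ x)) volume a b :=
    cc.intervalIntegrable_of_Icc hab.le
  have pt := isPrimitive_integral ci 0
  have proj : ∀ x, max a (min b x) ∈ Icc a b := fun x =>
    ⟨le_max_left _ _, max_le hab.le (min_le_left _ _)⟩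
  have projId : ∀ x ∈ Icc a b, max a (min b x) = x := fun x hx => by
    rw [min_eq_right hx.2, max_eq_right hx.1]
  have monoT : ∀ x ∈ Icc a b, ∀ z ∈ Icc a b, x ≤ z →
      ∫ t in a..x, √(ρ t / σ t) ≤ ∫ t in a..z, √(ρ t / σ t) := fun x hx z hz hxz =>
    intervalIntegral.integral_mono_interval le_rfl hx.1 hxz
      (Eventually.of_forall fun t => Real.sqrt_nonneg _) (IntervalIntegrable.mono_left_endpoint ci hz)
  have cont : Continuous fun x => ∫ t in a..(max a (min b x)), √(ρ t / σ t) := by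
    have := pt.continuousOn.comp_continuous (f := fun x => max a (min b x)) (by fun_prop) proj
    simpa [Function.comp_def] using this
  refine ⟨fun x => ∫ t in a..(max a (min b x)), √(ρ t / σ t), hi.1.mk κ₀, ⟨hab.le,
    ⟨cont.measurable, fun x => ?_, fun x => ?_, hi.1.stronglyMeasurable_mk.measurable, ?_⟩, ?_, cc,
    ?_, ?_, ?_⟩, ?_⟩
  · exact intervalIntegral.integral_nonneg (proj x).1 fun t _ => Real.sqrt_nonneg _
  · exact monoT _ (proj x) _ (right_mem_Icc.2 hab.le) (proj x).2
  · exact hi.congr hi.1.ae_eq_mk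
  · refine pt.congr hab.le (fun x hx => ?_) (Eventually.of_forall fun _ _ => rfl)
    rw [projId x hx, zero_add]
  · intro x hx z hz hxz
    beta_reduce
    rw [projId x hx, projId z hz]
    exact monoT x hx z hz hxz
  · rw [projId a (left_mem_Icc.2 hab.le), intervalIntegral.integral_same]
  · rw [projId b (right_mem_Icc.2 hab.le)]
    rfl
  · exact (ae_restrict_iff' measurableSet_Ioc).1 hi.1.ae_eq_mk.symm

theorem exists_isTransfer (h : IsStringCoeff a b ρ σ q) (hab : a < b) :
    ∃ (B C : ℝ) (y p : ℝ → ℝ → ℝ), 0 < B ∧ 0 < C ∧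
      IsTransfer a b ρ σ q (travelTime a b ρ σ) B C y p := by
  obtain ⟨η, η', pη, pβ, pβi⟩ := h.exists_liouville hab.le
  have cη := pη.continuousOn
  have cc := h.continuousOn_sqrt_div
  have hr : ∀ x ∈ Icc a b, 0 < ρ x := fun x hx => h.rho_pos' hx
  have hs : ∀ x ∈ Icc a b, 0 < σ x := fun x hx => h.sigma_pos' hx
  have hb : ∀ x ∈ Icc a b, 0 < √√(ρ x * σ x) := fun x hx =>
    Real.sqrt_pos.2 (Real.sqrt_pos.2 (mul_pos (hr x hx) (hs x hx)))
  have hbb : ∀ x ∈ Icc a b, √√(ρ x * σ x) ^ 2 * √(ρ x / σ x) = ρ x := fun x hx => by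
    have h1 := hr x hx
    have h2 := hs x hx
    rw [Real.sq_sqrt (Real.sqrt_nonneg _), ← Real.sqrt_mul (by positivity),
      show ρ x * σ x * (ρ x / σ x) = ρ x ^ 2 by field_simp, Real.sqrt_sq h1.le]
  have hbs : ∀ x ∈ Icc a b, √√(ρ x * σ x) ^ 2 = √(ρ x / σ x) * σ x := fun x hx => by
    have h1 := hr x hx
    have h2 := hs x hx
    rw [Real.sq_sqrt (Real.sqrt_nonneg _), ← Real.sqrt_sq h2.le, ← Real.sqrt_mul (by positivity),
      Real.sqrt_sq h2.le, show ρ x / σ x * σ x ^ 2 = ρ x * σ x by field_simp]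
  have cβi := pβi.continuousOn
  have qi : IntervalIntegrable q volume a b :=
    (intervalIntegrable_iff_integrableOn_Ioc_of_le hab.le).2 h.q_integrable
  have hu : uIcc a b = Icc a b := uIcc_of_le hab.le
  -- With β = (ρσ)^{1/4} and c = √(ρ/σ), this is the potential q/β² + η' + η²c for which y = Y/β and
  -- p = β(Z - ηY) solve the original equation; β²c = ρ and β² = cσ are used.
  have κi : IntervalIntegrable (fun x => q x * ((√√(ρ x * σ x))⁻¹ ^ 2) + η' x
      + η x * √(ρ x / σ x) * η x) volume a b := by
    refine ((qi.mul_continuousOn ?_).add pη.1).add (ContinuousOn.intervalIntegrable ?_)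
    · rw [hu]
      exact cβi.pow 2
    · rw [hu]
      exact (cη.mul cc).mul cη
  obtain ⟨τ, κ, nf, hκ⟩ := h.exists_isNormalForm hab κi
  set γ := travelTime a b ρ σ
  obtain ⟨E, hE, hYE⟩ := nf.wave.exists_abs_waveSol_le
  obtain ⟨E', hE', hYE'⟩ := nf.wave.exists_abs_waveSol_le_div
  obtain ⟨E'', hE'', hYE''⟩ := nf.exists_abs_mul_waveSol_sub_le
  obtain ⟨K, hK⟩ := isCompact_Icc.exists_bound_of_continuousOn cβi
  have hbm : b ∈ Icc a b := right_mem_Icc.2 hab.le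
  have ham : a ∈ Icc a b := left_mem_Icc.2 hab.le
  have hK0 : 0 ≤ K := (norm_nonneg _).trans (hK b hbm)
  set Y := waveSol (volume.restrict (Ioc a b)) τ κ with hYdef
  set Z := waveMom a b τ κ with hZdef
  set β := fun x => √√(ρ x * σ x) with hβ
  refine ⟨(β b)⁻¹, K * E + K * E' + K * E'' + 1, fun ω x => (β x)⁻¹ * Y ω x,
    fun ω x => β x * (Z ω x - η x * Y ω x), inv_pos.2 (hb b hbm), by positivity, ?_⟩
  have hKb : (β b)⁻¹ ≤ K := (le_abs_self _).trans (hK b hbm)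
  have hβb : 0 < (β b)⁻¹ := inv_pos.2 (hb b hbm)
  refine ⟨fun ω hω => ?_, fun ω hω => ?_, fun ω hω => ?_, fun ω x => ?_, fun ω x => ?_,
    fun ω x hx => ?_, fun x => ?_, ?_, ?_, ?_, fun ω hω => ?_, fun ω hω => ?_⟩
  · have pY := nf.isPrimitive_waveSol hω
    have pZ := nf.isPrimitive_waveMom hω
    have pp := pβ.mul hab.le (pZ.sub (pη.mul hab.le pY))
    have pp' : IsPrimitive a b (fun x => β x * (Z ω x - η x * Y ω x))
        fun x => (q x - ω ^ 2 * ρ x) * ((β x)⁻¹ * Y ω x) := by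
      refine pp.congr hab.le (fun x _ => rfl) ?_
      filter_upwards [hκ] with x hx hxm
      have hx' := Ioc_subset_Icc_self hxm
      have e1 := hbb x hx'
      have e2 := hx hxm
      have e3 := hb x hx'
      rw [e2, ← hYdef, ← hZdef]
      change 0 < β x at e3
      change β x ^ 2 * _ = _ at e1
      change β x * (η x * √(ρ x / σ x)) * _ + β x * ((q x * ((β x)⁻¹ ^ 2) + η' x
        + η x * √(ρ x / σ x) * η x - ω ^ 2 * √(ρ x / σ x)) * _ - _) = _
      generalize √(ρ x / σ x) = w at e1 ⊢
      rw [← e1]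
      field_simp
      ring
    refine ⟨fun x hx => ?_, pp'.2⟩
    have py := (pβi.mul hab.le pY).congr (g := fun x => (β x)⁻¹ * Y ω x)
      (g' := fun x => (β x * (Z ω x - η x * Y ω x)) / σ x) hab.le (fun x _ => rfl)
      (Eventually.of_forall fun x hxm => by
        have hx' := Ioc_subset_Icc_self hxm
        have e1 := hbs x hx'
        have e3 := hb x hx'
        have e4 := hs x hx'
        rw [← hYdef, ← hZdef]
        change 0 < β x at e3
        change β x ^ 2 = _ at e1
        change -((β x)⁻¹ * _) * _ + (β x)⁻¹ * _ = _
        field_simp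
        rw [e1]
        ring)
    exact py.hasDerivWithinAt (pp'.continuousOn.div h.continuousOn_sigma
      fun x hx => (hs x hx).ne') hx
  · rw [hYdef, nf.waveSol_left hω, mul_zero]
  · rw [hYdef, nf.waveSol_left hω, hZdef, nf.waveMom_left]
    have := hb a ham
    change 0 < β a at this
    simp [this.ne']
  · rw [hYdef, IsWaveData.waveSol_neg]
  · rw [hYdef, IsWaveData.waveSol_neg, hZdef, IsNormalForm.waveMom_neg]
  · rw [abs_mul]
    have : |(β x)⁻¹| * |Y ω x| ≤ K * E :=
      mul_le_mul (hK x hx) (hYE ω x) (abs_nonneg _) hK0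
    have h1 : 0 ≤ K * E' := by positivity
    have h2 : 0 ≤ K * E'' := by positivity
    linarith
  · exact continuous_const.mul (nf.wave.continuous_waveSol x)
  · have := (nf.wave.isBand_waveSol b).const_mul ((β b)⁻¹ : ℝ)
    simpa only [← Complex.ofReal_mul] using this
  · have := nf.isBand_mul_waveSol_right.const_mul ((β b)⁻¹ : ℝ)
    convert this using 2
    rw [← Complex.ofReal_mul]
    congr 1
    ring
  · have := (nf.isBand_waveMom_right.add ((nf.wave.isBand_waveSol b).const_mul
      (-η b : ℝ))).const_mul (β b : ℝ)
    convert this using 2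
    push_cast
    ring
  · have hω' := abs_pos.2 hω
    rw [abs_mul, abs_of_pos hβb]
    calc (β b)⁻¹ * |Y ω b| ≤ K * (E' / |ω|) :=
          mul_le_mul hKb (hYE' ω hω b) (abs_nonneg _) hK0
      _ = K * E' / |ω| := by ring
      _ ≤ _ := by
        have h1 : 0 ≤ K * E := by positivity
        have h2 : 0 ≤ K * E'' := by positivity
        gcongr
        linarith
  · have hω' := abs_pos.2 hω
    rw [show ω * ((β b)⁻¹ * Y ω b) - (β b)⁻¹ * Real.sin (ω * γ)
      = (β b)⁻¹ * (ω * Y ω b - Real.sin (ω * γ)) by ring, abs_mul, abs_of_pos hβb]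
    calc (β b)⁻¹ * |ω * Y ω b - Real.sin (ω * γ)| ≤ K * (E'' / |ω|) :=
          mul_le_mul hKb (hYE'' ω hω) (abs_nonneg _) hK0
      _ = K * E'' / |ω| := by ring
      _ ≤ _ := by
        have h1 : 0 ≤ K * E := by positivity
        have h2 : 0 ≤ K * E' := by positivity
        gcongr
        linarith

end IsStringCoeff

/-! ### Wronskian, energy and uniqueness -/

section

variable {a b l l' : ℝ} {ρ σ q y p y' p' : ℝ → ℝ}

theorem IsSLSolution.isPrimitive_mom (s : IsSLSolution a b ρ σ q l y p)
    (h : IsStringCoeff a b ρ σ q) (hab : a < b) :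
    IsPrimitive a b p fun x => (q x - l * ρ x) * y x := by
  refine ⟨?_, s.2⟩
  have cy : ContinuousOn y (Icc a b) := fun x hx => (s.1 x hx).continuousWithinAt
  have hu : uIcc a b = Icc a b := uIcc_of_le hab.le
  have qi : IntervalIntegrable q volume a b :=
    (intervalIntegrable_iff_integrableOn_Ioc_of_le hab.le).2 h.q_integrable
  refine (qi.sub (ContinuousOn.intervalIntegrable ?_)).mul_continuousOn (by rwa [hu])
  rw [hu]
  exact continuousOn_const.mul h.continuousOn_rho

theorem IsSLSolution.isPrimitive (s : IsSLSolution a b ρ σ q l y p)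
    (h : IsStringCoeff a b ρ σ q) (hab : a < b) : IsPrimitive a b y fun x => p x / σ x :=
  isPrimitive_of_hasDerivWithinAt hab.le s.1 ((s.isPrimitive_mom h hab).continuousOn.div
    h.continuousOn_sigma fun _ hx => (h.sigma_pos' hx).ne')

theorem IsSLSolution.combination (s : IsSLSolution a b ρ σ q l y p)
    (s' : IsSLSolution a b ρ σ q l y' p') (h : IsStringCoeff a b ρ σ q) (hab : a < b) (k k' : ℝ) :
    IsSLSolution a b ρ σ q l (fun x => k * y x + k' * y' x) fun x => k * p x + k' * p' x := by
  refine ⟨fun x hx => (((s.1 x hx).const_mul k).add ((s'.1 x hx).const_mul k')).congr_deriv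
    (by ring), ?_⟩
  have := ((s.isPrimitive_mom h hab).const_mul k).add ((s'.isPrimitive_mom h hab).const_mul k')
  exact (this.congr hab.le (fun _ _ => rfl) (Eventually.of_forall fun x _ => by ring)).2

theorem IsSLSolution.const_mul (s : IsSLSolution a b ρ σ q l y p) (h : IsStringCoeff a b ρ σ q)
    (hab : a < b) (k : ℝ) :
    IsSLSolution a b ρ σ q l (fun x => k * y x) fun x => k * p x := by
  simpa using s.combination s h hab k 0

/-- Lagrange's identity. Here y' and p' denote a second solution, at parameter l'; the potential
cancels in the derivative of p y' - y p'. -/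
theorem IsSLSolution.wronskian (s : IsSLSolution a b ρ σ q l y p)
    (s' : IsSLSolution a b ρ σ q l' y' p') (h : IsStringCoeff a b ρ σ q) (hab : a < b) :
    p b * y' b - y b * p' b = p a * y' a - y a * p' a
      + (l' - l) * ∫ x in a..b, ρ x * (y x * y' x) := by
  have key := ((s.isPrimitive_mom h hab).mul hab.le (s'.isPrimitive h hab)).sub
    ((s.isPrimitive h hab).mul hab.le (s'.isPrimitive_mom h hab))
  refine (key.2 b (right_mem_Icc.2 hab.le)).trans ?_
  rw [← intervalIntegral.integral_const_mul]
  congr 2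
  ext x
  ring

theorem IsSLSolution.energy (s : IsSLSolution a b ρ σ q l y p)
    (h : IsStringCoeff a b ρ σ q) (hab : a < b) :
    p b * y b - p a * y a = (∫ x in a..b, q x * y x ^ 2) - l * (∫ x in a..b, ρ x * y x ^ 2)
      + ∫ x in a..b, p x ^ 2 / σ x := by
  have cy := (s.isPrimitive h hab).continuousOn
  have cp := (s.isPrimitive_mom h hab).continuousOn
  have cs := h.continuousOn_sigma
  have cr := h.continuousOn_rho
  have hu : uIcc a b = Icc a b := uIcc_of_le hab.le
  have qi : IntervalIntegrable q volume a b :=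
    (intervalIntegrable_iff_integrableOn_Ioc_of_le hab.le).2 h.q_integrable
  have i1 : IntervalIntegrable (fun x => q x * y x ^ 2) volume a b :=
    qi.mul_continuousOn (by rw [hu]; exact cy.pow 2)
  have i2 : IntervalIntegrable (fun x => ρ x * y x ^ 2) volume a b :=
    (cr.mul (cy.pow 2)).intervalIntegrable_of_Icc hab.le
  have i3 : IntervalIntegrable (fun x => p x ^ 2 / σ x) volume a b :=
    ((cp.pow 2).div cs fun _ hx => (h.sigma_pos' hx).ne').intervalIntegrable_of_Icc hab.le
  rw [← intervalIntegral.integral_const_mul, ← intervalIntegral.integral_sub i1 (i2.const_mul _),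
    ← intervalIntegral.integral_add (i1.sub (i2.const_mul _)) i3, sub_eq_iff_eq_add']
  refine (((s.isPrimitive_mom h hab).mul hab.le (s.isPrimitive h hab)).2 b
    (right_mem_Icc.2 hab.le)).trans ?_
  congr 2
  ext x
  ring

/-- With Q the maximum of |y| e^{-L(x-a)}, integrating the system twice gives Q ≤ SKQ/L. The
coefficient q - lρ is only integrable, so its L¹ norm K takes the place of a Lipschitz constant. -/
theorem IsSLSolution.eq_zero_of_left (s : IsSLSolution a b ρ σ q l y p)
    (h : IsStringCoeff a b ρ σ q) (hab : a < b) (hy : y a = 0) (hp : p a = 0) :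
    ∀ x ∈ Icc a b, y x = 0 ∧ p x = 0 := by
  have cy := (s.isPrimitive h hab).continuousOn
  have pm := s.isPrimitive_mom h hab
  have pr := s.isPrimitive h hab
  obtain ⟨S, hS⟩ := isCompact_Icc.exists_bound_of_continuousOn
    (h.continuousOn_sigma.inv₀ fun x hx => (h.sigma_pos' hx).ne')
  have qi : IntervalIntegrable q volume a b :=
    (intervalIntegrable_iff_integrableOn_Ioc_of_le hab.le).2 h.q_integrable
  have ki : IntervalIntegrable (fun x => |q x - l * ρ x|) volume a b :=
    (qi.sub ((h.continuousOn_rho.intervalIntegrable_of_Icc hab.le).const_mul l)).abs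
  have ham : a ∈ Icc a b := left_mem_Icc.2 hab.le
  have hbm : b ∈ Icc a b := right_mem_Icc.2 hab.le
  set K := ∫ x in a..b, |q x - l * ρ x| with hK
  have hK0 : 0 ≤ K := intervalIntegral.integral_nonneg hab.le fun _ _ => abs_nonneg _
  have hS0 : 0 ≤ S := (norm_nonneg _).trans (hS a ham)
  -- Makes SK/L at most 1/2, hence Q = 0.
  set L := 2 * (S * K) + 1 with hL
  have hL0 : 0 < L := by positivity
  obtain ⟨z, hz, hmax⟩ := isCompact_Icc.exists_isMaxOn (nonempty_Icc.2 hab.le)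
    (f := fun x => |y x| * Real.exp (-(L * (x - a)))) (cy.abs.mul (by fun_prop))
  set Q := |y z| * Real.exp (-(L * (z - a))) with hQ
  have hQ0 : 0 ≤ Q := by positivity
  have hyQ : ∀ x ∈ Icc a b, |y x| ≤ Q * Real.exp (L * (x - a)) := fun x hx => by
    have h1 : |y x| * Real.exp (-(L * (x - a))) ≤ Q := hmax hx
    rwa [Real.exp_neg, ← div_eq_mul_inv, div_le_iff₀ (Real.exp_pos _)] at h1
  have hpQ : ∀ x ∈ Icc a b, |p x| ≤ Q * Real.exp (L * (x - a)) * K := fun x hx => by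
    rw [pm.2 x hx, hp, zero_add, ← Real.norm_eq_abs]
    have kx := IntervalIntegrable.mono_left_endpoint ki hx
    refine (intervalIntegral.norm_integral_le_of_norm_le hx.1 (Eventually.of_forall fun t ht => ?_)
      (kx.const_mul (Q * Real.exp (L * (x - a))))).trans ?_
    · have ht' : t ∈ Icc a b := ⟨ht.1.le, ht.2.trans hx.2⟩
      rw [norm_mul, mul_comm]
      refine mul_le_mul_of_nonneg_right ((hyQ t ht').trans ?_) (norm_nonneg _)
      have := ht.2
      gcongr
    · rw [intervalIntegral.integral_const_mul]
      refine mul_le_mul_of_nonneg_left ?_ (by positivity)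
      exact intervalIntegral.integral_mono_interval le_rfl hx.1 hx.2
        (Eventually.of_forall fun t => abs_nonneg _) ki
  have hyz : |y z| ≤ S * K * Q * (Real.exp (L * (z - a)) / L) := by
    rw [pr.2 z hz, hy, zero_add, ← Real.norm_eq_abs]
    have hd : ∀ x ∈ uIcc a z, HasDerivAt (fun x => Real.exp (L * (x - a)) / L)
        (Real.exp (L * (x - a))) x := fun x _ => by
      have h1 := ((((hasDerivAt_id x).sub_const a).const_mul L).exp).div_const L
      simpa [hL0.ne'] using h1
    have e1 := intervalIntegral.integral_eq_sub_of_hasDerivAt hd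
      (Continuous.intervalIntegrable (by fun_prop) _ _)
    refine (intervalIntegral.norm_integral_le_of_norm_le hz.1
      (g := fun x => S * K * Q * Real.exp (L * (x - a))) (Eventually.of_forall fun t ht => ?_)
      (Continuous.intervalIntegrable (by fun_prop) _ _)).trans ?_
    · have ht' : t ∈ Icc a b := ⟨ht.1.le, ht.2.trans hz.2⟩
      rw [div_eq_mul_inv, norm_mul]
      calc ‖p t‖ * ‖(σ t)⁻¹‖ ≤ Q * Real.exp (L * (t - a)) * K * S :=
            mul_le_mul (hpQ t ht') (hS t ht') (norm_nonneg _) (by positivity)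
        _ = _ := by ring
    · rw [intervalIntegral.integral_const_mul, e1]
      refine mul_le_mul_of_nonneg_left ?_ (by positivity)
      have : 0 ≤ Real.exp (L * (a - a)) / L := by positivity
      linarith
  have hQz : Q = 0 := by
    have e2 : Q ≤ S * K * Q / L := by
      have e4 : Q = |y z| / Real.exp (L * (z - a)) := by rw [hQ, Real.exp_neg, div_eq_mul_inv]
      nth_rewrite 1 [e4]
      rw [div_le_iff₀ (Real.exp_pos _)]
      exact hyz.trans (le_of_eq (by ring))
    have e3 : S * K * Q / L ≤ Q / 2 := by
      rw [div_le_div_iff₀ hL0 two_pos, hL]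
      nlinarith
    linarith
  intro x hx
  have h1 := hyQ x hx
  have h2 := hpQ x hx
  simp only [hQz, zero_mul, abs_nonpos_iff] at h1 h2
  exact ⟨h1, h2⟩

end

/-! ### Reflection, so that both strings are fixed at -1 and joined at 0 -/

section Reflection

theorem integral_comp_neg_eq {f : ℝ → ℝ} (a x : ℝ) :
    ∫ t in a..x, f (-t) = -∫ t in (-a)..(-x), f t := by
  rw [intervalIntegral.integral_comp_neg, intervalIntegral.integral_symm]

theorem IsPrimitive.reflect {a b : ℝ} {f f' : ℝ → ℝ} (hab : a ≤ b) (h : IsPrimitive a b f f') :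
    IsPrimitive (-b) (-a) (fun x => f (-x)) fun x => -f' (-x) := by
  have h1 : IntervalIntegrable (fun x => f' (-x)) volume (-b) (-a) := by
    have := h.1.comp_sub_left 0
    simpa using this.symm
  refine ⟨h1.neg, fun x hx => ?_⟩
  have hx' : -x ∈ Icc a b := ⟨by linarith [hx.2], by linarith [hx.1]⟩
  have hi := IntervalIntegrable.mono_left_endpoint h.1 hx'
  beta_reduce
  rw [intervalIntegral.integral_neg, integral_comp_neg_eq, neg_neg, neg_neg, h.2 (-x) hx',
    h.2 b (right_mem_Icc.2 hab), ← intervalIntegral.integral_add_adjacent_intervals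
      (a := a) (b := b) (c := -x) h.1 (h.1.symm.trans hi)]
  ring

theorem hasDerivWithinAt_reflect {a b : ℝ} {f : ℝ → ℝ} {d x : ℝ}
    (h : HasDerivWithinAt f d (Icc a b) (-x)) :
    HasDerivWithinAt (fun x => f (-x)) (-d) (Icc (-b) (-a)) x := by
  have := h.scomp x (h := fun x : ℝ => -x) (s := Icc (-b) (-a)) (hasDerivAt_neg x).hasDerivWithinAt
    fun y hy => ⟨by linarith [hy.2], by linarith [hy.1]⟩
  simpa [Function.comp_def] using this

theorem measurePreserving_neg_Ioc (a b : ℝ) :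
    MeasurePreserving (fun x : ℝ => -x) (volume.restrict (Ioc (-b) (-a)))
      (volume.restrict (Ioc a b)) := by
  have h1 := (Measure.measurePreserving_neg (volume : Measure ℝ)).restrict_preimage
    (s := Ico a b) measurableSet_Ico
  have h2 : (Neg.neg : ℝ → ℝ) ⁻¹' Ico a b = Ioc (-b) (-a) := by
    ext x
    simp only [mem_preimage, mem_Ico, mem_Ioc]
    constructor <;> rintro ⟨h3, h4⟩ <;> constructor <;> linarith
  rw [h2, restrict_Ico_eq_restrict_Ioc] at h1
  exact h1

theorem MemH2.reflect {a b : ℝ} {f : ℝ → ℝ} (hab : a ≤ b) (h : MemH2 a b f) :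
    MemH2 (-b) (-a) fun x => f (-x) := by
  obtain ⟨f', f'', h1, h2, h3⟩ := h
  have p1 : IsPrimitive a b f' f'' :=
    ⟨(intervalIntegrable_iff_integrableOn_Ioc_of_le hab).2 (h1.integrable (by norm_num)), h3⟩
  have p2 := (p1.reflect hab).const_mul (-1)
  refine ⟨fun x => -f' (-x), fun x => f'' (-x), h1.comp_measurePreserving
    (measurePreserving_neg_Ioc a b), fun x hx => hasDerivWithinAt_reflect
      (h2 (-x) ⟨by linarith [hx.2], by linarith [hx.1]⟩), fun x hx => ?_⟩
  simpa using p2.2 x hx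

theorem IsStringCoeff.reflect {a b : ℝ} {ρ σ q : ℝ → ℝ} (hab : a ≤ b)
    (h : IsStringCoeff a b ρ σ q) :
    IsStringCoeff (-b) (-a) (fun x => ρ (-x)) (fun x => σ (-x)) fun x => q (-x) := by
  have hm : ∀ x ∈ Icc (-b) (-a), -x ∈ Icc a b := fun x hx =>
    ⟨by linarith [hx.2], by linarith [hx.1]⟩
  refine ⟨h.rho_mem.reflect hab, h.sigma_mem.reflect hab,
    (measurePreserving_neg_Ioc a b).integrable_comp_of_integrable h.q_integrable, ?_, ?_, ?_⟩
  · obtain ⟨c, hc, h1⟩ := h.rho_pos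
    exact ⟨c, hc, fun x hx => h1 _ (hm x hx)⟩
  · obtain ⟨c, hc, h1⟩ := h.sigma_pos
    exact ⟨c, hc, fun x hx => h1 _ (hm x hx)⟩
  · exact (measurePreserving_neg_Ioc a b).quasiMeasurePreserving.ae h.q_nonneg

theorem travelTime_reflect (a b : ℝ) (ρ σ : ℝ → ℝ) :
    travelTime (-b) (-a) (fun x => ρ (-x)) (fun x => σ (-x)) = travelTime a b ρ σ := by
  rw [travelTime, intervalIntegral.integral_comp_neg fun x => √(ρ x / σ x), neg_neg, neg_neg]
  rfl

theorem IsSLSolution.reflect {a b l : ℝ} {ρ σ q y p : ℝ → ℝ} (s : IsSLSolution a b ρ σ q l y p)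
    (h : IsStringCoeff a b ρ σ q) (hab : a < b) :
    IsSLSolution (-b) (-a) (fun x => ρ (-x)) (fun x => σ (-x)) (fun x => q (-x)) l
      (fun x => y (-x)) fun x => -p (-x) := by
  refine ⟨fun x hx => ?_, fun x hx => ?_⟩
  · rw [neg_div]
    exact hasDerivWithinAt_reflect (s.1 (-x) ⟨by linarith [hx.2], by linarith [hx.1]⟩)
  · have := (((s.isPrimitive_mom h hab).reflect hab.le).const_mul (-1)).2 x hx
    simpa using this

theorem IsSLSolution.eq_zero_of_right {a b l : ℝ} {ρ σ q y p : ℝ → ℝ}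
    (s : IsSLSolution a b ρ σ q l y p)
    (h : IsStringCoeff a b ρ σ q) (hab : a < b) (hy : y b = 0) (hp : p b = 0) :
    ∀ x ∈ Icc a b, y x = 0 ∧ p x = 0 := by
  intro x hx
  have := (s.reflect h hab).eq_zero_of_left (h.reflect hab.le) (neg_lt_neg hab) (by simpa using hy)
    (by simpa using hp) (-x) ⟨by linarith [hx.2], by linarith [hx.1]⟩
  simpa using this

end Reflection

theorem IsBand.differentiable_ofReal {lo hi : ℝ} {f : ℝ → ℝ} (h : IsBand lo hi fun ω => (f ω : ℂ)) :
    Differentiable ℝ f := fun ω =>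
  (Complex.reCLM.hasFDerivAt.comp_hasDerivAt ω (h.differentiable ω).hasDerivAt).differentiableAt

theorem IsBand.deriv_ofReal_eq {lo hi : ℝ} {f : ℝ → ℝ} (h : IsBand lo hi fun ω => (f ω : ℂ)) :
    _root_.deriv (fun ω => (f ω : ℂ)) = fun ω => ((_root_.deriv f ω : ℝ) : ℂ) := by
  ext ω
  exact (h.differentiable_ofReal ω).hasDerivAt.ofReal_comp.deriv

theorem IsBand.deriv_ofReal {lo hi : ℝ} {f : ℝ → ℝ} (h : IsBand lo hi fun ω => (f ω : ℂ)) :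
    IsBand lo hi fun ω => ((_root_.deriv f ω : ℝ) : ℂ) := by
  rw [← h.deriv_ofReal_eq]
  exact h.deriv

theorem IsBand.exists_abs_le {lo hi : ℝ} {f : ℝ → ℝ} (h : IsBand lo hi fun ω => (f ω : ℂ)) :
    ∃ C > 0, ∀ ω, |f ω| ≤ C := by
  obtain ⟨C, hC, hb⟩ := h.exists_bound
  exact ⟨C, hC, fun ω => by simpa using hb ω⟩

/-! ### Dependence of the junction data on the frequency -/

namespace IsTransfer

variable {a b γ B C : ℝ} {ρ σ q : ℝ → ℝ} {y p : ℝ → ℝ → ℝ}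

theorem exists_ne_zero (t : IsTransfer a b ρ σ q γ B C y p) (h : IsStringCoeff a b ρ σ q)
    (hab : a < b) {ω : ℝ} (hω : ω ≠ 0) : ∃ x ∈ Icc a b, y ω x ≠ 0 := by
  by_contra! hn
  have ham : a ∈ Icc a b := left_mem_Icc.2 hab.le
  have h1 : HasDerivWithinAt (y ω) 0 (Icc a b) a :=
    (hasDerivWithinAt_const a (Icc a b) (0 : ℝ)).congr hn (hn a ham)
  have h2 := (uniqueDiffOn_Icc hab a ham).eq_deriv _ ((t.sol ω hω).1 a ham) h1
  rcases div_eq_zero_iff.1 h2 with h3 | h3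
  · exact t.p_left ω hω h3
  · exact (h.sigma_pos' ham).ne' h3

theorem right_ne_zero (t : IsTransfer a b ρ σ q γ B C y p) (h : IsStringCoeff a b ρ σ q)
    (hab : a < b) {ω : ℝ} (hω : ω ≠ 0) (hy : y ω b = 0) : p ω b ≠ 0 := fun hp =>
  t.p_left ω hω ((t.sol ω hω).eq_zero_of_right h hab hy hp a (left_mem_Icc.2 hab.le)).2

theorem exists_eq_mul (t : IsTransfer a b ρ σ q γ B C y p) (h : IsStringCoeff a b ρ σ q)
    (hab : a < b) {ω : ℝ} (hω : ω ≠ 0) {u pu : ℝ → ℝ} (s : IsSLSolution a b ρ σ q (ω ^ 2) u pu)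
    (hu : u a = 0) : ∃ k, ∀ x ∈ Icc a b, u x = k * y ω x ∧ pu x = k * p ω x := by
  refine ⟨pu a / p ω a, fun x hx => ?_⟩
  have hp := t.p_left ω hω
  have := (s.combination (t.sol ω hω) h hab 1 (-(pu a / p ω a))).eq_zero_of_left h hab
    (by simp [hu, t.y_left ω hω]) (by field_simp; ring) x hx
  constructor
  · linarith [this.1]
  · linarith [this.2]

/-- The derivative of the Wronskian with respect to the frequency. -/
theorem exists_deriv_wronskian (t : IsTransfer a b ρ σ q γ B C y p) (h : IsStringCoeff a b ρ σ q)
    (hab : a < b) {ω : ℝ} (hω : ω ≠ 0) :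
    ∃ I > 0, p ω b * deriv (fun ω => y ω b) ω - y ω b * deriv (fun ω => p ω b) ω = 2 * ω * I := by
  have cy : ∀ {μ : ℝ}, μ ≠ 0 → ContinuousOn (y μ) (Icc a b) := fun hμ =>
    ((t.sol _ hμ).isPrimitive h hab).continuousOn
  have cr := h.continuousOn_rho
  refine ⟨∫ x in a..b, ρ x * (y ω x * y ω x), ?_, ?_⟩
  · obtain ⟨x, hx, hxy⟩ := t.exists_ne_zero h hab hω
    refine intervalIntegral.integral_pos hab (cr.mul ((cy hω).mul (cy hω))) (fun z hz => ?_)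
      ⟨x, hx, mul_pos (h.rho_pos' hx) (mul_self_pos.2 hxy)⟩
    exact mul_nonneg (h.rho_pos' (Ioc_subset_Icc_self hz)).le (mul_self_nonneg _)
  · have dy := t.band_y.differentiable_ofReal
    have dp := t.band_p.differentiable_ofReal
    -- The first solution stays at ω while μ varies. By Lagrange's identity the difference quotient
    -- at ω is (μ + ω)∫ρ y_ω y_μ, because (μ² - ω²)/(μ - ω) = μ + ω.
    have d1 : HasDerivAt (fun μ => p ω b * y μ b - y ω b * p μ b)
        (p ω b * deriv (fun ω => y ω b) ω - y ω b * deriv (fun ω => p ω b) ω) ω :=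
      ((dy ω).hasDerivAt.const_mul _).sub ((dp ω).hasDerivAt.const_mul _)
    have cI : ContinuousAt (fun μ => ∫ x in a..b, ρ x * (y ω x * y μ x)) ω := by
      obtain ⟨R, hR⟩ := isCompact_Icc.exists_bound_of_continuousOn cr
      have hsub : uIoc a b ⊆ Icc a b := by
        rw [uIoc_of_le hab.le]
        exact Ioc_subset_Icc_self
      refine intervalIntegral.continuousAt_of_dominated_interval (bound := fun _ => R * (C * C))
        ?_ (Eventually.of_forall fun μ => Eventually.of_forall fun x hx => ?_)
        intervalIntegrable_const (Eventually.of_forall fun x hx => ?_)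
      · filter_upwards [isOpen_ne.mem_nhds hω] with μ hμ
        exact ((cr.mul ((cy hω).mul (cy hμ))).mono hsub).aestronglyMeasurable measurableSet_uIoc
      · have hx' := hsub hx
        have h1 := t.abs_le ω x hx'
        rw [norm_mul, norm_mul]
        exact mul_le_mul (hR x hx') (mul_le_mul h1 (t.abs_le μ x hx') (norm_nonneg _)
          ((abs_nonneg _).trans h1)) (by positivity) ((norm_nonneg _).trans (hR x hx'))
      · exact (continuous_const.mul (continuous_const.mul (t.continuous x))).continuousAt
    have d2 := hasDerivAt_iff_tendsto_slope.1 d1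
    have d3 : Tendsto (fun μ => (μ + ω) * ∫ x in a..b, ρ x * (y ω x * y μ x)) (𝓝[≠] ω)
        (𝓝 ((ω + ω) * ∫ x in a..b, ρ x * (y ω x * y ω x))) :=
      ((continuousAt_id.add continuousAt_const).mul cI).tendsto.mono_left nhdsWithin_le_nhds
    rw [tendsto_nhds_unique d2 (d3.congr' ?_)]
    · ring
    · filter_upwards [self_mem_nhdsWithin, nhdsWithin_le_nhds (isOpen_ne.mem_nhds hω)] with μ h1 h2
      have w := (t.sol ω hω).wronskian (t.sol μ h2) h hab
      rw [t.y_left ω hω, t.y_left μ h2] at w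
      have h3 : μ - ω ≠ 0 := sub_ne_zero.2 h1
      rw [slope_def_field, w, eq_div_iff h3]
      ring

end IsTransfer

/-! ### The characteristic function: band, simplicity and location of zeros -/

/-- The characteristic function of two strings with boundary data `φᵢ = yᵢ(0)`, `Pᵢ = pᵢ(0)` at the
common end point, joined by a mass `M`. -/
def charFun (M : ℝ) (φ₁ P₁ φ₂ P₂ : ℝ → ℝ) (ω : ℝ) : ℝ :=
  M * (ω * φ₁ ω) * (ω * φ₂ ω) - P₁ ω * φ₂ ω - P₂ ω * φ₁ ω

/-- A function that is positive at one point and not positive at a later one has a zero in between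
at which its derivative is not positive. -/
theorem exists_zero_deriv_nonpos {g : ℝ → ℝ} (hg : Differentiable ℝ g) {x z : ℝ} (hxz : x ≤ z)
    (hx : 0 < g x) (hz : g z ≤ 0) : ∃ w ∈ Icc x z, g w = 0 ∧ deriv g w ≤ 0 := by
  have hc : IsCompact (Icc x z ∩ g ⁻¹' Iic 0) :=
    isCompact_Icc.inter_right (isClosed_Iic.preimage hg.continuous)
  obtain ⟨w, ⟨hw, hw0⟩, hmin⟩ := hc.exists_isLeast ⟨z, right_mem_Icc.2 hxz, hz⟩
  have hpos : ∀ v ∈ Ico x w, 0 < g v := fun v hv => by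
    by_contra hn
    exact absurd (hmin ⟨⟨hv.1, hv.2.le.trans hw.2⟩, not_lt.1 hn⟩) (not_le.2 hv.2)
  have hxw : x < w := lt_of_le_of_ne hw.1 fun h => (not_le.2 hx) (h ▸ hw0)
  have hev : ∀ᶠ v in 𝓝[<] w, v ∈ Ico x w := Ico_mem_nhdsLT hxw
  have hw0' : g w = 0 := le_antisymm hw0 (ge_of_tendsto
    (hg.continuous.continuousAt.tendsto.mono_left nhdsWithin_le_nhds)
    (hev.mono fun v hv => (hpos v hv).le))
  refine ⟨w, hw, hw0', ?_⟩
  have hs := (hasDerivWithinAt_iff_tendsto_slope' self_notMem_Iio).1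
    ((hg w).hasDerivAt.hasDerivWithinAt (s := Iio w))
  refine le_of_tendsto hs (hev.mono fun v hv => ?_)
  rw [slope_def_field, hw0', sub_zero]
  exact div_nonpos_of_nonneg_of_nonpos (hpos v hv).le (by linarith [hv.2])

/-- If all the zeros of `g` on an interval are strictly increasing then there is only one. -/
theorem zero_unique_of_deriv_pos {g : ℝ → ℝ} (hg : Differentiable ℝ g) {x z : ℝ} (hxz : x < z)
    (hx : g x = 0) (hz : g z = 0) (h : ∀ w ∈ Icc x z, g w = 0 → 0 < deriv g w) : False := by
  have hs := (hasDerivWithinAt_iff_tendsto_slope' self_notMem_Ioi).1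
    ((hg x).hasDerivAt.hasDerivWithinAt (s := Ioi x))
  obtain ⟨v, hv, hvx⟩ := ((hs.eventually (lt_mem_nhds (h x (left_mem_Icc.2 hxz.le) hx))).and
    (Ioo_mem_nhdsGT hxz)).exists
  rw [slope_def_field, hx, sub_zero, div_pos_iff_of_pos_right (sub_pos.2 hvx.1)] at hv
  obtain ⟨w, hw, hw0, hw1⟩ := exists_zero_deriv_nonpos hg hvx.2.le hv hz.le
  exact absurd (h w ⟨hvx.1.le.trans hw.1, hw.2⟩ hw0) (not_lt.2 hw1)

/-- If F had no zero it would keep one sign, and then -F(x)·g would cross every zero upwards, which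
cannot happen at two zeros of a differentiable function. -/
theorem exists_zero_of_deriv_mul_neg {F g : ℝ → ℝ} (hF : Continuous F) (hg : Differentiable ℝ g)
    {x z : ℝ} (hxz : x < z) (hx : g x = 0) (hz : g z = 0)
    (h : ∀ w ∈ Icc x z, g w = 0 → F w = 0 ∨ F w * deriv g w < 0) : ∃ w ∈ Icc x z, F w = 0 := by
  by_contra! hn
  have hm : x ∈ Icc x z := left_mem_Icc.2 hxz.le
  have hsign : ∀ w ∈ Icc x z, 0 < F x * F w := fun w hw => by
    by_contra hle
    have h0 : (0 : ℝ) ∈ uIcc (F x) (F w) := by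
      rw [mem_uIcc]
      rcases lt_or_gt_of_ne (hn x hm) with h1 | h1
      · left
        exact ⟨h1.le, by nlinarith⟩
      · right
        exact ⟨by nlinarith, h1.le⟩
    obtain ⟨v, hv, hv0⟩ := intermediate_value_uIcc hF.continuousOn h0
    rw [uIcc_of_le hw.1] at hv
    exact hn v ⟨hv.1, hv.2.trans hw.2⟩ hv0
  refine zero_unique_of_deriv_pos (g := fun w => -F x * g w) (hg.const_mul _) hxz (by simp [hx])
    (by simp [hz]) fun w hw hgw => ?_
  have hgw' : g w = 0 := by
    simpa [hn x hm] using hgw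
  rw [deriv_const_mul _ (hg w)]
  have h1 := (h w hw hgw').resolve_left (hn w hw)
  have h2 := hsign w hw
  have h3 : 0 < F w ^ 2 := by have := hn w hw; positivity
  have h4 : 0 < (-F x * deriv g w) * F w ^ 2 := by
    have : (-F x * deriv g w) * F w ^ 2 = (F x * F w) * -(F w * deriv g w) := by ring
    rw [this]
    exact mul_pos h2 (by linarith)
  exact (mul_pos_iff_of_pos_right h3).1 h4

section

variable {a₁ b₁ γ₁ B₁ C₁ : ℝ} {ρ₁ σ₁ q₁ : ℝ → ℝ} {y₁ p₁ : ℝ → ℝ → ℝ}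
  {a₂ b₂ γ₂ B₂ C₂ : ℝ} {ρ₂ σ₂ q₂ : ℝ → ℝ} {y₂ p₂ : ℝ → ℝ → ℝ} {M : ℝ}

/-- The factor ω² is shared between φ₁ and φ₂, since each ωφ_i is band-limited. -/
theorem IsTransfer.isBand_charFun (t₁ : IsTransfer a₁ b₁ ρ₁ σ₁ q₁ γ₁ B₁ C₁ y₁ p₁)
    (t₂ : IsTransfer a₂ b₂ ρ₂ σ₂ q₂ γ₂ B₂ C₂ y₂ p₂) :
    IsBand (-(γ₁ + γ₂)) (γ₁ + γ₂) fun ω => (charFun M (fun ω => y₁ ω b₁) (fun ω => p₁ ω b₁)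
      (fun ω => y₂ ω b₂) (fun ω => p₂ ω b₂) ω : ℂ) := by
  have h1 := ((t₁.band_mul_y.mul t₂.band_mul_y).const_mul M)
  have h2 := ((t₁.band_p.mul t₂.band_y).const_mul (-1))
  have h3 := ((t₁.band_y.mul t₂.band_p).const_mul (-1))
  rw [neg_add]
  convert (h1.add h2).add h3 using 2
  rw [charFun]
  push_cast
  ring

theorem IsTransfer.hasDerivAt_charFun (t₁ : IsTransfer a₁ b₁ ρ₁ σ₁ q₁ γ₁ B₁ C₁ y₁ p₁)
    (t₂ : IsTransfer a₂ b₂ ρ₂ σ₂ q₂ γ₂ B₂ C₂ y₂ p₂) (ω : ℝ) :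
    HasDerivAt (charFun M (fun ω => y₁ ω b₁) (fun ω => p₁ ω b₁) (fun ω => y₂ ω b₂)
        (fun ω => p₂ ω b₂))
      (M * (y₁ ω b₁ + ω * deriv (fun ω => y₁ ω b₁) ω) * (ω * y₂ ω b₂)
        + M * (ω * y₁ ω b₁) * (y₂ ω b₂ + ω * deriv (fun ω => y₂ ω b₂) ω)
        - (deriv (fun ω => p₁ ω b₁) ω * y₂ ω b₂ + p₁ ω b₁ * deriv (fun ω => y₂ ω b₂) ω)
        - (deriv (fun ω => p₂ ω b₂) ω * y₁ ω b₁ + p₂ ω b₂ * deriv (fun ω => y₁ ω b₁) ω)) ω := by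
  have d1 := (t₁.band_y.differentiable_ofReal ω).hasDerivAt
  have d2 := (t₁.band_p.differentiable_ofReal ω).hasDerivAt
  have d3 := (t₂.band_y.differentiable_ofReal ω).hasDerivAt
  have d4 := (t₂.band_p.differentiable_ofReal ω).hasDerivAt
  refine ((((((hasDerivAt_id ω).fun_mul d1).const_mul M).fun_mul ((hasDerivAt_id ω).fun_mul d3)).fun_sub
    (d2.fun_mul d3)).fun_sub (d4.fun_mul d1)).congr_deriv ?_
  simp only [id]
  ring

/-- Formally F/(φ₁φ₂) = Mω² - P₁/φ₁ - P₂/φ₂ has derivative 2ω(M + I₁/φ₁² + I₂/φ₂²) by the Wronskian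
identities. After clearing denominators, a double zero would force φ₁ = φ₂ = 0; then P₁, P₂ ≠ 0 and
P₁P₂F' = -2ω(P₁²I₂ + P₂²I₁) ≠ 0. -/
theorem IsTransfer.deriv_charFun_ne_zero (t₁ : IsTransfer a₁ b₁ ρ₁ σ₁ q₁ γ₁ B₁ C₁ y₁ p₁)
    (t₂ : IsTransfer a₂ b₂ ρ₂ σ₂ q₂ γ₂ B₂ C₂ y₂ p₂) (h₁ : IsStringCoeff a₁ b₁ ρ₁ σ₁ q₁)
    (h₂ : IsStringCoeff a₂ b₂ ρ₂ σ₂ q₂) (hab₁ : a₁ < b₁) (hab₂ : a₂ < b₂) (hM : 0 < M) {ω : ℝ}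
    (hω : ω ≠ 0) (hF : charFun M (fun ω => y₁ ω b₁) (fun ω => p₁ ω b₁) (fun ω => y₂ ω b₂)
        (fun ω => p₂ ω b₂) ω = 0) :
    deriv (charFun M (fun ω => y₁ ω b₁) (fun ω => p₁ ω b₁) (fun ω => y₂ ω b₂)
        (fun ω => p₂ ω b₂)) ω ≠ 0 := by
  intro hF'
  rw [(t₁.hasDerivAt_charFun t₂ ω).deriv] at hF'
  obtain ⟨I₁, hI₁, w₁⟩ := t₁.exists_deriv_wronskian h₁ hab₁ hω
  obtain ⟨I₂, hI₂, w₂⟩ := t₂.exists_deriv_wronskian h₂ hab₂ hω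
  have n1 := t₁.right_ne_zero h₁ hab₁ hω
  have n2 := t₂.right_ne_zero h₂ hab₂ hω
  rw [charFun] at hF
  generalize y₁ ω b₁ = f₁ at *
  generalize p₁ ω b₁ = P₁ at *
  generalize y₂ ω b₂ = f₂ at *
  generalize p₂ ω b₂ = P₂ at *
  generalize deriv (fun ω => y₁ ω b₁) ω = f₁' at *
  generalize deriv (fun ω => p₁ ω b₁) ω = P₁' at *
  generalize deriv (fun ω => y₂ ω b₂) ω = f₂' at *
  generalize deriv (fun ω => p₂ ω b₂) ω = P₂' at *
  have e : 2 * ω * (M * (f₁ * f₂) ^ 2 + I₁ * f₂ ^ 2 + I₂ * f₁ ^ 2) = 0 := by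
    linear_combination (f₁ * f₂) * hF' - (f₁' * f₂ + f₁ * f₂') * hF - f₂ ^ 2 * w₁ - f₁ ^ 2 * w₂
  have e' : M * (f₁ * f₂) ^ 2 + I₁ * f₂ ^ 2 + I₂ * f₁ ^ 2 = 0 := by
    simpa [hω] using e
  have z2 : f₂ = 0 := by
    by_contra hn
    have : 0 < I₁ * f₂ ^ 2 := by positivity
    have : 0 ≤ I₂ * f₁ ^ 2 := by positivity
    have : 0 ≤ M * (f₁ * f₂) ^ 2 := by positivity
    linarith
  have z1 : f₁ = 0 := by
    by_contra hn
    have : 0 ≤ I₁ * f₂ ^ 2 := by positivity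
    have : 0 < I₂ * f₁ ^ 2 := by positivity
    have : 0 ≤ M * (f₁ * f₂) ^ 2 := by positivity
    linarith
  subst z1 z2
  have m1 := n1 rfl
  have m2 := n2 rfl
  have e2 : 2 * ω * (P₁ ^ 2 * I₂ + P₂ ^ 2 * I₁) = 0 := by
    linear_combination -(P₁ * P₂) * hF' - P₁ ^ 2 * w₂ - P₂ ^ 2 * w₁
  have : P₁ ^ 2 * I₂ + P₂ ^ 2 * I₁ ≠ 0 := by positivity
  simp [hω, this] at e2

/-- Interlacing: at a zero of φ₁φ₂ the product equals -2ω(I₁φ₂² + I₂φ₁²), which vanishes only if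
both factors do, and then F vanishes too. -/
theorem IsTransfer.charFun_mul_deriv (t₁ : IsTransfer a₁ b₁ ρ₁ σ₁ q₁ γ₁ B₁ C₁ y₁ p₁)
    (t₂ : IsTransfer a₂ b₂ ρ₂ σ₂ q₂ γ₂ B₂ C₂ y₂ p₂) (h₁ : IsStringCoeff a₁ b₁ ρ₁ σ₁ q₁)
    (h₂ : IsStringCoeff a₂ b₂ ρ₂ σ₂ q₂) (hab₁ : a₁ < b₁) (hab₂ : a₂ < b₂) {ω : ℝ}
    (hω : 0 < ω) (hg : y₁ ω b₁ * y₂ ω b₂ = 0) :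
    charFun M (fun ω => y₁ ω b₁) (fun ω => p₁ ω b₁) (fun ω => y₂ ω b₂) (fun ω => p₂ ω b₂) ω = 0 ∨
      charFun M (fun ω => y₁ ω b₁) (fun ω => p₁ ω b₁) (fun ω => y₂ ω b₂) (fun ω => p₂ ω b₂) ω *
        deriv (fun ω => y₁ ω b₁ * y₂ ω b₂) ω < 0 := by
  obtain ⟨I₁, hI₁, w₁⟩ := t₁.exists_deriv_wronskian h₁ hab₁ hω.ne'
  obtain ⟨I₂, hI₂, w₂⟩ := t₂.exists_deriv_wronskian h₂ hab₂ hω.ne'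
  rw [((t₁.band_y.differentiable_ofReal ω).hasDerivAt.fun_mul
    (t₂.band_y.differentiable_ofReal ω).hasDerivAt).deriv, charFun]
  generalize deriv (fun ω => y₁ ω b₁) ω = f₁' at *
  generalize deriv (fun ω => p₁ ω b₁) ω = P₁' at *
  generalize deriv (fun ω => y₂ ω b₂) ω = f₂' at *
  generalize deriv (fun ω => p₂ ω b₂) ω = P₂' at *
  generalize y₁ ω b₁ = f₁ at *
  generalize p₁ ω b₁ = P₁ at *
  generalize y₂ ω b₂ = f₂ at *
  generalize p₂ ω b₂ = P₂ at *
  by_cases hz : f₁ = 0 ∧ f₂ = 0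
  · left
    simp [hz.1, hz.2]
  right
  have e : (M * (ω * f₁) * (ω * f₂) - P₁ * f₂ - P₂ * f₁) * (f₁' * f₂ + f₁ * f₂')
      = -(2 * ω * (I₁ * f₂ ^ 2 + I₂ * f₁ ^ 2)) := by
    linear_combination (M * ω ^ 2 * (f₁' * f₂ + f₁ * f₂') - P₁' * f₂ - P₁ * f₂' - P₂ * f₁' - P₂' * f₁)
      * hg - f₂ ^ 2 * w₁ - f₁ ^ 2 * w₂
  rw [e]
  have : 0 < I₁ * f₂ ^ 2 + I₂ * f₁ ^ 2 := by
    rcases not_and_or.1 hz with h | h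
    · positivity
    · positivity
  have := mul_pos hω this
  linarith

end

section

variable {a₁ b₁ γ₁ B₁ C₁ : ℝ} {ρ₁ σ₁ q₁ : ℝ → ℝ} {y₁ p₁ : ℝ → ℝ → ℝ}
  {a₂ b₂ γ₂ B₂ C₂ : ℝ} {ρ₂ σ₂ q₂ : ℝ → ℝ} {y₂ p₂ : ℝ → ℝ → ℝ} {M : ℝ}

/-- The mass dominates: ωφ_i = B_i sin(γ_iω) + O(1/|ω|), while the terms P_iφ_j are O(1/|ω|). -/
theorem IsTransfer.exists_abs_charFun_sub_le (t₁ : IsTransfer a₁ b₁ ρ₁ σ₁ q₁ γ₁ B₁ C₁ y₁ p₁)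
    (t₂ : IsTransfer a₂ b₂ ρ₂ σ₂ q₂ γ₂ B₂ C₂ y₂ p₂) (hM : 0 < M) (hB₂ : 0 < B₂) (hC₁ : 0 < C₁)
    (hC₂ : 0 < C₂) :
    ∃ C > 0, ∀ ω ≠ 0, |charFun M (fun ω => y₁ ω b₁) (fun ω => p₁ ω b₁) (fun ω => y₂ ω b₂)
      (fun ω => p₂ ω b₂) ω - M * B₁ * B₂ * (Real.sin (ω * γ₁) * Real.sin (ω * γ₂))| ≤ C / |ω| := by
  obtain ⟨D, hD, hDb⟩ := t₁.band_mul_y.exists_abs_le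
  obtain ⟨E₁, hE₁, hb₁⟩ := t₁.band_p.exists_abs_le
  obtain ⟨E₂, hE₂, hb₂⟩ := t₂.band_p.exists_abs_le
  refine ⟨M * (D * C₂) + M * (B₂ * C₁) + E₁ * C₂ + E₂ * C₁, by positivity, fun ω hω => ?_⟩
  have hω' := abs_pos.2 hω
  have e : charFun M (fun ω => y₁ ω b₁) (fun ω => p₁ ω b₁) (fun ω => y₂ ω b₂)
      (fun ω => p₂ ω b₂) ω - M * B₁ * B₂ * (Real.sin (ω * γ₁) * Real.sin (ω * γ₂))
      = M * ((ω * y₁ ω b₁) * (ω * y₂ ω b₂ - B₂ * Real.sin (ω * γ₂)))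
        + M * ((B₂ * Real.sin (ω * γ₂)) * (ω * y₁ ω b₁ - B₁ * Real.sin (ω * γ₁)))
        + -(p₁ ω b₁ * y₂ ω b₂) + -(p₂ ω b₂ * y₁ ω b₁) := by
    rw [charFun]; ring
  have s1 := t₁.abs_right_le ω hω
  have s2 := t₂.abs_right_le ω hω
  have s3 := t₁.asymptotic ω hω
  have s4 := t₂.asymptotic ω hω
  have s5 : |B₂ * Real.sin (ω * γ₂)| ≤ B₂ := by
    rw [abs_mul, abs_of_pos hB₂]
    exact mul_le_of_le_one_right hB₂.le (Real.abs_sin_le_one _)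
  rw [e]
  calc _ ≤ M * (D * (C₂ / |ω|)) + M * (B₂ * (C₁ / |ω|)) + E₁ * (C₂ / |ω|) + E₂ * (C₁ / |ω|) := by
        refine (abs_add_le _ _).trans (add_le_add ((abs_add_le _ _).trans (add_le_add
          ((abs_add_le _ _).trans (add_le_add ?_ ?_)) ?_)) ?_)
        · rw [abs_mul, abs_mul, abs_of_pos hM]
          exact mul_le_mul_of_nonneg_left (mul_le_mul (hDb ω) s4 (abs_nonneg _) hD.le) hM.le
        · rw [abs_mul, abs_mul, abs_of_pos hM]
          exact mul_le_mul_of_nonneg_left (mul_le_mul s5 s3 (abs_nonneg _) hB₂.le) hM.le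
        · rw [abs_neg, abs_mul]
          exact mul_le_mul (hb₁ ω) s2 (abs_nonneg _) hE₁.le
        · rw [abs_neg, abs_mul]
          exact mul_le_mul (hb₂ ω) s1 (abs_nonneg _) hE₂.le
    _ = _ := by ring

theorem IsTransfer.exists_two_zeros (t : IsTransfer a₁ b₁ ρ₁ σ₁ q₁ γ₁ B₁ C₁ y₁ p₁) (hγ : 0 < γ₁)
    (hB : 0 < B₁) (hC : 0 < C₁) : ∃ X₀ > 0, ∀ X ≥ X₀, ∃ z z', X ≤ z ∧ z < z' ∧
      z' ≤ X + 6 * Real.pi / γ₁ ∧ y₁ z b₁ = 0 ∧ y₁ z' b₁ = 0 := by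
  have hπ := Real.pi_pos
  -- Beyond this threshold the error C₁/ω is smaller than the amplitude B₁, so φ has the sign of the
  -- sine where the sine is ±1. Three such points, with signs +, -, +, lie within 9π/(2γ₁) of X.
  refine ⟨C₁ / B₁ + 1, by positivity, fun X hX => ?_⟩
  have hX0 : 0 < X := lt_of_lt_of_le (by positivity) hX
  have cont : Continuous fun ω => y₁ ω b₁ := t.continuous b₁
  have key : ∀ ω ≥ X, |ω * y₁ ω b₁ - B₁ * Real.sin (ω * γ₁)| < B₁ := fun ω hω => by
    have h0 : 0 < ω := hX0.trans_le hω
    refine (t.asymptotic ω h0.ne').trans_lt ?_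
    rw [abs_of_pos h0, div_lt_iff₀ h0, mul_comm, ← div_lt_iff₀ hB]
    linarith
  have pos : ∀ ω ≥ X, Real.sin (ω * γ₁) = 1 → 0 < y₁ ω b₁ := fun ω hω hs => by
    have h1 := (abs_lt.1 (key ω hω)).1
    rw [hs] at h1
    exact (mul_pos_iff_of_pos_left (hX0.trans_le hω)).1 (by linarith)
  have neg : ∀ ω ≥ X, Real.sin (ω * γ₁) = -1 → y₁ ω b₁ < 0 := fun ω hω hs => by
    have h1 := (abs_lt.1 (key ω hω)).2
    rw [hs] at h1
    by_contra hn
    have := mul_nonneg (hX0.trans_le hω).le (not_lt.1 hn)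
    linarith
  set k := ⌈X * γ₁ / (2 * Real.pi)⌉₊ with hk
  have k1 : X * γ₁ / (2 * Real.pi) ≤ k := Nat.le_ceil _
  have k2 : (k : ℝ) < X * γ₁ / (2 * Real.pi) + 1 := Nat.ceil_lt_add_one (by positivity)
  rw [div_le_iff₀ (by positivity)] at k1
  rw [div_add_one (by positivity), lt_div_iff₀ (by positivity)] at k2
  have hw : ∀ j : ℝ, 0 ≤ j → X ≤ (Real.pi / 2 + k * (2 * Real.pi) + j) / γ₁ := fun j hj => by
    rw [le_div_iff₀ hγ]
    linarith
  have s0 : Real.sin ((Real.pi / 2 + k * (2 * Real.pi) + 0) / γ₁ * γ₁) = 1 := by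
    rw [div_mul_cancel₀ _ hγ.ne', add_zero, Real.sin_add_nat_mul_two_pi, Real.sin_pi_div_two]
  have s1 : Real.sin ((Real.pi / 2 + k * (2 * Real.pi) + Real.pi) / γ₁ * γ₁) = -1 := by
    rw [div_mul_cancel₀ _ hγ.ne', Real.sin_add_pi, Real.sin_add_nat_mul_two_pi,
      Real.sin_pi_div_two]
  have s2 : Real.sin ((Real.pi / 2 + k * (2 * Real.pi) + 2 * Real.pi) / γ₁ * γ₁) = 1 := by
    rw [div_mul_cancel₀ _ hγ.ne', Real.sin_add_two_pi, Real.sin_add_nat_mul_two_pi,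
      Real.sin_pi_div_two]
  have p0 := pos _ (hw 0 le_rfl) s0
  have n1 := neg _ (hw Real.pi hπ.le) s1
  have p2 := pos _ (hw (2 * Real.pi) (by positivity)) s2
  have l1 : (Real.pi / 2 + k * (2 * Real.pi) + 0) / γ₁
      ≤ (Real.pi / 2 + k * (2 * Real.pi) + Real.pi) / γ₁ := by
    gcongr
  have l2 : (Real.pi / 2 + k * (2 * Real.pi) + Real.pi) / γ₁
      ≤ (Real.pi / 2 + k * (2 * Real.pi) + 2 * Real.pi) / γ₁ := by
    gcongr
    linarith
  have l3 : (Real.pi / 2 + k * (2 * Real.pi) + 2 * Real.pi) / γ₁ ≤ X + 6 * Real.pi / γ₁ := by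
    rw [div_le_iff₀ hγ, add_mul, div_mul_cancel₀ _ hγ.ne']
    linarith
  obtain ⟨z, hz, hz0⟩ := intermediate_value_Icc' l1 cont.continuousOn ⟨n1.le, p0.le⟩
  obtain ⟨z', hz', hz0'⟩ := intermediate_value_Icc l2 cont.continuousOn ⟨n1.le, p2.le⟩
  refine ⟨z, z', (hw 0 le_rfl).trans hz.1, ?_, hz'.2.trans l3, hz0, hz0'⟩
  refine lt_of_le_of_ne (hz.2.trans hz'.1) fun he => ?_
  have : z = (Real.pi / 2 + k * (2 * Real.pi) + Real.pi) / γ₁ :=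
    le_antisymm hz.2 (he ▸ hz'.1)
  rw [this] at hz0
  exact n1.ne hz0

theorem IsTransfer.exists_zero_charFun (t₁ : IsTransfer a₁ b₁ ρ₁ σ₁ q₁ γ₁ B₁ C₁ y₁ p₁)
    (t₂ : IsTransfer a₂ b₂ ρ₂ σ₂ q₂ γ₂ B₂ C₂ y₂ p₂) (h₁ : IsStringCoeff a₁ b₁ ρ₁ σ₁ q₁)
    (h₂ : IsStringCoeff a₂ b₂ ρ₂ σ₂ q₂) (hab₁ : a₁ < b₁) (hab₂ : a₂ < b₂)
    (hγ : 0 < γ₁) (hB : 0 < B₁) (hC : 0 < C₁) :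
    ∃ L > 0, ∃ X₀ > 0, ∀ X ≥ X₀, ∃ z ∈ Icc X (X + L), charFun M (fun ω => y₁ ω b₁)
      (fun ω => p₁ ω b₁) (fun ω => y₂ ω b₂) (fun ω => p₂ ω b₂) z = 0 := by
  obtain ⟨X₀, hX₀, h⟩ := t₁.exists_two_zeros hγ hB hC
  have hπ := Real.pi_pos
  refine ⟨6 * Real.pi / γ₁, by positivity, X₀, hX₀, fun X hX => ?_⟩
  obtain ⟨z, z', hz, hzz, hz', h0, h0'⟩ := h X hX
  obtain ⟨w, hw, hw0⟩ := exists_zero_of_deriv_mul_neg (g := fun ω => y₁ ω b₁ * y₂ ω b₂)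
    (t₁.isBand_charFun t₂ (M := M)).differentiable_ofReal.continuous
    (t₁.band_y.differentiable_ofReal.mul t₂.band_y.differentiable_ofReal) hzz (by simp [h0])
    (by simp [h0']) fun w hw hg => t₁.charFun_mul_deriv t₂ h₁ h₂ hab₁ hab₂
      (hX₀.trans_le (hX.trans (hz.trans hw.1))) hg
  exact ⟨w, ⟨hz.trans hw.1, hw.2.trans hz'⟩, hw0⟩

end

/-! ### Positivity of the spectrum and the characteristic equation -/

theorem IsSLSolution.exists_sq_le {a b : ℝ} {ρ σ q : ℝ → ℝ}
    (h : IsStringCoeff a b ρ σ q) (hab : a < b) :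
    ∃ c > 0, ∀ {l : ℝ} {y p : ℝ → ℝ}, IsSLSolution a b ρ σ q l y p → y a = 0 →
      (∀ x ∈ Icc a b, y x ^ 2 ≤ c * ∫ x in a..b, p x ^ 2 / σ x) ∧
      ∫ x in a..b, ρ x * y x ^ 2 ≤ c * ∫ x in a..b, p x ^ 2 / σ x := by
  have cs := h.continuousOn_sigma
  have cr := h.continuousOn_rho
  have hs : ∀ x ∈ Icc a b, 0 < σ x := fun x hx => h.sigma_pos' hx
  have hbm : b ∈ Icc a b := right_mem_Icc.2 hab.le
  have csi : ContinuousOn (fun x => 1 / σ x) (Icc a b) :=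
    continuousOn_const.div cs fun x hx => (hs x hx).ne'
  set S := ∫ x in a..b, 1 / σ x with hS
  have hSi : IntervalIntegrable (fun x => 1 / σ x) volume a b := csi.intervalIntegrable_of_Icc hab.le
  have hS0 : 0 < S := intervalIntegral.intervalIntegral_pos_of_pos_on hSi
    (fun x hx => one_div_pos.2 (hs x (Ioo_subset_Icc_self hx))) hab
  set R := ∫ x in a..b, ρ x with hR
  have hRi : IntervalIntegrable ρ volume a b := cr.intervalIntegrable_of_Icc hab.le
  have hR0 : 0 < R := intervalIntegral.intervalIntegral_pos_of_pos_on hRi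
    (fun x hx => h.rho_pos' (Ioo_subset_Icc_self hx)) hab
  refine ⟨S + R * S, by positivity, fun {l y p} s hy => ?_⟩
  have pr := s.isPrimitive h hab
  have cp := (s.isPrimitive_mom h hab).continuousOn
  have cy := pr.continuousOn
  set D := ∫ x in a..b, p x ^ 2 / σ x with hD
  have hDi : IntervalIntegrable (fun x => p x ^ 2 / σ x) volume a b :=
    ((cp.pow 2).div cs fun x hx => (hs x hx).ne').intervalIntegrable_of_Icc hab.le
  have hD0 : 0 ≤ D := intervalIntegral.integral_nonneg hab.le fun x hx =>
    div_nonneg (sq_nonneg _) (hs x hx).le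
  have key : ∀ x ∈ Icc a b, y x ^ 2 ≤ S * D := fun x hx => by
    have i1 := IntervalIntegrable.mono_left_endpoint hDi hx
    have i2 := IntervalIntegrable.mono_left_endpoint pr.1 hx
    have i3 := IntervalIntegrable.mono_left_endpoint hSi hx
    have hmono : ∀ {f : ℝ → ℝ}, IntervalIntegrable f volume a b → (∀ x ∈ Icc a b, 0 ≤ f x) →
        ∫ t in a..x, f t ≤ ∫ t in a..b, f t := fun hf h0 =>
      intervalIntegral.integral_mono_interval le_rfl hx.1 hx.2
        ((ae_restrict_iff' measurableSet_Ioc).2 (Eventually.of_forall fun t ht =>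
          h0 t (Ioc_subset_Icc_self ht))) hf
    have m1 : ∫ t in a..x, p t ^ 2 / σ t ≤ D := hmono hDi fun t ht =>
      div_nonneg (sq_nonneg _) (hs t ht).le
    have m2 : ∫ t in a..x, 1 / σ t ≤ S := hmono hSi fun t ht => (one_div_pos.2 (hs t ht)).le
    have e : y x = ∫ t in a..x, p t / σ t := by rw [pr.2 x hx, hy, zero_add]
    -- A completed square in place of Cauchy–Schwarz, giving y(x)² ≤ SD from y(a) = 0.
    have nn : 0 ≤ ∫ t in a..x, (p t - y x / S) ^ 2 / σ t :=
      intervalIntegral.integral_nonneg hx.1 fun t ht =>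
        div_nonneg (sq_nonneg _) (hs t ⟨ht.1, ht.2.trans hx.2⟩).le
    have e2 : ∫ t in a..x, (p t - y x / S) ^ 2 / σ t
        = (∫ t in a..x, p t ^ 2 / σ t) - 2 * (y x / S) * (∫ t in a..x, p t / σ t)
          + (y x / S) ^ 2 * ∫ t in a..x, 1 / σ t := by
      rw [← intervalIntegral.integral_const_mul, ← intervalIntegral.integral_const_mul,
        ← intervalIntegral.integral_sub i1 (i2.const_mul _),
        ← intervalIntegral.integral_add (i1.sub (i2.const_mul _)) (i3.const_mul _)]
      congr 1
      ext t
      ring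
    rw [e2, ← e] at nn
    have m3 := mul_le_mul_of_nonneg_left m2 (sq_nonneg (y x / S))
    have m4 : 0 ≤ D - 2 * (y x / S) * y x + (y x / S) ^ 2 * S := by linarith
    have e3 : D - 2 * (y x / S) * y x + (y x / S) ^ 2 * S = (S * D - y x ^ 2) / S := by
      field_simp
      ring
    rw [e3] at m4
    rw [le_div_iff₀ hS0, zero_mul] at m4
    linarith
  have hRSD : 0 ≤ R * S * D := by positivity
  have hSD : 0 ≤ S * D := by positivity
  refine ⟨fun x hx => (key x hx).trans (by linarith), ?_⟩
  calc ∫ x in a..b, ρ x * y x ^ 2 ≤ ∫ x in a..b, ρ x * (S * D) := by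
        refine intervalIntegral.integral_mono_on hab.le
          ((cr.mul (cy.pow 2)).intervalIntegrable_of_Icc hab.le) (hRi.mul_const _) fun x hx => ?_
        exact mul_le_mul_of_nonneg_left (key x hx) (h.rho_pos' hx).le
    _ = R * (S * D) := by rw [intervalIntegral.integral_mul_const]
    _ ≤ _ := by linarith

section

variable {ρ₁ σ₁ q₁ ρ₂ σ₂ q₂ : ℝ → ℝ} {M : ℝ}

theorem IsStringCoeff.reflect_unit (h₂ : IsStringCoeff 0 1 ρ₂ σ₂ q₂) :
    IsStringCoeff (-1) 0 (fun x => ρ₂ (-x)) (fun x => σ₂ (-x)) fun x => q₂ (-x) := by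
  simpa using h₂.reflect zero_le_one

theorem IsSLSolution.reflect_unit {l : ℝ} {y p : ℝ → ℝ} (h₂ : IsStringCoeff 0 1 ρ₂ σ₂ q₂)
    (s : IsSLSolution 0 1 ρ₂ σ₂ q₂ l y p) :
    IsSLSolution (-1) 0 (fun x => ρ₂ (-x)) (fun x => σ₂ (-x)) (fun x => q₂ (-x)) l
      (fun x => y (-x)) fun x => -p (-x) := by
  simpa using s.reflect h₂ zero_lt_one

theorem IsSLSolution.of_reflect_unit {l : ℝ} {y p : ℝ → ℝ} (h₂ : IsStringCoeff 0 1 ρ₂ σ₂ q₂)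
    (s : IsSLSolution (-1) 0 (fun x => ρ₂ (-x)) (fun x => σ₂ (-x)) (fun x => q₂ (-x)) l y p) :
    IsSLSolution 0 1 ρ₂ σ₂ q₂ l (fun x => y (-x)) fun x => -p (-x) := by
  simpa using s.reflect h₂.reflect_unit (by norm_num)

/-- The eigenvalue problem with the second string reflected. -/
theorem isEigenvalue_iff (h₂ : IsStringCoeff 0 1 ρ₂ σ₂ q₂) {l : ℝ} :
    IsEigenvalue ρ₁ σ₁ q₁ ρ₂ σ₂ q₂ M l ↔ ∃ u p v r : ℝ → ℝ,
      IsSLSolution (-1) 0 ρ₁ σ₁ q₁ l u p ∧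
      IsSLSolution (-1) 0 (fun x => ρ₂ (-x)) (fun x => σ₂ (-x)) (fun x => q₂ (-x)) l v r ∧
      u (-1) = 0 ∧ v (-1) = 0 ∧ u 0 = v 0 ∧ p 0 + r 0 = l * M * u 0 ∧
      ((∃ x ∈ Icc (-1 : ℝ) 0, u x ≠ 0) ∨ ∃ x ∈ Icc (-1 : ℝ) 0, v x ≠ 0) := by
  constructor
  · rintro ⟨u, p, v, r, s1, s2, hu, hv, huv, hp, hne⟩
    refine ⟨u, p, fun x => v (-x), fun x => -r (-x), s1, s2.reflect_unit h₂, hu, by simpa using hv,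
      by simpa using huv, by simpa [← sub_eq_add_neg] using hp, hne.imp_right ?_⟩
    rintro ⟨x, hx, hvx⟩
    exact ⟨-x, ⟨by linarith [hx.2], by linarith [hx.1]⟩, by simpa using hvx⟩
  · rintro ⟨u, p, v, r, s1, s2, hu, hv, huv, hp, hne⟩
    refine ⟨u, p, fun x => v (-x), fun x => -r (-x), s1, s2.of_reflect_unit h₂, hu, by simpa using hv,
      by simpa using huv, by simpa using hp, hne.imp_right ?_⟩
    rintro ⟨x, hx, hvx⟩
    exact ⟨-x, ⟨by linarith [hx.2], by linarith [hx.1]⟩, by simpa using hvx⟩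

/-- Rayleigh quotient: adding the energy identities gives λ(Mu(0)² + ∫ρ₁u² + ∫ρ₂v²) = potential
energy + elastic energy, and the elastic energy controls the bracket by Poincaré's inequality. -/
theorem exists_le_of_isEigenvalue (h₁ : IsStringCoeff (-1) 0 ρ₁ σ₁ q₁)
    (h₂ : IsStringCoeff 0 1 ρ₂ σ₂ q₂) (hM : 0 < M) :
    ∃ l₀ > 0, ∀ l, IsEigenvalue ρ₁ σ₁ q₁ ρ₂ σ₂ q₂ M l → l₀ ≤ l := by
  have hab : (-1 : ℝ) < 0 := by norm_num
  have h₂' := h₂.reflect_unit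
  obtain ⟨c₁, hc₁, b₁⟩ := IsSLSolution.exists_sq_le h₁ hab
  obtain ⟨c₂, hc₂, b₂⟩ := IsSLSolution.exists_sq_le h₂' hab
  refine ⟨1 / (M * c₁ + c₁ + c₂), by positivity, fun l hl => ?_⟩
  obtain ⟨u, p, v, r, s1, s2, hu, hv, huv, hp, hne⟩ := (isEigenvalue_iff h₂).1 hl
  obtain ⟨bu, bu'⟩ := b₁ s1 hu
  obtain ⟨bv, bv'⟩ := b₂ s2 hv
  have e1 := s1.energy h₁ hab
  have e2 := s2.energy h₂' hab
  have nn : ∀ {f y : ℝ → ℝ}, (∀ᵐ x ∂(volume.restrict (Ioc (-1 : ℝ) 0)), 0 ≤ f x) →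
      0 ≤ ∫ x in (-1 : ℝ)..0, f x * y x ^ 2 := fun hf => by
    rw [intervalIntegral.integral_of_le hab.le]
    exact integral_nonneg_of_ae (hf.mono fun x hx => mul_nonneg hx (sq_nonneg _))
  have n1 := nn (y := u) h₁.q_nonneg
  have n2 := nn (y := v) h₂'.q_nonneg
  have n5 : 0 ≤ ∫ x in (-1 : ℝ)..0, ρ₁ x * u x ^ 2 :=
    intervalIntegral.integral_nonneg hab.le fun x hx => mul_nonneg (h₁.rho_pos' hx).le (sq_nonneg _)
  have n6 : 0 ≤ ∫ x in (-1 : ℝ)..0, ρ₂ (-x) * v x ^ 2 :=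
    intervalIntegral.integral_nonneg hab.le fun x hx => mul_nonneg (h₂'.rho_pos' hx).le (sq_nonneg _)
  have n3 : 0 ≤ ∫ x in (-1 : ℝ)..0, p x ^ 2 / σ₁ x :=
    intervalIntegral.integral_nonneg hab.le fun x hx => div_nonneg (sq_nonneg _) (h₁.sigma_pos' hx).le
  have n4 : 0 ≤ ∫ x in (-1 : ℝ)..0, r x ^ 2 / σ₂ (-x) :=
    intervalIntegral.integral_nonneg hab.le fun x hx =>
      div_nonneg (sq_nonneg _) (h₂'.sigma_pos' hx).le
  have b0 := bu 0 (right_mem_Icc.2 hab.le)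
  have hD : 0 < (∫ x in (-1 : ℝ)..0, p x ^ 2 / σ₁ x) + ∫ x in (-1 : ℝ)..0, r x ^ 2 / σ₂ (-x) := by
    rcases hne with ⟨x, hx, hux⟩ | ⟨x, hx, hvx⟩
    · refine lt_of_lt_of_le ?_ (le_add_of_nonneg_right n4)
      refine (mul_pos_iff_of_pos_left hc₁).1 (lt_of_lt_of_le ?_ (bu x hx))
      positivity
    · refine lt_of_lt_of_le ?_ (le_add_of_nonneg_left n3)
      refine (mul_pos_iff_of_pos_left hc₂).1 (lt_of_lt_of_le ?_ (bv x hx))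
      positivity
  rw [hu, mul_zero, sub_zero] at e1
  rw [hv, mul_zero, sub_zero, ← huv] at e2
  generalize (∫ x in (-1 : ℝ)..0, p x ^ 2 / σ₁ x) = D₁ at *
  generalize (∫ x in (-1 : ℝ)..0, r x ^ 2 / σ₂ (-x)) = D₂ at *
  generalize (∫ x in (-1 : ℝ)..0, q₁ x * u x ^ 2) = Q₁ at *
  generalize (∫ x in (-1 : ℝ)..0, q₂ (-x) * v x ^ 2) = Q₂ at *
  generalize (∫ x in (-1 : ℝ)..0, ρ₁ x * u x ^ 2) = J₁ at *
  generalize (∫ x in (-1 : ℝ)..0, ρ₂ (-x) * v x ^ 2) = J₂ at *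
  have key : l * (M * u 0 ^ 2 + J₁ + J₂) = Q₁ + Q₂ + (D₁ + D₂) := by
    linear_combination e1 + e2 - u 0 * hp
  have hN : 0 ≤ M * u 0 ^ 2 + J₁ + J₂ := by positivity
  have hN' : M * u 0 ^ 2 + J₁ + J₂ ≤ (M * c₁ + c₁ + c₂) * (D₁ + D₂) := by
    have := mul_le_mul_of_nonneg_left b0 hM.le
    have : 0 ≤ M * (c₁ * D₂) := by positivity
    have : 0 ≤ c₁ * D₂ := by positivity
    have : 0 ≤ c₂ * D₁ := by positivity
    linarith
  have hl0 : 0 < l := by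
    by_contra hn
    have := mul_nonpos_of_nonpos_of_nonneg (not_lt.1 hn) hN
    linarith
  rw [div_le_iff₀ (by positivity)]
  have h3 := mul_le_mul_of_nonneg_left hN' hl0.le
  have h4 : 1 * (D₁ + D₂) ≤ l * (M * c₁ + c₁ + c₂) * (D₁ + D₂) := by
    linarith
  exact le_of_mul_le_mul_right h4 hD

/-- An eigenfunction is kφ₁, k'φ₂ on the two strings, and the junction conditions form a linear
system in (k, k') with determinant `charFun` up to sign. A null vector is (φ₂, φ₁), or (P₂, -P₁)
when both φ vanish at 0. -/
theorem isEigenvalue_sq_iff (h₁ : IsStringCoeff (-1) 0 ρ₁ σ₁ q₁) (h₂ : IsStringCoeff 0 1 ρ₂ σ₂ q₂)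
    {γ₁ B₁ C₁ γ₂ B₂ C₂ : ℝ} {y₁ p₁ y₂ p₂ : ℝ → ℝ → ℝ}
    (t₁ : IsTransfer (-1) 0 ρ₁ σ₁ q₁ γ₁ B₁ C₁ y₁ p₁)
    (t₂ : IsTransfer (-1) 0 (fun x => ρ₂ (-x)) (fun x => σ₂ (-x)) (fun x => q₂ (-x)) γ₂ B₂ C₂ y₂ p₂)
    {ω : ℝ} (hω : ω ≠ 0) :
    IsEigenvalue ρ₁ σ₁ q₁ ρ₂ σ₂ q₂ M (ω ^ 2) ↔ charFun M (fun ω => y₁ ω 0) (fun ω => p₁ ω 0)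
      (fun ω => y₂ ω 0) (fun ω => p₂ ω 0) ω = 0 := by
  have hab : (-1 : ℝ) < 0 := by norm_num
  have h₂' := h₂.reflect_unit
  have h0 : (0 : ℝ) ∈ Icc (-1 : ℝ) 0 := right_mem_Icc.2 hab.le
  rw [isEigenvalue_iff h₂]
  constructor
  · rintro ⟨u, p, v, r, s1, s2, hu, hv, huv, hp, hne⟩
    obtain ⟨k, hk⟩ := t₁.exists_eq_mul h₁ hab hω s1 hu
    obtain ⟨k', hk'⟩ := t₂.exists_eq_mul h₂' hab hω s2 hv
    rw [(hk 0 h0).1, (hk' 0 h0).1] at huv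
    rw [(hk 0 h0).1, (hk 0 h0).2, (hk' 0 h0).2] at hp
    rw [charFun]
    rcases hne with ⟨x, hx, hux⟩ | ⟨x, hx, hvx⟩
    · have : k ≠ 0 := fun hk0 => hux (by simp [(hk x hx).1, hk0])
      refine (mul_eq_zero.1 ?_).resolve_left this
      linear_combination (-y₂ ω 0) * hp - p₂ ω 0 * huv
    · have : k' ≠ 0 := fun hk0 => hvx (by simp [(hk' x hx).1, hk0])
      refine (mul_eq_zero.1 ?_).resolve_left this
      linear_combination (-y₁ ω 0) * hp + (p₁ ω 0 - M * ω ^ 2 * y₁ ω 0) * huv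
  · intro hF
    rw [charFun] at hF
    have n1 := t₁.right_ne_zero h₁ hab hω
    have n2 := t₂.right_ne_zero h₂' hab hω
    have mk : ∀ k k' : ℝ, k * y₁ ω 0 = k' * y₂ ω 0 →
        k * p₁ ω 0 + k' * p₂ ω 0 = ω ^ 2 * M * (k * y₁ ω 0) → (k ≠ 0 ∨ k' ≠ 0) →
        ∃ u p v r : ℝ → ℝ,
      IsSLSolution (-1) 0 ρ₁ σ₁ q₁ (ω ^ 2) u p ∧
      IsSLSolution (-1) 0 (fun x => ρ₂ (-x)) (fun x => σ₂ (-x)) (fun x => q₂ (-x)) (ω ^ 2) v r ∧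
      u (-1) = 0 ∧ v (-1) = 0 ∧ u 0 = v 0 ∧ p 0 + r 0 = (ω ^ 2) * M * u 0 ∧
      ((∃ x ∈ Icc (-1 : ℝ) 0, u x ≠ 0) ∨ ∃ x ∈ Icc (-1 : ℝ) 0, v x ≠ 0) := by
      intro k k' e1 e2 hk
      refine ⟨fun x => k * y₁ ω x, fun x => k * p₁ ω x, fun x => k' * y₂ ω x,
        fun x => k' * p₂ ω x, (t₁.sol ω hω).const_mul h₁ hab k, (t₂.sol ω hω).const_mul h₂' hab k',
        by simp [t₁.y_left ω hω], by simp [t₂.y_left ω hω], e1, e2, ?_⟩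
      refine hk.imp (fun hk => ?_) fun hk => ?_
      · obtain ⟨x, hx, hy⟩ := t₁.exists_ne_zero h₁ hab hω
        exact ⟨x, hx, mul_ne_zero hk hy⟩
      · obtain ⟨x, hx, hy⟩ := t₂.exists_ne_zero h₂' hab hω
        exact ⟨x, hx, mul_ne_zero hk hy⟩
    by_cases hz : y₁ ω 0 = 0 ∧ y₂ ω 0 = 0
    · refine mk (p₂ ω 0) (-p₁ ω 0) (by simp [hz.1, hz.2]) ?_ (Or.inl (n2 hz.2))
      rw [hz.1]
      ring
    · refine mk (y₂ ω 0) (y₁ ω 0) (mul_comm _ _) ?_ ?_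
      · linear_combination -hF
      · rcases not_and_or.1 hz with h | h
        · exact Or.inr h
        · exact Or.inl h

end

/-! ### Asymptotic nondegeneracy of the characteristic function -/

/-- The properties of the characteristic function `F` on which the analysis of the spectrum rests. -/
structure IsCharacteristic (γ₁ γ₂ ω₀ K C L X₀ : ℝ) (F : ℝ → ℝ) : Prop where
  pos₁ : 0 < γ₁
  pos₂ : 0 < γ₂
  lower_pos : 0 < ω₀
  amplitude_pos : 0 < K
  threshold_pos : 0 < X₀
  band : IsBand (-(γ₁ + γ₂)) (γ₁ + γ₂) fun ω => (F ω : ℂ)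
  even : ∀ ω, F (-ω) = F ω
  le_of_zero : ∀ ω > 0, F ω = 0 → ω₀ ≤ ω
  deriv_ne_zero : ∀ ω ≠ 0, F ω = 0 → deriv F ω ≠ 0
  asymptotic : ∀ ω ≠ 0, |F ω - K * (Real.sin (ω * γ₁) * Real.sin (ω * γ₂))| ≤ C / |ω|
  exists_zero : ∀ X ≥ X₀, ∃ z ∈ Icc X (X + L), F z = 0

theorem exists_isCharacteristic {ρ₁ σ₁ q₁ ρ₂ σ₂ q₂ : ℝ → ℝ} {M : ℝ}
    (h₁ : IsStringCoeff (-1) 0 ρ₁ σ₁ q₁) (h₂ : IsStringCoeff 0 1 ρ₂ σ₂ q₂) (hM : 0 < M) :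
    ∃ (ω₀ K C L X₀ : ℝ) (F : ℝ → ℝ),
      IsCharacteristic (travelTime (-1) 0 ρ₁ σ₁) (travelTime 0 1 ρ₂ σ₂) ω₀ K C L X₀ F ∧
      ∀ l, IsEigenvalue ρ₁ σ₁ q₁ ρ₂ σ₂ q₂ M l ↔ ∃ ω > 0, F ω = 0 ∧ l = ω ^ 2 := by
  have hab : (-1 : ℝ) < 0 := by norm_num
  have h₂' := h₂.reflect_unit
  obtain ⟨B₁, C₁, y₁, p₁, hB₁, hC₁, t₁⟩ := h₁.exists_isTransfer hab
  obtain ⟨B₂, C₂, y₂, p₂, hB₂, hC₂, t₂⟩ := h₂'.exists_isTransfer hab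
  have hT : travelTime (-1) 0 (fun x => ρ₂ (-x)) (fun x => σ₂ (-x)) = travelTime 0 1 ρ₂ σ₂ := by
    simpa using travelTime_reflect 0 1 ρ₂ σ₂
  obtain ⟨l₀, hl₀, hl⟩ := exists_le_of_isEigenvalue h₁ h₂ hM
  have hγ₁ := h₁.travelTime_pos hab
  obtain ⟨C, -, hasy⟩ := t₁.exists_abs_charFun_sub_le t₂ hM hB₂ hC₁ hC₂
  obtain ⟨L, -, X₀, hX₀, hz⟩ := t₁.exists_zero_charFun t₂ h₁ h₂' hab hab (M := M) hγ₁ hB₁ hC₁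
  have iff := fun {ω : ℝ} (hω : ω ≠ 0) => isEigenvalue_sq_iff (M := M) h₁ h₂ t₁ t₂ hω
  refine ⟨√l₀, M * B₁ * B₂, C, L, X₀, charFun M (fun ω => y₁ ω 0) (fun ω => p₁ ω 0)
      (fun ω => y₂ ω 0) (fun ω => p₂ ω 0), ⟨hγ₁, h₂.travelTime_pos zero_lt_one, Real.sqrt_pos.2 hl₀,
      by positivity, hX₀, ?_, fun ω => ?_, fun ω hω hF => ?_,
      fun ω hω hF => t₁.deriv_charFun_ne_zero t₂ h₁ h₂' hab hab hM hω hF, ?_, hz⟩, fun l =>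
      ⟨fun h => ?_, ?_⟩⟩
  · rw [← hT]
    exact t₁.isBand_charFun t₂
  · simp only [charFun, t₁.y_neg, t₁.p_neg, t₂.y_neg, t₂.p_neg]
    ring
  · exact Real.sqrt_le_iff.2 ⟨hω.le, hl _ ((iff hω.ne').2 hF)⟩
  · rw [← hT]
    exact hasy
  · have h0 := hl₀.trans_le (hl l h)
    have h1 := Real.sqrt_pos.2 h0
    have h2 := Real.sq_sqrt h0.le
    exact ⟨√l, h1, (iff h1.ne').1 (by rwa [h2]), h2.symm⟩
  · rintro ⟨ω, hω, hF, rfl⟩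
    exact (iff hω.ne').2 hF

/-- If `f → 0` and `f''` is bounded then `f' → 0`. -/
theorem tendsto_deriv_zero {f f' f'' : ℝ → ℝ} (h1 : ∀ t, HasDerivAt f (f' t) t)
    (h2 : ∀ t, HasDerivAt f' (f'' t) t) {C : ℝ} (hC : ∀ t, |f'' t| ≤ C)
    (hf : Tendsto f atTop (𝓝 0)) : Tendsto f' atTop (𝓝 0) := by
  have hC0 : 0 ≤ C := (abs_nonneg _).trans (hC 0)
  rw [Metric.tendsto_atTop]
  intro ε hε
  -- A mean slope over length η is at most 2η²/η, and f' varies by at most Cη there; together they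
  -- give ε/2.
  set η := ε / (2 * (2 + C)) with hη
  have hη0 : 0 < η := by positivity
  obtain ⟨X, hX⟩ := Metric.tendsto_atTop.1 hf (η ^ 2) (by positivity)
  refine ⟨X, fun t ht => ?_⟩
  have a1 := hX t ht
  have a2 := hX (t + η) (by linarith)
  rw [Real.dist_eq, sub_zero] at a1 a2 ⊢
  obtain ⟨ξ, hξ, hs⟩ := exists_hasDerivAt_eq_slope f f' (show t < t + η by linarith)
    (fun x _ => (h1 x).continuousAt.continuousWithinAt) fun x _ => h1 x
  obtain ⟨ζ, hζ, hs'⟩ := exists_hasDerivAt_eq_slope f' f'' hξ.1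
    (fun x _ => (h2 x).continuousAt.continuousWithinAt) fun x _ => h2 x
  rw [add_sub_cancel_left, eq_div_iff hη0.ne'] at hs
  rw [eq_div_iff (by linarith [hξ.1])] at hs'
  have b1 : |f' ξ| * η ≤ 2 * η * η := by
    rw [← abs_of_pos hη0, ← abs_mul, abs_of_pos hη0, hs]
    have := abs_sub (f (t + η)) (f t)
    nlinarith
  have b2 : |f' ξ| ≤ 2 * η := le_of_mul_le_mul_right b1 hη0
  have b3 : |f' ξ - f' t| ≤ C * η := by
    rw [← hs', abs_mul, abs_of_pos (show 0 < ξ - t by linarith [hξ.1])]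
    exact mul_le_mul (hC ζ) (by linarith [hξ.2]) (by linarith [hξ.1]) hC0
  have b4 : |f' t| ≤ 2 * η + C * η := by
    have : f' t = f' ξ - (f' ξ - f' t) := by ring
    rw [this]
    exact (abs_sub _ _).trans (add_le_add b2 b3)
  have b5 : 2 * η + C * η = ε / 2 := by
    rw [hη]; field_simp
  linarith

theorem IsBand.tendsto_deriv_zero {lo hi : ℝ} {f : ℝ → ℝ} (h : IsBand lo hi fun ω => (f ω : ℂ))
    (hf : Tendsto f atTop (𝓝 0)) : Tendsto (_root_.deriv f) atTop (𝓝 0) := by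
  obtain ⟨C, -, hC⟩ := h.deriv_ofReal.deriv_ofReal.exists_abs_le
  exact StringMass.tendsto_deriv_zero (fun t => (h.differentiable_ofReal t).hasDerivAt)
    (fun t => (h.deriv_ofReal.differentiable_ofReal t).hasDerivAt) hC hf

/-- If sin α sin β and cos α cos β both vanish, then one of sin α cos β and cos α sin β is ±1 and
the other is 0, so the middle term does not vanish. The squares of the four products sum to 1, which
makes this quantitative; N collects the constants. -/
theorem exists_le_sin_cos {γ₁ γ₂ : ℝ} (h₁ : 0 < γ₁) (h₂ : 0 < γ₂) :
    ∃ s > 0, ∀ α β : ℝ, s ≤ |Real.sin α * Real.sin β|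
      + |γ₁ * Real.cos α * Real.sin β + γ₂ * Real.sin α * Real.cos β|
      + |Real.cos α * Real.cos β| := by
  set m := min γ₁ γ₂ with hm
  have hm0 : 0 < m := lt_min h₁ h₂
  set N := 1 + 2 * γ₁ * γ₂ + 2 * m ^ 2 with hN
  have hN0 : 0 < N := by positivity
  refine ⟨min 1 (m ^ 2 / N), lt_min one_pos (by positivity), fun α β => ?_⟩
  have e1 := Real.sin_sq_add_cos_sq α
  have e2 := Real.sin_sq_add_cos_sq β
  set a := Real.sin α
  set b := Real.cos α
  set c := Real.sin β
  set d := Real.cos β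
  set e := |a * c| + |γ₁ * b * c + γ₂ * a * d| + |b * d| with he
  have hA : |a * c| ≤ e := by
    have := abs_nonneg (γ₁ * b * c + γ₂ * a * d)
    have := abs_nonneg (b * d)
    linarith
  have hB : |γ₁ * b * c + γ₂ * a * d| ≤ e := by
    have := abs_nonneg (a * c)
    have := abs_nonneg (b * d)
    linarith
  have hC : |b * d| ≤ e := by
    have := abs_nonneg (γ₁ * b * c + γ₂ * a * d)
    have := abs_nonneg (a * c)
    linarith
  have he0 : 0 ≤ e := (abs_nonneg _).trans hA
  by_cases h1 : 1 ≤ e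
  · exact (min_le_left _ _).trans h1
  refine (min_le_right _ _).trans ?_
  rw [div_le_iff₀ hN0]
  have m1 : m ^ 2 ≤ γ₁ ^ 2 := pow_le_pow_left₀ hm0.le (min_le_left _ _) 2
  have m2 : m ^ 2 ≤ γ₂ ^ 2 := pow_le_pow_left₀ hm0.le (min_le_right _ _) 2
  have hA2 : (a * c) ^ 2 ≤ e ^ 2 := sq_le_sq' (abs_le.1 hA).1 (abs_le.1 hA).2
  have hB2 : (γ₁ * b * c + γ₂ * a * d) ^ 2 ≤ e ^ 2 := sq_le_sq' (abs_le.1 hB).1 (abs_le.1 hB).2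
  have hC2 : (b * d) ^ 2 ≤ e ^ 2 := sq_le_sq' (abs_le.1 hC).1 (abs_le.1 hC).2
  have hAC : |(a * c) * (b * d)| ≤ e * e := by
    rw [abs_mul]
    exact mul_le_mul hA hC (abs_nonneg _) he0
  have hAC' := (abs_le.1 hAC).1
  have k1 : m ^ 2 * (b * c) ^ 2 ≤ γ₁ ^ 2 * (b * c) ^ 2 :=
    mul_le_mul_of_nonneg_right m1 (sq_nonneg _)
  have k2 : m ^ 2 * (a * d) ^ 2 ≤ γ₂ ^ 2 * (a * d) ^ 2 :=
    mul_le_mul_of_nonneg_right m2 (sq_nonneg _)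
  have k3 : (γ₁ * b * c + γ₂ * a * d) ^ 2 = γ₁ ^ 2 * (b * c) ^ 2 + γ₂ ^ 2 * (a * d) ^ 2
    + 2 * γ₁ * γ₂ * ((a * c) * (b * d)) := by ring
  have k4 : m ^ 2 = m ^ 2 * ((a * c) ^ 2 + (b * d) ^ 2) + m ^ 2 * (b * c) ^ 2
      + m ^ 2 * (a * d) ^ 2 := by
    linear_combination (-m ^ 2 * (c ^ 2 + d ^ 2)) * e1 - m ^ 2 * e2
  have k5 : m ^ 2 * ((a * c) ^ 2 + (b * d) ^ 2) ≤ m ^ 2 * (e ^ 2 + e ^ 2) :=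
    mul_le_mul_of_nonneg_left (add_le_add hA2 hC2) (sq_nonneg _)
  have k6 : 2 * γ₁ * γ₂ * -(e * e) ≤ 2 * γ₁ * γ₂ * ((a * c) * (b * d)) :=
    mul_le_mul_of_nonneg_left hAC' (by positivity)
  have k7 : m ^ 2 ≤ N * e ^ 2 := by
    rw [hN]
    linarith
  have k8 : e ^ 2 ≤ e := by
    rw [sq]
    exact mul_le_of_le_one_left he0 (not_le.1 h1).le
  have k9 := mul_le_mul_of_nonneg_left k8 hN0.le
  linarith

namespace IsCharacteristic

variable {γ₁ γ₂ ω₀ K C L X₀ : ℝ} {F : ℝ → ℝ}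

theorem deriv_neg (h : IsCharacteristic γ₁ γ₂ ω₀ K C L X₀ F) (ω : ℝ) :
    deriv F (-ω) = -deriv F ω := by
  have h1 : (fun x => F (-x)) = F := funext h.even
  have h2 := deriv_comp_neg F ω
  rw [h1] at h2
  linarith

theorem deriv_deriv_neg (h : IsCharacteristic γ₁ γ₂ ω₀ K C L X₀ F) (ω : ℝ) :
    deriv (deriv F) (-ω) = deriv (deriv F) ω := by
  have h1 : (fun x => deriv F (-x)) = fun x => -deriv F x := funext h.deriv_neg
  have h2 := deriv_comp_neg (deriv F) ω
  rw [h1, deriv.fun_neg] at h2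
  linarith

/-- Far out, `F`, `F'` and `F''` do not become small simultaneously. -/
theorem exists_nondegenerate (h : IsCharacteristic γ₁ γ₂ ω₀ K C L X₀ F) :
    ∃ c > 0, ∃ X > 0, ∀ ω, X ≤ |ω| → c ≤ |F ω| + |deriv F ω| + |deriv (deriv F) ω| := by
  obtain ⟨s, hs, hsb⟩ := exists_le_sin_cos h.pos₁ h.pos₂
  have p1 := h.pos₁
  have p2 := h.pos₂
  have hK := h.amplitude_pos
  set S : ℝ → ℝ := fun ω => K * (Real.sin (ω * γ₁) * Real.sin (ω * γ₂)) with hS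
  set S1 : ℝ → ℝ := fun ω => K * (γ₁ * Real.cos (ω * γ₁) * Real.sin (ω * γ₂)
    + γ₂ * Real.sin (ω * γ₁) * Real.cos (ω * γ₂)) with hS1
  set S2 : ℝ → ℝ := fun ω => K * (-(γ₁ ^ 2 + γ₂ ^ 2) * (Real.sin (ω * γ₁) * Real.sin (ω * γ₂))
    + 2 * γ₁ * γ₂ * (Real.cos (ω * γ₁) * Real.cos (ω * γ₂))) with hS2
  have ds : ∀ γ ω : ℝ, HasDerivAt (fun ω => Real.sin (ω * γ)) (Real.cos (ω * γ) * γ) ω :=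
    fun γ ω => by simpa using ((hasDerivAt_id ω).mul_const γ).sin
  have dc : ∀ γ ω : ℝ, HasDerivAt (fun ω => Real.cos (ω * γ)) (-Real.sin (ω * γ) * γ) ω :=
    fun γ ω => by simpa using ((hasDerivAt_id ω).mul_const γ).cos
  have d0 : ∀ ω, HasDerivAt S (S1 ω) ω := fun ω =>
    (((ds γ₁ ω).fun_mul (ds γ₂ ω)).const_mul K).congr_deriv (by rw [hS1]; ring)
  have d1 : ∀ ω, HasDerivAt S1 (S2 ω) ω := fun ω =>
    (((((dc γ₁ ω).const_mul γ₁).fun_mul (ds γ₂ ω)).fun_add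
      (((ds γ₁ ω).const_mul γ₂).fun_mul (dc γ₂ ω))).const_mul K).congr_deriv (by rw [hS2]; ring)
  have hSband : IsBand (-(γ₁ + γ₂)) (γ₁ + γ₂) fun ω => (S ω : ℂ) := by
    have := ((isBand_sin p1.le).mul (isBand_sin p2.le)).const_mul K
    rw [neg_add]
    convert this using 2
    rw [hS]
    push_cast
    ring
  set R : ℝ → ℝ := fun ω => F ω - S ω with hR
  have hRband : IsBand (-(γ₁ + γ₂)) (γ₁ + γ₂) fun ω => (R ω : ℂ) := by
    convert h.band.add (hSband.const_mul (-1)) using 2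
    rw [hR]
    push_cast
    ring
  have dF : ∀ ω, HasDerivAt F (deriv F ω) ω := fun ω => (h.band.differentiable_ofReal ω).hasDerivAt
  have dF' : ∀ ω, HasDerivAt (deriv F) (deriv (deriv F) ω) ω := fun ω =>
    (h.band.deriv_ofReal.differentiable_ofReal ω).hasDerivAt
  have r1 : deriv R = fun ω => deriv F ω - S1 ω := funext fun ω => ((dF ω).sub (d0 ω)).deriv
  have r2 : deriv (deriv R) = fun ω => deriv (deriv F) ω - S2 ω := by
    rw [r1]
    exact funext fun ω => ((dF' ω).sub (d1 ω)).deriv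
  -- The remainder is band-limited and tends to 0, so its first two derivatives tend to 0 as well;
  -- an asymptotic formula for F alone suffices.
  have t0 : Tendsto R atTop (𝓝 0) := by
    refine squeeze_zero_norm' ?_ (tendsto_const_nhds.div_atTop tendsto_id : Tendsto (fun ω => C / ω)
      atTop (𝓝 0))
    filter_upwards [eventually_gt_atTop 0] with ω hω
    have := h.asymptotic ω hω.ne'
    rwa [abs_of_pos hω] at this
  have t1 := hRband.tendsto_deriv_zero t0
  have t2 := hRband.deriv_ofReal.tendsto_deriv_zero t1
  -- S'' contains -(γ₁² + γ₂²) sin sin besides 2γ₁γ₂ cos cos; Λ is the cost of solving for cos cos.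
  set Λ := 1 + (1 + γ₁ ^ 2 + γ₂ ^ 2) / (2 * γ₁ * γ₂) with hΛ
  have hΛ0 : 0 < Λ := by positivity
  have lower : ∀ ω, K * s / Λ ≤ |S ω| + |S1 ω| + |S2 ω| := fun ω => by
    have h1 := hsb (ω * γ₁) (ω * γ₂)
    rw [hS, hS1, hS2]
    beta_reduce
    rw [abs_mul K, abs_mul K, abs_mul K, abs_of_pos hK]
    generalize Real.sin (ω * γ₁) * Real.sin (ω * γ₂) = A at *
    generalize γ₁ * Real.cos (ω * γ₁) * Real.sin (ω * γ₂)
      + γ₂ * Real.sin (ω * γ₁) * Real.cos (ω * γ₂) = B at *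
    generalize Real.cos (ω * γ₁) * Real.cos (ω * γ₂) = D at *
    have h2 : 2 * γ₁ * γ₂ * |D| ≤ |-(γ₁ ^ 2 + γ₂ ^ 2) * A + 2 * γ₁ * γ₂ * D|
        + (γ₁ ^ 2 + γ₂ ^ 2) * |A| := by
      have e1 : 2 * γ₁ * γ₂ * |D| = |2 * γ₁ * γ₂ * D| := by
        rw [abs_mul (2 * γ₁ * γ₂), abs_of_pos (by positivity : 0 < 2 * γ₁ * γ₂)]
      have e2 : (γ₁ ^ 2 + γ₂ ^ 2) * |A| = |(γ₁ ^ 2 + γ₂ ^ 2) * A| := by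
        rw [abs_mul (γ₁ ^ 2 + γ₂ ^ 2), abs_of_pos (by positivity : 0 < γ₁ ^ 2 + γ₂ ^ 2)]
      rw [e1, e2]
      refine le_trans (le_of_eq ?_) (abs_add_le _ _)
      congr 1
      ring
    have hE0 := abs_nonneg (-(γ₁ ^ 2 + γ₂ ^ 2) * A + 2 * γ₁ * γ₂ * D)
    generalize |-(γ₁ ^ 2 + γ₂ ^ 2) * A + 2 * γ₁ * γ₂ * D| = E at *
    have h3 : |D| ≤ (E + (γ₁ ^ 2 + γ₂ ^ 2) * |A|) / (2 * γ₁ * γ₂) := by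
      rw [le_div_iff₀ (by positivity)]
      linarith
    have hA := abs_nonneg A
    have hB := abs_nonneg B
    rw [div_le_iff₀ hΛ0, ← mul_add, ← mul_add, mul_assoc]
    refine mul_le_mul_of_nonneg_left (h1.trans ?_) hK.le
    have h4 : (E + (γ₁ ^ 2 + γ₂ ^ 2) * |A|) / (2 * γ₁ * γ₂)
        ≤ (1 + γ₁ ^ 2 + γ₂ ^ 2) / (2 * γ₁ * γ₂) * (|A| + |B| + E) := by
      rw [div_mul_eq_mul_div]
      gcongr
      have : 0 ≤ (γ₁ ^ 2 + γ₂ ^ 2) * E := by positivity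
      have : 0 ≤ (γ₁ ^ 2 + γ₂ ^ 2) * |B| := by positivity
      linarith
    rw [hΛ, mul_add, mul_one]
    linarith
  obtain ⟨X, hX⟩ := eventually_atTop.1 (((t0.abs.add t1.abs).add t2.abs).eventually
    (gt_mem_nhds (show |(0 : ℝ)| + |(0 : ℝ)| + |(0 : ℝ)| < K * s / Λ / 2 by simp; positivity)))
  have main : ∀ ω ≥ X, K * s / Λ / 2 ≤ |F ω| + |deriv F ω| + |deriv (deriv F) ω| := fun ω hω => by
    have l1 := hX ω hω
    have l2 := lower ω
    rw [r2, r1] at l1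
    have q0 : |S ω| ≤ |F ω| + |R ω| := by
      have : S ω = F ω - R ω := by rw [hR]; ring
      rw [this]
      exact abs_sub _ _
    have q1 : |S1 ω| ≤ |deriv F ω| + |deriv F ω - S1 ω| := by
      have : S1 ω = deriv F ω - (deriv F ω - S1 ω) := by ring
      nth_rewrite 1 [this]
      exact abs_sub _ _
    have q2 : |S2 ω| ≤ |deriv (deriv F) ω| + |deriv (deriv F) ω - S2 ω| := by
      have : S2 ω = deriv (deriv F) ω - (deriv (deriv F) ω - S2 ω) := by ring
      nth_rewrite 1 [this]
      exact abs_sub _ _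
    linarith
  refine ⟨K * s / Λ / 2, by positivity, max X 1, by positivity, fun ω hω => ?_⟩
  rcases le_total 0 ω with h0 | h0
  · rw [abs_of_nonneg h0] at hω
    exact main ω ((le_max_left _ _).trans hω)
  · rw [abs_of_nonpos h0] at hω
    have := main (-ω) ((le_max_left _ _).trans hω)
    rwa [h.even, h.deriv_neg, h.deriv_deriv_neg, abs_neg] at this

end IsCharacteristic

/-! ### Zeros and slopes of smooth functions -/

/-- A convex function that starts decreasingly from zero, with a small slope, returns to zero. -/
theorem exists_zero_right {f f' f'' : ℝ → ℝ} (h1 : ∀ t, HasDerivAt f (f' t) t)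
    (h2 : ∀ t, HasDerivAt f' (f'' t) t) {x r m : ℝ} (hr : 0 < r) (hm : 0 < m)
    (hf : ∀ t ∈ Icc x (x + r), m ≤ f'' t) (h0 : f x = 0) (hneg : f' x < 0)
    (hsmall : -f' x < m * r / 4) : ∃ z, f z = 0 ∧ x < z ∧ z < x + r := by
  have mvt : ∀ {f f' : ℝ → ℝ}, (∀ t, HasDerivAt f (f' t) t) → ∀ {u v : ℝ}, u < v →
      ∃ ξ ∈ Ioo u v, f v = f u + f' ξ * (v - u) := fun {f f'} h {u v} huv => by
    obtain ⟨ξ, hξ, hs⟩ := exists_hasDerivAt_eq_slope _ _ huv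
      (fun x _ => (h x).continuousAt.continuousWithinAt) fun x _ => h x
    rw [eq_div_iff (by linarith)] at hs
    exact ⟨ξ, hξ, by linarith⟩
  have low : ∀ t ∈ Ioc x (x + r), f' x + m * (t - x) ≤ f' t := fun t ht => by
    obtain ⟨ζ, hζ, e⟩ := mvt h2 ht.1
    have := mul_le_mul_of_nonneg_right (hf ζ ⟨hζ.1.le, hζ.2.le.trans ht.2⟩)
      (show 0 ≤ t - x by linarith [ht.1])
    linarith
  -- The slope is at least f'(x) on the first half of the interval and at least f'(x) + mr/2 on the
  -- second; their sum is positive because -f'(x) < mr/4, so f(x + r) > 0.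
  obtain ⟨ξ, hξ, e1⟩ := mvt h1 (show x < x + r / 2 by linarith)
  obtain ⟨η, hη, e2⟩ := mvt h1 (show x + r / 2 < x + r by linarith)
  have l1 := low ξ ⟨hξ.1, by linarith [hξ.2]⟩
  have l2 := low η ⟨by linarith [hη.1], hη.2.le⟩
  have l1' : f' x ≤ f' ξ := by
    have := mul_nonneg hm.le (show 0 ≤ ξ - x by linarith [hξ.1])
    linarith
  have l2' : f' x + m * (r / 2) ≤ f' η := by
    have := mul_le_mul_of_nonneg_left (show r / 2 ≤ η - x by linarith [hη.1]) hm.le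
    linarith
  have hpos : 0 < f (x + r) := by
    rw [e2, e1, h0]
    have e : 0 + f' ξ * (x + r / 2 - x) + f' η * (x + r - (x + r / 2))
      = (f' ξ + f' η) * (r / 2) := by ring
    rw [e]
    exact mul_pos (by linarith) (by linarith)
  have hs := (hasDerivWithinAt_iff_tendsto_slope' self_notMem_Ioi).1
    ((h1 x).hasDerivWithinAt (s := Ioi x))
  obtain ⟨v, hv, hvx⟩ := ((hs.eventually (gt_mem_nhds hneg)).and
    (Ioo_mem_nhdsGT (show x < x + r by linarith))).exists
  rw [slope_def_field, h0, sub_zero, div_lt_iff₀ (sub_pos.2 hvx.1), zero_mul] at hv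
  obtain ⟨z, hz, hz0⟩ := intermediate_value_Ioo hvx.2.le
    (fun t _ => (h1 t).continuousAt.continuousWithinAt) ⟨hv, hpos⟩
  exact ⟨z, hz0, hvx.1.trans hz.1, hz.2⟩

theorem exists_zero_near {f f' f'' : ℝ → ℝ} (h1 : ∀ t, HasDerivAt f (f' t) t)
    (h2 : ∀ t, HasDerivAt f' (f'' t) t) {x r m : ℝ} (hr : 0 < r) (hm : 0 < m)
    (hf : ∀ t, |t - x| ≤ r → m ≤ f'' t) (h0 : f x = 0) (hne : f' x ≠ 0)
    (hsmall : |f' x| < m * r / 4) : ∃ z, f z = 0 ∧ z ≠ x ∧ |z - x| < r := by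
  rcases lt_or_gt_of_ne hne with hneg | hpos
  · obtain ⟨z, hz, hz1, hz2⟩ := exists_zero_right h1 h2 hr hm
      (fun t ht => hf t (by rw [abs_le]; constructor <;> linarith [ht.1, ht.2])) h0 hneg
      (by rwa [abs_of_neg hneg] at hsmall)
    exact ⟨z, hz, hz1.ne', by rw [abs_lt]; constructor <;> linarith⟩
  · have g1 : ∀ t, HasDerivAt (fun t => f (-t)) (-f' (-t)) t := fun t => by
      simpa [Function.comp_def] using (h1 (-t)).scomp t (hasDerivAt_neg t)
    have g2 : ∀ t, HasDerivAt (fun t => -f' (-t)) (f'' (-t)) t := fun t => by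
      simpa [Function.comp_def] using ((h2 (-t)).scomp t (hasDerivAt_neg t)).fun_neg
    obtain ⟨z, hz, hz1, hz2⟩ := exists_zero_right g1 g2 (x := -x) hr hm
      (fun t ht => hf (-t) (by rw [abs_le]; constructor <;> linarith [ht.1, ht.2])) (by simpa using h0)
      (by simpa using hpos) (by rwa [neg_neg, neg_neg, ← abs_of_pos hpos])
    exact ⟨-z, hz, by intro h; linarith, by rw [abs_lt]; constructor <;> linarith⟩

/-- At an isolated zero of a function that is not degenerate, the slope is bounded below. -/
theorem le_abs_deriv_of_isolated {f f' f'' f''' : ℝ → ℝ} (h1 : ∀ t, HasDerivAt f (f' t) t)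
    (h2 : ∀ t, HasDerivAt f' (f'' t) t) (h3 : ∀ t, HasDerivAt f'' (f''' t) t) {B : ℝ} (hB : 0 < B)
    (hb : ∀ t, |f''' t| ≤ B) {c : ℝ} (hc : 0 < c) {x : ℝ} (h0 : f x = 0) (hne : f' x ≠ 0)
    (hnd : c ≤ |f' x| + |f'' x|) {d : ℝ} (hd : 0 < d) (hd1 : d ≤ 1)
    (hiso : ∀ z, f z = 0 → z ≠ x → d ≤ |z - x|) :
    min (c / 2) (c / 16 * min 1 (c / (4 * B))) * d ≤ |f' x| := by
  by_contra! hlt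
  -- On this radius f'' changes by at most c/4, so it keeps its sign and has modulus at least c/4.
  -- Since r ≤ d, a second zero within r contradicts isolation.
  set r := d * min 1 (c / (4 * B)) with hr
  have hm0 : 0 < min 1 (c / (4 * B)) := lt_min one_pos (by positivity)
  have hr0 : 0 < r := by positivity
  have hrd : r ≤ d := mul_le_of_le_one_right hd.le (min_le_left _ _)
  have hrc : r ≤ c / (4 * B) :=
    (mul_le_of_le_one_left hm0.le hd1).trans (min_le_right _ _)
  have s1 : |f' x| < c / 2 := hlt.trans_le
    ((mul_le_mul_of_nonneg_right (min_le_left _ _) hd.le).trans (mul_le_of_le_one_right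
      (by positivity) hd1))
  have s2 : |f' x| < c / 4 * r / 4 := hlt.trans_le
    ((mul_le_mul_of_nonneg_right (min_le_right _ _) hd.le).trans (le_of_eq (by rw [hr]; ring)))
  have s3 : c / 2 < |f'' x| := by linarith
  have lip : ∀ t, |t - x| ≤ r → |f'' t - f'' x| ≤ c / 4 := fun t ht => by
    have := Convex.norm_image_sub_le_of_norm_hasDerivWithin_le (f := f'') (f' := f''') (C := B)
      (s := univ) (fun t _ => (h3 t).hasDerivWithinAt) (fun t _ => hb t) convex_univ (mem_univ x)
      (mem_univ t)
    refine this.trans ?_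
    calc B * ‖t - x‖ ≤ B * (c / (4 * B)) := by gcongr; exact ht.trans hrc
      _ = c / 4 := by field_simp
  have contra : ∃ z, f z = 0 ∧ z ≠ x ∧ |z - x| < r := by
    rcases lt_or_ge 0 (f'' x) with hp | hp
    · rw [abs_of_pos hp] at s3
      exact exists_zero_near h1 h2 hr0 (by positivity : 0 < c / 4) (fun t ht => by
        have := (abs_le.1 (lip t ht)).1
        linarith) h0 hne s2
    · rw [abs_of_nonpos hp] at s3
      obtain ⟨z, hz, hz1⟩ := exists_zero_near (fun t => (h1 t).neg) (fun t => (h2 t).neg) hr0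
        (by positivity : 0 < c / 4) (fun t ht => by
          have := (abs_le.1 (lip t ht)).2
          linarith) (by simp [h0]) (by simpa using hne) (by simpa using s2)
      exact ⟨z, by simpa using hz, hz1⟩
  obtain ⟨z, hz, hzx, hzr⟩ := contra
  exact absurd (hiso z hz hzx) (not_le.2 (hzr.trans_le hrd))

/-- Three zeros close to each other make the first two derivatives small. -/
theorem abs_deriv_le_of_three_zeros {f f' f'' f''' : ℝ → ℝ} (h1 : ∀ t, HasDerivAt f (f' t) t)
    (h2 : ∀ t, HasDerivAt f' (f'' t) t) (h3 : ∀ t, HasDerivAt f'' (f''' t) t) {B : ℝ}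
    (hb2 : ∀ t, |f'' t| ≤ B) (hb3 : ∀ t, |f''' t| ≤ B) {x y z : ℝ} (hxy : x < y) (hyz : y < z)
    (hx : f x = 0) (hy : f y = 0) (hz : f z = 0) :
    |f' x| + |f'' x| ≤ 2 * B * (z - x) := by
  have cont : ∀ {f f' : ℝ → ℝ}, (∀ t, HasDerivAt f (f' t) t) → ∀ {s : Set ℝ}, ContinuousOn f s :=
    fun {f f'} h {s} t _ => (h t).continuousAt.continuousWithinAt
  have lip : ∀ {f f' : ℝ → ℝ}, (∀ t, HasDerivAt f (f' t) t) → (∀ t, |f' t| ≤ B) → ∀ t,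
      f t = 0 → x < t → t < z → |f x| ≤ B * (z - x) := fun {f f'} h hb t ht htx htz => by
    have := Convex.norm_image_sub_le_of_norm_hasDerivWithin_le (f := f) (f' := f') (C := B)
      (s := univ) (fun t _ => (h t).hasDerivWithinAt) (fun t _ => hb t) convex_univ (mem_univ t)
      (mem_univ x)
    rw [ht, sub_zero, Real.norm_eq_abs, Real.norm_eq_abs, abs_of_neg (by linarith : x - t < 0)] at this
    refine this.trans (mul_le_mul_of_nonneg_left (by linarith) ((abs_nonneg _).trans (hb x)))
  -- Rolle twice gives a zero of f' and one of f'' between x and z; the bounds on f'' and f''' carry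
  -- this back to x.
  obtain ⟨u, hu, hu0⟩ := exists_hasDerivAt_eq_zero hxy (cont h1) (hx.trans hy.symm) fun t _ => h1 t
  obtain ⟨v, hv, hv0⟩ := exists_hasDerivAt_eq_zero hyz (cont h1) (hy.trans hz.symm) fun t _ => h1 t
  obtain ⟨w, hw, hw0⟩ := exists_hasDerivAt_eq_zero (hu.2.trans hv.1) (cont h2)
    (hu0.trans hv0.symm) fun t _ => h2 t
  have l1 := lip h2 hb2 u hu0 hu.1 (hu.2.trans hyz)
  have l2 := lip h3 hb3 w hw0 (hu.1.trans hw.1) (hw.2.trans hv.2)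
  linarith

/-- The trapezoidal rule, for a function that takes equal values at the end points. -/
theorem norm_deriv_add_deriv_le {f f' f'' f''' : ℝ → ℂ} (h1 : ∀ t, HasDerivAt f (f' t) t)
    (h2 : ∀ t, HasDerivAt f' (f'' t) t) (h3 : ∀ t, HasDerivAt f'' (f''' t) t) {B : ℝ}
    (hb : ∀ t, ‖f''' t‖ ≤ B) {x y : ℝ} (hxy : x < y) (h : f x = f y) :
    ‖f' x + f' y‖ ≤ B * (y - x) ^ 2 := by
  have hB : 0 ≤ B := (norm_nonneg _).trans (hb 0)
  have dr : ∀ t, HasDerivAt (fun t : ℝ => ((t - x : ℝ) : ℂ)) 1 t := fun t => by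
    simpa using ((hasDerivAt_id t).sub_const x).ofReal_comp
  have b1 : ∀ t ∈ Icc x y, ‖f' t - f' x - ((t - x : ℝ) : ℂ) * f'' t‖ ≤ B * (y - x) * (t - x) :=
    fun t ht => by
    have := norm_image_sub_le_of_norm_deriv_le_segment' (a := x) (b := y) (C := B * (y - x))
      (f := fun t => f' t - f' x - ((t - x : ℝ) : ℂ) * f'' t)
      (f' := fun t => f'' t - (1 * f'' t + ((t - x : ℝ) : ℂ) * f''' t))
      (fun t _ => (((h2 t).sub_const _).sub ((dr t).mul (h3 t))).hasDerivWithinAt) (fun t ht => by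
        have : f'' t - (1 * f'' t + ((t - x : ℝ) : ℂ) * f''' t) = -(((t - x : ℝ) : ℂ) * f''' t) := by
          ring
        rw [this, norm_neg, norm_mul, Complex.norm_real, mul_comm, Real.norm_of_nonneg (by linarith [ht.1])]
        exact mul_le_mul (hb t) (by linarith [ht.2]) (by linarith [ht.1]) hB) t ht
    simpa using this
  -- The function 2(f(t) - f(x)) - (t - x)(f'(x) + f'(t)) has derivative f'(t) - f'(x) - (t -
  -- x)f''(t), bounded in b1. At t = y the first part vanishes. Only norm estimates are used, as
  -- Rolle fails for complex values.
  have b2 := norm_image_sub_le_of_norm_deriv_le_segment' (a := x) (b := y)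
    (C := B * (y - x) * (y - x))
    (f := fun t => 2 * (f t - f x) - ((t - x : ℝ) : ℂ) * (f' x + f' t))
    (f' := fun t => 2 * f' t - (1 * (f' x + f' t) + ((t - x : ℝ) : ℂ) * f'' t))
    (fun t _ => ((((h1 t).sub_const _).const_mul 2).sub
      ((dr t).mul ((h2 t).const_add _))).hasDerivWithinAt) (fun t ht => by
        have : 2 * f' t - (1 * (f' x + f' t) + ((t - x : ℝ) : ℂ) * f'' t)
          = f' t - f' x - ((t - x : ℝ) : ℂ) * f'' t := by ring
        rw [this]
        exact (b1 t ⟨ht.1, ht.2.le⟩).trans (mul_le_mul_of_nonneg_left (by linarith [ht.2])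
          (mul_nonneg hB (by linarith)))) y (right_mem_Icc.2 hxy.le)
  have e : (2 * (f y - f x) - ((y - x : ℝ) : ℂ) * (f' x + f' y))
      - (2 * (f x - f x) - ((x - x : ℝ) : ℂ) * (f' x + f' x)) = -(((y - x : ℝ) : ℂ) * (f' x + f' y)) := by
    rw [h]
    simp
  have hyx : 0 < y - x := by linarith
  rw [e, norm_neg, norm_mul, Complex.norm_real, Real.norm_of_nonneg hyx.le] at b2
  refine le_of_mul_le_mul_left (b2.trans (le_of_eq ?_)) hyx
  ring

/-! ### Enumeration of the zeros -/

/-- An unbounded set of reals without finite accumulation points and bounded below is the range of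
an increasing sequence. -/
theorem exists_strictMono_range_eq {S : Set ℝ} (hfin : ∀ X, (S ∩ Iic X).Finite)
    (hne : S.Nonempty) (hub : ∀ x, ∃ z ∈ S, x < z) : ∃ w : ℕ → ℝ, StrictMono w ∧ range w = S := by
  obtain ⟨z, hz⟩ := hne
  have hmin : ∃ z₀ ∈ S, ∀ x ∈ S, z₀ ≤ x := by
    obtain ⟨z₀, hz₀, hm⟩ := exists_min_image _ id (hfin z) ⟨z, hz, le_refl z⟩
    refine ⟨z₀, hz₀.1, fun x hx => ?_⟩
    rcases le_total x z with h | h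
    · exact hm x ⟨hx, h⟩
    · exact le_trans hz₀.2 h
  obtain ⟨z₀, hz₀, hm⟩ := hmin
  -- With a bottom, finite intervals and no maximum, the set is order isomorphic to ℕ.
  let _ : OrderBot S := { bot := ⟨z₀, hz₀⟩, bot_le := fun x => hm x x.2 }
  let _ : LocallyFiniteOrder S := LocallyFiniteOrder.ofFiniteIcc fun a b => by
    refine Finite.of_finite_image (f := Subtype.val) ((hfin b).subset ?_)
      Subtype.val_injective.injOn
    rintro _ ⟨x, hx, rfl⟩
    exact ⟨x.2, hx.2⟩
  let _ : SuccOrder S := LinearLocallyFiniteOrder.succOrder S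
  let _ : PredOrder S := LinearLocallyFiniteOrder.predOrder S
  have _ : NoMaxOrder S := ⟨fun a => by
    obtain ⟨z, hz, h⟩ := hub a
    exact ⟨⟨z, hz⟩, h⟩⟩
  let e : S ≃o ℕ := orderIsoNatOfLinearSuccPredArch
  refine ⟨fun n => e.symm n, fun m n h => e.symm.strictMono h, ?_⟩
  ext x
  constructor
  · rintro ⟨n, rfl⟩
    exact (e.symm n).2
  · intro hx
    exact ⟨e ⟨x, hx⟩, by simp⟩

/-- An accumulation point of these zeros would be a zero of modulus at least ω₀, hence simple, hence
isolated. The lower bound ω₀ matters because simplicity is known only away from 0. -/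
theorem IsCharacteristic.finite_zeros {γ₁ γ₂ ω₀ K C L X₀ : ℝ} {F : ℝ → ℝ}
    (h : IsCharacteristic γ₁ γ₂ ω₀ K C L X₀ F) (X : ℝ) :
    {z | (z ≠ 0 ∧ F z = 0) ∧ |z| ≤ X}.Finite := by
  by_contra hinf
  obtain ⟨z, -, hz⟩ := Set.Infinite.exists_accPt_of_subset_isCompact hinf
    (isCompact_Icc (a := -X) (b := X)) fun z hz => abs_le.1 hz.2
  have hcont := h.band.differentiable_ofReal.continuous
  have hzc : ∀ {T : Set ℝ}, IsClosed T → {z | (z ≠ 0 ∧ F z = 0) ∧ |z| ≤ X} ⊆ T → z ∈ T :=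
    fun hT hs => hT.closure_subset_iff.2 hs hz.clusterPt.mem_closure
  have h0 : F z = 0 := hzc (isClosed_singleton.preimage hcont) fun z hz => hz.1.2
  have h1 : ω₀ ≤ |z| := by
    refine hzc (T := {z | ω₀ ≤ |z|}) (isClosed_le continuous_const continuous_abs) ?_
    rintro z ⟨⟨hz, hF⟩, -⟩
    rcases lt_or_gt_of_ne hz with hz' | hz'
    · change ω₀ ≤ |z|
      rw [abs_of_neg hz']
      exact h.le_of_zero (-z) (by linarith) (by rw [h.even, hF])
    · change ω₀ ≤ |z|
      rw [abs_of_pos hz']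
      exact h.le_of_zero z hz' hF
  have hzne : z ≠ 0 := abs_pos.1 (h.lower_pos.trans_le h1)
  have hev := (h.band.differentiable_ofReal z).hasDerivAt.eventually_ne (h.deriv_ne_zero z hzne h0)
    (c := 0)
  obtain ⟨w, hw, hw'⟩ := ((accPt_iff_frequently_nhdsNE.1 hz).and_eventually hev).exists
  exact hw' hw.1.2

/-- The indices n ≥ 0 stand for n + 1, so the symmetry of the frequencies is n ↦ -1 - n rather than
n ↦ -n. -/
theorem freq_neg (lam : ℕ → ℝ) (n : ℤ) : freq lam (-1 - n) = -freq lam n := by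
  rcases n with k | k
  · have : -1 - Int.ofNat k = Int.negSucc k := by
      rw [Int.negSucc_eq]; simp only [Int.ofNat_eq_natCast]; ring
    rw [this]
    rfl
  · have : -1 - Int.negSucc k = Int.ofNat k := by
      rw [Int.negSucc_eq]; simp only [Int.ofNat_eq_natCast]; ring
    rw [this]
    exact (neg_neg _).symm

/-- The nonzero zeros of the even function `F`, listed by the integers in increasing order. -/
structure IsSpectrum (F : ℝ → ℝ) (ω : ℤ → ℝ) : Prop where
  strictMono : StrictMono ω
  neg : ∀ n, ω (-1 - n) = -ω n
  ne_zero : ∀ n, ω n ≠ 0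
  zero : ∀ n, F (ω n) = 0
  exists_eq : ∀ z ≠ 0, F z = 0 → ∃ n, ω n = z

theorem IsCharacteristic.exists_isSpectrum {γ₁ γ₂ ω₀ K C L X₀ : ℝ} {F : ℝ → ℝ}
    (h : IsCharacteristic γ₁ γ₂ ω₀ K C L X₀ F) :
    ∃ lam : ℕ → ℝ, StrictMono lam ∧ (∀ k, 0 < lam k) ∧
      range lam = {l | ∃ ω > 0, F ω = 0 ∧ l = ω ^ 2} ∧ IsSpectrum F (freq lam) := by
  have hub : ∀ x, ∃ z ∈ {z | 0 < z ∧ F z = 0}, x < z := fun x => by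
    obtain ⟨z, hz, hF⟩ := h.exists_zero (max X₀ (x + 1)) (le_max_left _ _)
    exact ⟨z, ⟨h.threshold_pos.trans_le ((le_max_left _ _).trans hz.1), hF⟩,
      lt_of_lt_of_le (by linarith) ((le_max_right _ _).trans hz.1)⟩
  obtain ⟨w, hw, hr⟩ := exists_strictMono_range_eq (S := {z | 0 < z ∧ F z = 0})
    (fun X => (h.finite_zeros X).subset fun z hz =>
      ⟨⟨hz.1.1.ne', hz.1.2⟩, by rw [abs_of_pos hz.1.1]; exact hz.2⟩)
    (by obtain ⟨z, hz, -⟩ := hub 0; exact ⟨z, hz⟩) hub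
  have hmem : ∀ k, 0 < w k ∧ F (w k) = 0 := fun k => by
    have : w k ∈ range w := mem_range_self k
    rwa [hr] at this
  have f1 : ∀ k : ℕ, freq (fun k => w k ^ 2) (Int.ofNat k) = w k := fun k =>
    Real.sqrt_sq (hmem k).1.le
  have f2 : ∀ k : ℕ, freq (fun k => w k ^ 2) (Int.negSucc k) = -w k := fun k =>
    congrArg Neg.neg (Real.sqrt_sq (hmem k).1.le)
  refine ⟨fun k => w k ^ 2, fun m n hmn => pow_lt_pow_left₀ (hw hmn) (hmem m).1.le two_ne_zero,
    fun k => pow_pos (hmem k).1 2, ?_, strictMono_int_of_lt_succ fun n => ?_, freq_neg _,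
    fun n => ?_, fun n => ?_, fun z hz hF => ?_⟩
  · ext l
    constructor
    · rintro ⟨k, rfl⟩
      exact ⟨w k, (hmem k).1, (hmem k).2, rfl⟩
    · rintro ⟨ω, hω, hF, rfl⟩
      have : ω ∈ range w := by rw [hr]; exact ⟨hω, hF⟩
      obtain ⟨k, rfl⟩ := this
      exact ⟨k, rfl⟩
  · rcases n with k | (_ | k)
    · rw [show Int.ofNat k + 1 = Int.ofNat (k + 1) from rfl, f1, f1]
      exact hw (Nat.lt_succ_self k)
    · rw [show Int.negSucc 0 + 1 = Int.ofNat 0 from rfl, f1, f2]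
      linarith [(hmem 0).1]
    · rw [show Int.negSucc (k + 1) + 1 = Int.negSucc k from rfl, f2, f2]
      exact neg_lt_neg (hw (Nat.lt_succ_self k))
  · rcases n with k | k
    · rw [f1]
      exact (hmem k).1.ne'
    · rw [f2]
      exact (neg_lt_zero.2 (hmem k).1).ne
  · rcases n with k | k
    · rw [f1]
      exact (hmem k).2
    · rw [f2, h.even]
      exact (hmem k).2
  · rcases lt_or_gt_of_ne hz with hz' | hz'
    · have : -z ∈ range w := by rw [hr]; exact ⟨by linarith, by rw [h.even, hF]⟩
      obtain ⟨k, hk⟩ := this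
      exact ⟨Int.negSucc k, by rw [f2, hk, neg_neg]⟩
    · have : z ∈ range w := by rw [hr]; exact ⟨hz', hF⟩
      obtain ⟨k, hk⟩ := this
      exact ⟨Int.ofNat k, by rw [f1, hk]⟩

/-- Reduces uniform bounds to asymptotic ones: the finitely many low frequencies only lower the
constant. -/
theorem exists_pos_le_of_finite {g : ℤ → ℝ} (hg : ∀ n, 0 < g n) {c : ℝ} (hc : 0 < c)
    (hfin : {n | g n < c}.Finite) : ∃ c' > 0, ∀ n, c' ≤ g n := by
  rcases {n | g n < c}.eq_empty_or_nonempty with he | hne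
  · exact ⟨c, hc, fun n => by
      by_contra hn
      have : n ∈ {n | g n < c} := not_le.1 hn
      simp [he] at this⟩
  · obtain ⟨m, hm, hmin⟩ := exists_min_image _ g hfin hne
    refine ⟨g m, hg m, fun n => ?_⟩
    by_cases hn : g n < c
    · exact hmin n hn
    · exact (le_of_lt hm).trans (not_lt.1 hn)

/-! ### Gaps between the frequencies and derivative bounds -/

namespace IsSpectrum

variable {γ₁ γ₂ ω₀ K C L X₀ : ℝ} {F : ℝ → ℝ} {ω : ℤ → ℝ}

theorem finite_abs_lt (s : IsSpectrum F ω) (h : IsCharacteristic γ₁ γ₂ ω₀ K C L X₀ F) (X : ℝ) :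
    {n | |ω n| < X}.Finite :=
  Finite.of_finite_image (f := ω) ((h.finite_zeros X).subset (by
    rintro _ ⟨n, hn, rfl⟩
    exact ⟨⟨s.ne_zero n, s.zero n⟩, le_of_lt hn⟩)) s.strictMono.injective.injOn

theorem gap_pos (s : IsSpectrum F ω) (n : ℤ) : 0 < gap ω n := sub_pos.2 (s.strictMono (by omega))

/-- Three zeros close together would make F' and F'' small at a zero of F, which nondegeneracy
forbids far out. -/
theorem exists_two_gap (s : IsSpectrum F ω) (h : IsCharacteristic γ₁ γ₂ ω₀ K C L X₀ F) :
    ∃ δ > 0, ∀ n, 2 * δ < ω (n + 2) - ω n := by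
  obtain ⟨c, hc, X, hX, hnd⟩ := h.exists_nondegenerate
  have b2 := h.band.deriv_ofReal.deriv_ofReal
  obtain ⟨B, hB, hB'⟩ := b2.exists_abs_le
  obtain ⟨D, hD, hD'⟩ := b2.deriv_ofReal.exists_abs_le
  obtain ⟨c', hc', hle⟩ := exists_pos_le_of_finite (g := fun n => ω (n + 2) - ω n)
    (fun n => sub_pos.2 (s.strictMono (by omega))) (c := c / (2 * (B + D))) (by positivity)
    ((s.finite_abs_lt h X).subset fun n hn => by
      by_contra hX
      have h1 := hnd (ω n) (not_lt.1 hX)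
      have h2 := abs_deriv_le_of_three_zeros (B := B + D)
        (fun t => (h.band.differentiable_ofReal t).hasDerivAt)
        (fun t => (h.band.deriv_ofReal.differentiable_ofReal t).hasDerivAt)
        (fun t => (b2.differentiable_ofReal t).hasDerivAt) (fun t => (hB' t).trans (by linarith))
        (fun t => (hD' t).trans (by linarith)) (s.strictMono (show n < n + 1 by omega))
        (s.strictMono (show n + 1 < n + 2 by omega)) (s.zero _) (s.zero _) (s.zero _)
      rw [s.zero, abs_zero, zero_add] at h1
      have h3 : ω (n + 2) - ω n < c / (2 * (B + D)) := hn
      rw [lt_div_iff₀ (by positivity)] at h3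
      linarith)
  exact ⟨c' / 3, by positivity, fun n => by have := hle n; linarith⟩

/-- A small gap whose index is not in the set must be preceded by another small gap; the two
together would be shorter than 2δ. -/
theorem isPairing_closePairs {δ d : ℝ} (hδ : ∀ n, 2 * δ < ω (n + 2) - ω n) (hd : 0 < d)
    (hdδ : d ≤ δ) : IsPairing ω (closePairs ω d) := by
  refine ⟨fun n hn hn' => ?_, d, hd, fun n hn => ?_⟩
  · have h1 : d ≤ gap ω (n + 1 - 1) := hn'.1
    rw [add_sub_cancel_right] at h1
    exact absurd hn.2 (not_lt.2 h1)
  · by_contra hlt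
    have hlt' := not_le.1 hlt
    have h1 : gap ω (n - 1) < d := by
      by_contra h2
      exact hn ⟨not_lt.1 h2, hlt'⟩
    have h3 := hδ (n - 1)
    rw [gap, sub_add_cancel] at h1
    rw [gap] at hlt'
    rw [show n - 1 + 2 = n + 1 by ring] at h3
    linarith

/-- Relative density of the zeros bounds the gaps at nonnegative frequencies, and symmetry those at
negative ones. The gap across 0, of index -1, is treated apart. -/
theorem exists_gap_le (s : IsSpectrum F ω) (h : IsCharacteristic γ₁ γ₂ ω₀ K C L X₀ F) :
    ∃ D, ∀ n, gap ω n ≤ D := by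
  have key : ∀ n, 0 ≤ ω n → gap ω n ≤ X₀ + 1 + L := fun n hn => by
    by_contra hlt
    have hX := h.threshold_pos
    rw [gap, not_le] at hlt
    obtain ⟨z, hz, hF⟩ := h.exists_zero (ω n + X₀) (by linarith)
    obtain ⟨m, rfl⟩ := s.exists_eq z (by linarith [hz.1]) hF
    have h1 : n < m := s.strictMono.lt_iff_lt.1 (by linarith [hz.1])
    have h2 : m < n + 1 := s.strictMono.lt_iff_lt.1 (by linarith [hz.2])
    omega
  have gneg : ∀ n, gap ω (-2 - n) = gap ω n := fun n => by
    rw [gap, gap, show -2 - n + 1 = -1 - n by ring, show -2 - n = -1 - (n + 1) by ring, s.neg, s.neg]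
    ring
  have h0 : 0 ≤ ω 0 := by
    have h1 := s.neg 0
    have h2 := s.strictMono (show (-1 - 0 : ℤ) < 0 by norm_num)
    linarith
  refine ⟨max (X₀ + 1 + L) (gap ω (-1)), fun n => ?_⟩
  rcases lt_trichotomy n (-1) with hn | rfl | hn
  · rw [← gneg]
    refine (key _ (h0.trans (s.strictMono.monotone ?_))).trans (le_max_left _ _)
    omega
  · exact le_max_right _ _
  · exact (key _ (h0.trans (s.strictMono.monotone (by omega)))).trans (le_max_left _ _)

/-- Far out, a nondegenerate zero with small slope has another zero nearby, so the slope is bounded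
below by the distance to the neighbours; at the finitely many other frequencies simplicity is
enough. -/
theorem exists_le_abs_deriv (s : IsSpectrum F ω) (h : IsCharacteristic γ₁ γ₂ ω₀ K C L X₀ F) :
    ∃ κ > 0, ∀ n, κ * min 1 (min (gap ω (n - 1)) (gap ω n)) ≤ |deriv F (ω n)| := by
  obtain ⟨c, hc, X, hX, hnd⟩ := h.exists_nondegenerate
  have b2 := h.band.deriv_ofReal.deriv_ofReal
  obtain ⟨D, hD, hD'⟩ := b2.deriv_ofReal.exists_abs_le
  have hg : ∀ n, 0 < min 1 (min (gap ω (n - 1)) (gap ω n)) := fun n =>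
    lt_min one_pos (lt_min (s.gap_pos _) (s.gap_pos _))
  set κ := min (c / 2) (c / 16 * min 1 (c / (4 * D))) with hκ
  have hκ0 : 0 < κ := by
    have : 0 < min 1 (c / (4 * D)) := lt_min one_pos (by positivity)
    exact lt_min (by positivity) (by positivity)
  obtain ⟨c', hc', hle⟩ := exists_pos_le_of_finite
    (g := fun n => |deriv F (ω n)| / min 1 (min (gap ω (n - 1)) (gap ω n)))
    (fun n => div_pos (abs_pos.2 (h.deriv_ne_zero _ (s.ne_zero n) (s.zero n))) (hg n)) hκ0
    ((s.finite_abs_lt h (X + 1)).subset fun n hn => by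
      by_contra hX'
      have hX1 : X + 1 ≤ |ω n| := not_lt.1 hX'
      have h1 := hnd (ω n) (by linarith)
      rw [s.zero, abs_zero, zero_add] at h1
      have h2 := le_abs_deriv_of_isolated
        (fun t => (h.band.differentiable_ofReal t).hasDerivAt)
        (fun t => (h.band.deriv_ofReal.differentiable_ofReal t).hasDerivAt)
        (fun t => (b2.differentiable_ofReal t).hasDerivAt) hD hD' hc (s.zero n)
        (h.deriv_ne_zero _ (s.ne_zero n) (s.zero n)) h1 (hg n) (min_le_left _ _)
        fun z hz hzn => by
          -- The list omits a possible zero of F at 0. The threshold X + 1 keeps it at distance at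
          -- least 1, whence the cap by 1.
          by_cases hz0 : z = 0
          · subst hz0
            rw [zero_sub, abs_neg]
            exact (min_le_left _ _).trans (by linarith)
          · obtain ⟨m, rfl⟩ := s.exists_eq z hz0 hz
            have hmn : m ≠ n := fun e => hzn (by rw [e])
            refine (min_le_right _ _).trans ?_
            rcases lt_or_gt_of_ne hmn with hlt | hlt
            · refine (min_le_left _ _).trans ?_
              have := s.strictMono.monotone (show m ≤ n - 1 by omega)
              rw [gap, sub_add_cancel, abs_of_neg (by linarith [s.strictMono hlt])]
              linarith
            · refine (min_le_right _ _).trans ?_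
              have := s.strictMono.monotone (show n + 1 ≤ m by omega)
              rw [gap, abs_of_pos (by linarith [s.strictMono hlt])]
              linarith
      have h3 : |deriv F (ω n)| / min 1 (min (gap ω (n - 1)) (gap ω n)) < κ := hn
      rw [div_lt_iff₀ (hg n)] at h3
      exact absurd h2 (not_le.2 h3))
  exact ⟨c', hc', fun n => (le_div_iff₀ (hg n)).1 (hle n)⟩

theorem exists_derivBounds (s : IsSpectrum F ω) (h : IsCharacteristic γ₁ γ₂ ω₀ K C L X₀ F)
    {A : Set ℤ} (hA : IsPairing ω A) :
    ∃ κ > 0, ∃ K D : ℝ, DerivBounds ω A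
      (fun n => deriv (fun x => expI x (γ₁ + γ₂) * (F x : ℂ)) (ω n)) κ K D := by
  obtain ⟨κ, hκ, hκ'⟩ := s.exists_le_abs_deriv h
  obtain ⟨D, hD⟩ := s.exists_gap_le h
  obtain ⟨hA1, c, hc, hA2⟩ := hA
  have b0 := (isBand_expI (γ₁ + γ₂)).mul h.band
  obtain ⟨B, hB, hB'⟩ := b0.deriv.deriv.deriv.exists_bound
  -- At a zero of F the product rule leaves only the phase times F', so the phase does not affect
  -- the size.
  have hnorm : ∀ n, ‖deriv (fun x => expI x (γ₁ + γ₂) * (F x : ℂ)) (ω n)‖ = |deriv F (ω n)| :=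
    fun n => by
    have h1 := (hasDerivAt_expI (ω n) (γ₁ + γ₂)).fun_mul
      (h.band.differentiable_ofReal (ω n)).hasDerivAt.ofReal_comp
    rw [h1.deriv, s.zero, Complex.ofReal_zero, mul_zero, zero_add, norm_mul, norm_expI, one_mul,
      Complex.norm_real, Real.norm_eq_abs]
  have hD0 : 0 < D := (s.gap_pos 0).trans_le (hD 0)
  have hm : 0 < min 1 c := lt_min one_pos hc
  have hm1 : 0 < 1 + D := by linarith
  have pre : ∀ n ∈ A, n - 1 ∉ A := fun n hn hn' => hA1 _ hn' (by simpa using hn)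
  -- Makes q·gap at most 1, at most c and at most gap. The outer gaps of a pair have indices outside
  -- `A`, hence are at least c, so the minimum in the slope bound can be replaced by q times the
  -- inner gap.
  set q := min 1 c / (1 + D) with hq
  have hq0 : 0 < q := div_pos hm hm1
  have hq1 : q ≤ min 1 c := div_le_self hm.le (by linarith)
  have hqD : ∀ n, q * gap ω n ≤ min 1 c := fun n => by
    rw [hq, div_mul_eq_mul_div, div_le_iff₀ hm1]
    exact mul_le_mul_of_nonneg_left ((hD n).trans (by linarith)) hm.le
  have hqg : ∀ n, q * gap ω n ≤ gap ω n := fun n =>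
    mul_le_of_le_one_left (s.gap_pos n).le (hq1.trans (min_le_left _ _))
  refine ⟨κ * q, by positivity, B, D, fun n hn hnA => ?_, fun n hn => ?_, fun n hn => ?_,
    fun n hn => ?_, hD⟩
  · rw [hnorm]
    refine (mul_le_mul_of_nonneg_left (hq1.trans ?_) hκ.le).trans (hκ' n)
    exact min_le_min le_rfl (le_min (hA2 _ hn) (hA2 _ hnA))
  · rw [hnorm, mul_assoc]
    refine (mul_le_mul_of_nonneg_left ?_ hκ.le).trans (hκ' n)
    exact le_min ((hqD n).trans (min_le_left _ _)) (le_min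
      ((hqD n).trans ((min_le_right _ _).trans (hA2 _ (pre n hn)))) (hqg n))
  · rw [hnorm, mul_assoc]
    refine (mul_le_mul_of_nonneg_left ?_ hκ.le).trans (hκ' (n + 1))
    rw [add_sub_cancel_right]
    exact le_min ((hqD n).trans (min_le_left _ _)) (le_min (hqg n)
      ((hqD n).trans ((min_le_right _ _).trans (hA2 _ (hA1 n hn)))))
  · exact norm_deriv_add_deriv_le (fun t => (b0.differentiable t).hasDerivAt)
      (fun t => (b0.deriv.differentiable t).hasDerivAt)
      (fun t => (b0.deriv.deriv.differentiable t).hasDerivAt) hB'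
      (s.strictMono (show n < n + 1 by omega)) (by simp [s.zero])

end IsSpectrum

end StringMass

theorem lemma4p2
    (ρ₁ σ₁ q₁ ρ₂ σ₂ q₂ : ℝ → ℝ) (M : ℝ)
    (h₁ : StringMass.IsStringCoeff (-1) 0 ρ₁ σ₁ q₁)
    (h₂ : StringMass.IsStringCoeff 0 1 ρ₂ σ₂ q₂)
    (hM : 0 < M) :
    ∃ lam : ℕ → ℝ,
      -- `lam` lists all eigenvalues in increasing order, and they are positive
      StrictMono lam ∧ (∀ k, 0 < lam k) ∧
      Set.range lam = {l : ℝ | StringMass.IsEigenvalue ρ₁ σ₁ q₁ ρ₂ σ₂ q₂ M l} ∧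
      -- the close frequencies come in separated pairs
      (∃ δ > 0,
        (∀ n : ℤ, 2 * δ < StringMass.freq lam (n + 2) - StringMass.freq lam n) ∧
        ∀ d : ℝ, 0 < d → d ≤ δ →
          StringMass.IsPairing (StringMass.freq lam)
            (StringMass.closePairs (StringMass.freq lam) d)) ∧
      -- the two-sided estimate
      ∀ A : Set ℤ, StringMass.IsPairing (StringMass.freq lam) A →
        ∀ T : ℝ,
          2 * (StringMass.travelTime (-1) 0 ρ₁ σ₁ + StringMass.travelTime 0 1 ρ₂ σ₂) < T →
          ∃ C₁ C₂ : ℝ, 0 < C₁ ∧ 0 < C₂ ∧ ∀ a : ℤ → ℂ,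
            (StringMass.ddNorm (StringMass.freq lam) A a < ⊤ →
              ∃ f : ℝ → ℂ, StringMass.IsExpSum T (StringMass.freq lam) a f) ∧
            ∀ f : ℝ → ℂ, StringMass.IsExpSum T (StringMass.freq lam) a f →
              ENNReal.ofReal C₁ * StringMass.ddNorm (StringMass.freq lam) A a
                  ≤ ∫⁻ t in Set.Ioc (0 : ℝ) T, ‖f t‖ₑ ^ 2 ∧
              ∫⁻ t in Set.Ioc (0 : ℝ) T, ‖f t‖ₑ ^ 2
                  ≤ ENNReal.ofReal C₂ * StringMass.ddNorm (StringMass.freq lam) A a := by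
  obtain ⟨ω₀, K, C, L, X₀, F, h, hF⟩ := StringMass.exists_isCharacteristic h₁ h₂ hM
  obtain ⟨lam, hlam, hpos, hrange, s⟩ := h.exists_isSpectrum
  obtain ⟨δ, hδ, hgap⟩ := s.exists_two_gap h
  refine ⟨lam, hlam, hpos, ?_, ⟨δ, hδ, hgap, fun d hd hdδ =>
    StringMass.IsSpectrum.isPairing_closePairs hgap hd hdδ⟩, fun A hA T hT => ?_⟩
  · rw [hrange]
    ext l
    exact (hF l).symm
  · obtain ⟨κ, hκ, K', D, hb⟩ := s.exists_derivBounds h hA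
    have p1 := h.pos₁
    have p2 := h.pos₂
    -- The phase e^{ix(γ₁+γ₂)} moves the band [-(γ₁+γ₂), γ₁+γ₂] to [0, 2(γ₁+γ₂)], which lies in [0,
    -- T].
    exact hA.exists_expSum_estimate s.strictMono (by linarith)
      (((StringMass.isBand_expI _).mul h.band).mono (by linarith) (by linarith))
      (fun n => by simp [s.zero]) hκ hb
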